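/- Let $n\ge 1$, let $M$ be a closed smooth manifold of dimension $2n+1$ and let $(B,\pi)$ be an open book decomposition of $M$: $B\subset M$ is a closed submanifold of codimension $2$, $\pi:M\setminus B\to S^1$ is a smooth submersion, and there are $\delta_0>0$ and a diffeomorphism $\phi$ from $B\times B^2(\delta_0)$ onto an open neighbourhood of $B$ such that $\phi(p,0)=p$ and $\pi(\phi(p,r,\theta))=\theta$ for $r>0$, where $B^2(\delta)$ is the open disk of radius $\delta$ in $\mathbb R^2$ with polar coordinates $(r,\theta)$. Let $\alpha$ be a contact form on $M$, that is, a smooth $1$-form such that $\alpha\wedge(d\alpha)^n$ vanishes nowhere; orient $M$ by $\alpha\wedge(d\alpha)^n>0$, and orient $B$ so that $\phi$ preserves orientations along $B\times\{0\}$. Let $R$ be the Reeb vector field of $\alpha$ ($d\alpha(R,\cdot)=0$, $\alpha(R)=1$). Suppose that $\alpha$ supports $(B,\pi)$, i.e. $\alpha|_B$ is a positive contact form on $B$ (so $\alpha|_B\wedge(d\alpha|_B)^{n-1}>0$), $d\pi(R)>0$ on $M\setminus B$, and $R$ is tangent to $B$ along $B$. For $t\in S^1$ let $P_t=\overline{\pi^{-1}(t)}$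 be the page over $t$. Then: (1) There are $\delta>0$, a diffeomorphism $\psi$ from $B\times B^2(\delta)$ onto an open neighbourhood $U$ of $B$ with $\psi(p,0)=p$ and $\pi(\psi(p,r,\theta))=\theta$ for $r>0$, and a smooth function $g:B\times B^2(\delta)\to(0,\infty)$ such that $$\psi^*\alpha=g\cdot(\alpha|_B+r^2\,d\theta)\qquad\text{and}\qquad \partial_r g<0\ \text{ for } r>0 .$$ In particular $P_t\cap U=\psi(\{\theta=t\text{ or }r=0\})$ for every $t\in S^1$. (2) For every $t\in S^1$ the binding is a convex boundary of the page $P_t$ with respect to $\alpha|_{P_t}$, in the following sense. We have $P_t\setminus \pi^{-1}(t)=B$, and $d\alpha$ restricts to a symplectic form on the interior $\pi^{-1}(t)$. Let $X$ be the Liouville vector field on $\pi^{-1}(t)$, given by $i_X\,(d\alpha)|_{\pi^{-1}(t)}=\alpha|_{\pi^{-1}(t)}$. (The form $d\alpha|_{P_t}$ degenerates along $B$, and $X$ does not extend to $B$.) Then, near $B$, some positive multiple $fX$, with $f:\pi^{-1}(t)\to(0,\infty)$ defined near $B$, extends to a smooth vector field on a neighbourhood of $B$ in $P_t$ that along $B$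 is transverse to $B$ and points out of $P_t$. -/

import Mathlib

open scoped Manifold ContDiff

noncomputable section

namespace ContactOpenBook

universe u v

/-- A (not necessarily continuous) differential 1-form on a `d`-dimensional manifold. -/
abbrev OneForm (d : ℕ) (M : Type u) [TopologicalSpace M]
    [ChartedSpace (EuclideanSpace ℝ (Fin d)) M] : Type u :=
  (q : M) → TangentSpace (𝓡 d) q →L[ℝ] ℝ

section Forms

variable {d : ℕ} {M : Type u} [TopologicalSpace M] [ChartedSpace (EuclideanSpace ℝ (Fin d)) M]

/-- Smoothness of a 1-form, as a section of the cotangent bundle `Hom(TM, ℝ)`. -/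
def IsSmoothForm [IsManifold (𝓡 d) ∞ M] (α : OneForm d M) : Prop :=
  ContMDiff (𝓡 d) ((𝓡 d).prod 𝓘(ℝ, EuclideanSpace ℝ (Fin d) →L[ℝ] ℝ)) ∞
    (fun q => (Bundle.TotalSpace.mk' (EuclideanSpace ℝ (Fin d) →L[ℝ] ℝ) q (α q) :
      Bundle.TotalSpace (EuclideanSpace ℝ (Fin d) →L[ℝ] ℝ)
        (fun x : M => TangentSpace (𝓡 d) x →L[ℝ] Bundle.Trivial M ℝ x)))

/-- The coordinate expression of a 1-form in the preferred chart at `x`, i.e. its pullback by the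
inverse of that chart. -/
def localForm (α : OneForm d M) (x : M) (y : EuclideanSpace ℝ (Fin d)) :
    EuclideanSpace ℝ (Fin d) →L[ℝ] ℝ :=
  (α ((extChartAt (𝓡 d) x).symm y)).comp
    (mfderiv 𝓘(ℝ, EuclideanSpace ℝ (Fin d)) (𝓡 d) (extChartAt (𝓡 d) x).symm y)

/-- The exterior derivative `dα` of a 1-form at `q`, evaluated on two tangent vectors: with `β`
the coordinate expression of `α` in the chart at `q`, it is `∂_v β (w) - ∂_w β (v)`. -/
def dForm (α : OneForm d M) (q : M) (v w : TangentSpace (𝓡 d) q) : ℝ :=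
  let D := fderiv ℝ (localForm α q) (extChartAt (𝓡 d) q q)
  let v' : EuclideanSpace ℝ (Fin d) :=
    mfderiv (𝓡 d) 𝓘(ℝ, EuclideanSpace ℝ (Fin d)) (extChartAt (𝓡 d) q) q v
  let w' : EuclideanSpace ℝ (Fin d) :=
    mfderiv (𝓡 d) 𝓘(ℝ, EuclideanSpace ℝ (Fin d)) (extChartAt (𝓡 d) q) q w
  D v' w' - D w' v'

end Forms

/-- The value of `a ∧ wⁿ` on `2n+1` vectors, up to a positive constant that depends only on `n`
and on the normalization of the wedge product: the antisymmetrization of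
`a(v₀) w(v₁, v₂) ⋯ w(v₂ₙ₋₁, v₂ₙ)`. -/
def contactVolume {V : Type*} (n : ℕ) (a : V → ℝ) (w : V → V → ℝ) (v : Fin (2 * n + 1) → V) : ℝ :=
  ∑ σ : Equiv.Perm (Fin (2 * n + 1)), ((Equiv.Perm.sign σ : ℤ) : ℝ) *
    (a (v (σ 0)) * ∏ i : Fin n,
      w (v (σ ⟨2 * (i : ℕ) + 1, by omega⟩)) (v (σ ⟨2 * (i : ℕ) + 2, by omega⟩)))

section Contact

variable {n : ℕ} {M : Type u} [TopologicalSpace M]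
  [ChartedSpace (EuclideanSpace ℝ (Fin (2 * n + 1))) M]

/-- `(α ∧ (dα)ⁿ)_q (v₀, …, v₂ₙ)`, up to a positive constant. A contact form orients the manifold
by declaring the frames on which this number is positive to be the positive ones. -/
def formVolume (α : OneForm (2 * n + 1) M) (q : M)
    (v : Fin (2 * n + 1) → TangentSpace (𝓡 (2 * n + 1)) q) : ℝ :=
  contactVolume n (fun x => α q x) (dForm α q) v

/-- A contact form on a `(2n+1)`-dimensional manifold: a smooth 1-form for which `α ∧ (dα)ⁿ`
vanishes nowhere. -/
structure IsContactForm [IsManifold (𝓡 (2 * n + 1)) ∞ M] (α : OneForm (2 * n + 1) M) : Prop where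
  smooth : IsSmoothForm α
  volume_ne_zero : ∀ q : M, ∃ v : Fin (2 * n + 1) → TangentSpace (𝓡 (2 * n + 1)) q,
    formVolume α q v ≠ 0

/-- `R` is the value at `q` of the Reeb vector field of `α`. -/
def IsReebVector (α : OneForm (2 * n + 1) M) (q : M) (R : TangentSpace (𝓡 (2 * n + 1)) q) : Prop :=
  (∀ w : TangentSpace (𝓡 (2 * n + 1)) q, dForm α q R w = 0) ∧ α q R = 1

end Contact

section AngularForm

variable {d : ℕ} {M : Type u} [TopologicalSpace M] [ChartedSpace (EuclideanSpace ℝ (Fin d)) M]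

/-- The differential of a circle-valued map, the tangent lines of the circle being identified with
`ℝ` through the angular vector field `∂_θ`; that is, the 1-form `π^* dθ`. -/
def angularForm (π : M → Circle) : OneForm d M := fun q =>
  (Complex.imCLM.comp (ContinuousLinearMap.mul ℝ ℂ (starRingEnd ℂ (π q : ℂ)))).comp
    (mfderiv (𝓡 d) 𝓘(ℝ, ℂ) (fun x => (π x : ℂ)) q)

end AngularForm

section OpenBook

variable {b d : ℕ}
  {B : Type v} [TopologicalSpace B] [ChartedSpace (EuclideanSpace ℝ (Fin b)) B]
  {M : Type u} [TopologicalSpace M] [ChartedSpace (EuclideanSpace ℝ (Fin d)) M]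

/-- `ψ` is a trivialization, adapted to `π`, of a tubular neighbourhood of the binding `ι(B)`:
a diffeomorphism of `B × B²(δ)` onto an open set of `M` (the target of `ψ`) which is `ι` on
`B × {0}` and satisfies `π(ψ(p, r e^{iθ})) = e^{iθ}` for `r > 0`. The disk `B²(δ)` is the open disk
in `ℂ = ℝ²`. -/
structure IsBindingTrivialization (ι : B → M) (π : M → Circle) (δ : ℝ)
    (ψ : PartialDiffeomorph ((𝓡 b).prod 𝓘(ℝ, ℂ)) (𝓡 d) (B × ℂ) M ∞) : Prop where
  pos : 0 < δ
  source_eq : ψ.source = Set.univ ×ˢ Metric.ball (0 : ℂ) δ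
  zero_section : ∀ p : B, ψ (p, 0) = ι p
  angle : ∀ (p : B) (r : ℝ) (u : Circle), 0 < r → r < δ → π (ψ (p, r • (u : ℂ))) = u

/-- `(ι(B), π)` is an open book decomposition of `M`: the map `π`, whose values on `ι(B)` are
irrelevant, is a smooth submersion of `M \ ι(B)` to the circle. -/
structure IsOpenBook [IsManifold (𝓡 b) ∞ B] [IsManifold (𝓡 d) ∞ M]
    (ι : B → M) (π : M → Circle) : Prop where
  codim : b + 2 = d
  embedding : Manifold.IsSmoothEmbedding (𝓡 b) (𝓡 d) ∞ ι
  submersion : ∀ q : M, q ∉ Set.range ι → Manifold.IsSubmersionAt (𝓡 d) (𝓡 1) ∞ π q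
  tubular : ∃ (δ : ℝ) (φ : PartialDiffeomorph ((𝓡 b).prod 𝓘(ℝ, ℂ)) (𝓡 d) (B × ℂ) M ∞),
    IsBindingTrivialization ι π δ φ

/-- The fibre of `π : M \ ι(B) → S¹` over `t`. -/
def openPage (ι : B → M) (π : M → Circle) (t : Circle) : Set M :=
  {q | q ∉ Set.range ι ∧ π q = t}

/-- The page over `t`. -/
def page (ι : B → M) (π : M → Circle) (t : Circle) : Set M :=
  closure (openPage ι π t)

/-- The restriction of a 1-form on `M` to `B`. -/
def restrictForm (ι : B → M) (α : OneForm d M) : OneForm b B := fun p =>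
  (α (ι p)).comp (mfderiv (𝓡 b) (𝓡 d) ι p)

/-- `X` is the value at `q ∉ ι(B)` of the Liouville vector field of `α` restricted to the page
through `q`, whose tangent space is `ker d_qπ`: `X` is tangent to the page, and `i_X dα = α` on
the page. -/
def IsLiouvilleVector (π : M → Circle) (α : OneForm d M) (q : M) (X : TangentSpace (𝓡 d) q) :
    Prop :=
  angularForm π q X = 0 ∧
    ∀ w : TangentSpace (𝓡 d) q, angularForm π q w = 0 → dForm α q X w = α q w

/-- `v`, a tangent vector of `M` at the binding point `ι p`, is tangent to the page over `t`,
transverse to its boundary `ι(B)`, and points outwards: it is not tangent to `ι(B)`, and `-v` is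
the initial velocity of a smooth curve that enters the interior of the page. -/
def IsOutward (ι : B → M) (π : M → Circle) (t : Circle) (p : B)
    (v : TangentSpace (𝓡 d) (ι p)) : Prop :=
  (∀ w : TangentSpace (𝓡 b) p, mfderiv (𝓡 b) (𝓡 d) ι p w ≠ v) ∧
    ∃ γ : ℝ → M, ContMDiffAt 𝓘(ℝ, ℝ) (𝓡 d) ∞ γ 0 ∧
      (⟨γ 0, mfderiv 𝓘(ℝ, ℝ) (𝓡 d) γ 0 (1 : ℝ)⟩ : TangentBundle (𝓡 d) M) = ⟨ι p, -v⟩ ∧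
      ∀ᶠ s in nhdsWithin (0 : ℝ) (Set.Ioi 0), γ s ∈ openPage ι π t

/-- The binding is a convex boundary of the page `P` over `t`, with respect to `α` restricted to
`P`. The form `dα` on `P` is symplectic in the interior of `P` but degenerate along the binding,
and the Liouville field `X` is defined in the interior only. Convexity means that the direction
of `X` extends to the boundary, where it is transverse and points outwards: some positive multiple
`Y = f X` extends smoothly over the boundary, to an outward pointing field. (If `X` itself extends,
this says that `X` is transverse to the boundary and points outwards.) -/
structure IsConvexBoundary [IsManifold (𝓡 d) ∞ M] (ι : B → M) (π : M → Circle)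
    (α : OneForm d M) (t : Circle) : Prop where
  boundary_eq : page ι π t \ openPage ι π t = Set.range ι
  symplectic : ∀ q ∈ openPage ι π t, ∀ v : TangentSpace (𝓡 d) q, angularForm π q v = 0 →
    (∀ w : TangentSpace (𝓡 d) q, angularForm π q w = 0 → dForm α q v w = 0) → v = 0
  convex : ∃ (N : Set M) (Y : (q : M) → TangentSpace (𝓡 d) q),
    IsOpen N ∧ Set.range ι ⊆ N ∧
    ContMDiffOn (𝓡 d) (𝓡 d).tangent ∞ (fun q => (⟨q, Y q⟩ : TangentBundle (𝓡 d) M)) N ∧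
    (∀ q ∈ N ∩ openPage ι π t, ∃ (f : ℝ) (X : TangentSpace (𝓡 d) q),
      0 < f ∧ IsLiouvilleVector π α q X ∧ Y q = f • X) ∧
    ∀ p : B, IsOutward (b := b) ι π t p (Y (ι p))

end OpenBook

section Supports

variable {n : ℕ}
  {B : Type v} [TopologicalSpace B] [ChartedSpace (EuclideanSpace ℝ (Fin (2 * n + 1))) B]
  {M : Type u} [TopologicalSpace M] [ChartedSpace (EuclideanSpace ℝ (Fin (2 * (n + 1) + 1))) M]

/-- The frame of `T_{ι p} M` formed by the images of `2n+1` tangent vectors of `B` at `p`, followed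
by the images of the coordinate vectors `∂_x`, `∂_y` of the disk under a trivialization `φ`. -/
def bindingFrame (ι : B → M)
    (φ : PartialDiffeomorph ((𝓡 (2 * n + 1)).prod 𝓘(ℝ, ℂ)) (𝓡 (2 * (n + 1) + 1)) (B × ℂ) M ∞)
    (p : B) (v : Fin (2 * n + 1) → TangentSpace (𝓡 (2 * n + 1)) p) :
    Fin (2 * (n + 1) + 1) → TangentSpace (𝓡 (2 * (n + 1) + 1)) (ι p) :=
  Fin.snoc (n := 2 * n + 2) (α := fun _ => EuclideanSpace ℝ (Fin (2 * (n + 1) + 1)))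
    (Fin.snoc (n := 2 * n + 1) (α := fun _ => EuclideanSpace ℝ (Fin (2 * (n + 1) + 1)))
      (fun i => mfderiv (𝓡 (2 * n + 1)) (𝓡 (2 * (n + 1) + 1)) ι p (v i))
      (mfderiv ((𝓡 (2 * n + 1)).prod 𝓘(ℝ, ℂ)) (𝓡 (2 * (n + 1) + 1)) φ (p, 0)
        ((0, (1 : ℂ)) : EuclideanSpace ℝ (Fin (2 * n + 1)) × ℂ)))
    (mfderiv ((𝓡 (2 * n + 1)).prod 𝓘(ℝ, ℂ)) (𝓡 (2 * (n + 1) + 1)) φ (p, 0)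
      ((0, Complex.I) : EuclideanSpace ℝ (Fin (2 * n + 1)) × ℂ))

/-- The contact form `α` supports the open book `(ι(B), π)`. The manifold `M` is oriented by
`α ∧ (dα)ⁿ⁺¹ > 0` and the binding is oriented so that `M` has the product orientation of
`B × B²(δ)` near it. -/
structure Supports [IsManifold (𝓡 (2 * n + 1)) ∞ B] [IsManifold (𝓡 (2 * (n + 1) + 1)) ∞ M]
    (ι : B → M) (π : M → Circle) (α : OneForm (2 * (n + 1) + 1) M) : Prop where
  contact : IsContactForm α
  binding_contact : IsContactForm (restrictForm ι α : OneForm (2 * n + 1) B)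
  /-- `α_B ∧ (dα_B)ⁿ > 0` for the orientation of the binding. -/
  binding_positive : ∀ (δ : ℝ)
    (φ : PartialDiffeomorph ((𝓡 (2 * n + 1)).prod 𝓘(ℝ, ℂ)) (𝓡 (2 * (n + 1) + 1)) (B × ℂ) M ∞),
    IsBindingTrivialization ι π δ φ →
    ∀ (p : B) (v : Fin (2 * n + 1) → TangentSpace (𝓡 (2 * n + 1)) p),
      0 < formVolume α (ι p) (bindingFrame ι φ p v) →
      0 < formVolume (restrictForm ι α : OneForm (2 * n + 1) B) p v
  reeb_transverse : ∀ (q : M) (R : TangentSpace (𝓡 (2 * (n + 1) + 1)) q), q ∉ Set.range ι →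
    IsReebVector α q R → 0 < angularForm π q R
  reeb_tangent : ∀ (p : B) (R : TangentSpace (𝓡 (2 * (n + 1) + 1)) (ι p)),
    IsReebVector α (ι p) R →
    ∃ w : TangentSpace (𝓡 (2 * n + 1)) p,
      mfderiv (𝓡 (2 * n + 1)) (𝓡 (2 * (n + 1) + 1)) ι p w = R

end Supports

end ContactOpenBook

end

/-! Near the binding, α restricts to a contact form on every slice B × {z} of a tubular
neighbourhood B × disk, because it does so on B itself. Hence a vector ζ of the disk has exactly one
lift (v, ζ) that lies in ker α and is dα-orthogonal to the contact planes of the slice: together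
with a multiplier it solves a linear system that is invertible exactly where the slice is contact
(`isCharacteristic_iff_exists`, `exists_characteristic_field`). Following the lifted radii and using
their starting points as new coordinates on B keeps the angle and makes the radii themselves
characteristic (`exists_radial_map`, `IsBindingTrivialization.exists_radial`).

Let Z be a radial vector in such coordinates. Then α(Z) = 0, and i_Z dα is a multiple of α on the
slices. So moving along Z only scales α on the slices, which gives the term G α_B. On the disk {p} ×
B²(δ) the form α kills Z, so it is K r² dθ with K(z) = ∫ s κ(sz) ds over [0, 1], where κ = dα(∂_x,
∂_y). Therefore α = G α_B + K r² dθ (`IsRadial.exists_normal_form`).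

The sign of K comes from the binding. There the Reeb field is tangent to B, so the disk directions
are dα-orthogonal to all of TB, and the volume form of α splits into a positive constant times κ
times the volume form of α_B (`formVolume_bindingFrame`). The orientation of B forces κ > 0, so K =
κ/2 > 0 along B. Rescaling the radius by √(K/G) turns the normal form into g (α_B + r² dθ)
(`exists_isModel`).

The rest is read off from the contraction of dα with ∂_r, which is g_r (α_B + r² dθ) + 2 g r dθ
(`IsModel.dFormAt_radial`). On the Reeb field this must vanish, while α(R) = 1 and dθ(R) > 0, so g_r
< 0. On a page dθ = 0, so i_{∂_r} dα = g_r α_B and α = g α_B: the Liouville field is (g / g_r) ∂_r.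
Its positive multiple -∂_r extends over the binding and points outwards. That the pages are
symplectic only uses that the Reeb field is transverse to them.

The analytic input is smooth dependence of the lifted radii on their data. It follows from the
inverse function theorem in the Banach space of continuous curves (`exists_smooth_solution_family`).

In Lean the dimension of M is 2(n+1)+1 and that of B is 2n+1, so the integer n ≥ 1 of the text is n
+ 1 here. -/

noncomputable section

namespace ContactOpenBook

universe u v

set_option linter.unusedSectionVars false

/-! ### Superposition operators on spaces of continuous functions. -/

section Superposition

variable {K : Type} [TopologicalSpace K] [CompactSpace K]
  {V W : Type} [NormedAddCommGroup V] [NormedSpace ℝ V] [NormedAddCommGroup W] [NormedSpace ℝ W]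

/-- Pointwise application of a family of continuous linear maps to a family of vectors. -/
def pointwiseApply : C(K, V →L[ℝ] W) →L[ℝ] C(K, V) →L[ℝ] C(K, W) :=
  LinearMap.mkContinuous₂
    (LinearMap.mk₂ ℝ (fun (A : C(K, V →L[ℝ] W)) (v : C(K, V)) =>
        (⟨fun s => A s (v s), by fun_prop⟩ : C(K, W)))
      (fun A A' v => by ext s; simp) (fun c A v => by ext s; simp)
      (fun A v v' => by ext s; simp) (fun c A v => by ext s; simp)) 1
    (fun A v => by
      rw [one_mul]
      refine (ContinuousMap.norm_le _ (by positivity)).2 fun s => ?_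
      exact ((A s).le_opNorm (v s)).trans
        (mul_le_mul (A.norm_coe_le_norm s) (v.norm_coe_le_norm s) (norm_nonneg _)
          ((norm_nonneg (A s)).trans (A.norm_coe_le_norm s))))

/-- The range of `u` is compact, so `fderiv ℝ F` is uniformly continuous there. The mean value
inequality then bounds the first-order remainder uniformly over `K`, as the sup norm requires. -/
lemma hasFDerivAt_superposition {F : V → W} (hF : ContDiff ℝ 1 F) (u : C(K, V)) :
    HasFDerivAt (fun u : C(K, V) => (⟨F, hF.continuous⟩ : C(V, W)).comp u)
      (pointwiseApply ((⟨fderiv ℝ F, hF.continuous_fderiv one_ne_zero⟩ : C(V, V →L[ℝ] W)).comp u))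
      u := by
  rw [hasFDerivAt_iff_isLittleO_nhds_zero, Asymptotics.isLittleO_iff]
  intro c hc
  have hK : IsCompact (Set.range u) := isCompact_range u.continuous
  have h1 := hK.uniformContinuousAt_of_continuousAt (fderiv ℝ F)
    (fun a _ => (hF.continuous_fderiv one_ne_zero).continuousAt) (Metric.dist_mem_uniformity hc)
  obtain ⟨ε, hε, h2⟩ := Metric.mem_uniformity_dist.1 h1
  filter_upwards [Metric.ball_mem_nhds (0 : C(K, V)) hε] with h hh
  rw [mem_ball_zero_iff] at hh
  refine (ContinuousMap.norm_le _ (by positivity)).2 fun s => ?_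
  have hs : ‖h s‖ < ε := (h.norm_coe_le_norm s).trans_lt hh
  have key := (convex_ball (u s) ε).norm_image_sub_le_of_norm_hasFDerivWithin_le'
    (f := F) (f' := fderiv ℝ F) (φ := fderiv ℝ F (u s)) (C := c) (x := u s) (y := u s + h s)
    (fun x _ => (hF.differentiable one_ne_zero x).hasFDerivAt.hasFDerivWithinAt)
    (fun x hx => by
      have := h2 (a := u s) (b := x) (by rw [dist_comm]; exact hx) (Set.mem_range_self s)
      rw [Set.mem_ofPred_eq, dist_comm, dist_eq_norm] at this
      exact this.le)
    (Metric.mem_ball_self hε) (by simpa [Metric.mem_ball, dist_eq_norm] using hs)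
  rw [add_sub_cancel_left] at key
  exact key.trans (mul_le_mul_of_nonneg_left (h.norm_coe_le_norm s) hc.le)

/-- The derivative of superposition with `F` is superposition with `fderiv ℝ F` followed by a
continuous linear map, so the order rises by induction. The target `W` has to vary, since it changes
from `F` to `fderiv ℝ F`. -/
lemma contDiff_superposition_nat (n : ℕ) : ∀ {W : Type} [NormedAddCommGroup W] [NormedSpace ℝ W]
    {F : V → W} (hF : ContDiff ℝ ∞ F),
    ContDiff ℝ n (fun u : C(K, V) => (⟨F, hF.continuous⟩ : C(V, W)).comp u) := by
  induction n with
  | zero =>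
    intro W _ _ F hF
    exact contDiff_zero.2 (ContinuousMap.continuous_postcomp _)
  | succ n ih =>
    intro W _ _ F hF
    have hF' : ContDiff ℝ ∞ (fderiv ℝ F) := (contDiff_infty_iff_fderiv.1 hF).2
    have h := (ContinuousLinearMap.contDiff (pointwiseApply (K := K) (V := V) (W := W))).comp
      (ih hF')
    exact contDiff_succ_iff_hasFDerivAt.2
      ⟨_, h, fun u => hasFDerivAt_superposition (hF.of_le (by exact_mod_cast le_top)) u⟩

/-- Superposition with a smooth function is a smooth operator on continuous functions. -/
lemma contDiff_superposition {F : V → W} (hF : ContDiff ℝ ∞ F) :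
    ContDiff ℝ ∞ (fun u : C(K, V) => (⟨F, hF.continuous⟩ : C(V, W)).comp u) :=
  contDiff_infty.2 fun n => contDiff_superposition_nat n hF

end Superposition

/-! ### The inverse function theorem with a smooth inverse. -/

section Inverse

variable {X Y : Type*} [NormedAddCommGroup X] [NormedSpace ℝ X] [CompleteSpace X]
  [NormedAddCommGroup Y] [NormedSpace ℝ Y]

/-- The inverse function theorem, with an inverse that is smooth on its whole domain. -/
lemma exists_smooth_local_inverse {f : X → Y} {U : Set X} (hU : IsOpen U)
    (hf : ContDiffOn ℝ ∞ f U) {x : X} (hx : x ∈ U) {f' : X ≃L[ℝ] Y}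
    (hf' : HasFDerivAt f (f' : X →L[ℝ] Y) x) :
    ∃ e : OpenPartialHomeomorph X Y, x ∈ e.source ∧ e.source ⊆ U ∧ (∀ y, e y = f y) ∧
      ContDiffOn ℝ ∞ e.symm e.target := by
  have hfx : ContDiffAt ℝ ∞ f x := hf.contDiffAt (hU.mem_nhds hx)
  let e₀ := hfx.toOpenPartialHomeomorph f hf' (by simp)
  have hc : ContinuousOn (fderiv ℝ f) U := hf.continuousOn_fderiv_of_isOpen hU (by simp)
  -- Invertibility of the derivative is an open condition. On this smaller source the inverse is
  -- smooth at every point of its domain, not only at the image of `x`.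
  have hop : IsOpen (U ∩ fderiv ℝ f ⁻¹' Set.range ((↑) : (X ≃L[ℝ] Y) → X →L[ℝ] Y)) :=
    hc.isOpen_inter_preimage hU ContinuousLinearEquiv.isOpen
  refine ⟨e₀.restrOpen _ hop, ?_, ?_, fun y => rfl, ?_⟩
  · rw [OpenPartialHomeomorph.restrOpen_source]
    exact ⟨hfx.mem_toOpenPartialHomeomorph_source hf' (by simp), hx, f', hf'.fderiv.symm⟩
  · rw [OpenPartialHomeomorph.restrOpen_source]
    exact fun y hy => hy.2.1
  · intro y hy
    have hy' := (e₀.restrOpen _ hop).map_target hy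
    rw [OpenPartialHomeomorph.restrOpen_source] at hy'
    obtain ⟨hs, hyU, g, hg⟩ := hy'
    refine ContDiffAt.contDiffWithinAt ?_
    have hfd : ContDiffAt ℝ ∞ f ((e₀.restrOpen _ hop).symm y) := hf.contDiffAt (hU.mem_nhds hyU)
    exact (e₀.restrOpen _ hop).contDiffAt_symm hy (f₀' := g)
      (by rw [hg]; exact (hfd.differentiableAt (by simp)).hasFDerivAt) hfd

end Inverse

/-! ### Integrals and ordinary differential equations depending on parameters. -/

section Family


/-- The unit interval. -/
abbrev I01 : Type := Set.Icc (0 : ℝ) 1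

variable {E P : Type} [NormedAddCommGroup E] [NormedSpace ℝ E]
  [NormedAddCommGroup P] [NormedSpace ℝ P]

/-- Extension of a function on the unit interval to a constant function outside. -/
abbrev extendI (u : C(I01, E)) : C(ℝ, E) := u.IccExtend zero_le_one

lemma norm_extendI_le (u : C(I01, E)) (s : ℝ) : ‖extendI u s‖ ≤ ‖u‖ := u.norm_coe_le_norm _

lemma extendI_apply (u : C(I01, E)) (s : I01) : extendI u s = u s := by
  simp [extendI, ContinuousMap.IccExtend, Set.IccExtend_val]

/-- The operator that sends `u` to its primitive vanishing at `0`. -/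
def primitive : C(I01, E) →L[ℝ] C(I01, E) :=
  LinearMap.mkContinuous
    { toFun := fun u => ⟨fun s => ∫ τ in (0 : ℝ)..s, extendI u τ,
        (intervalIntegral.continuous_primitive
          (fun a b => (extendI u).continuous.intervalIntegrable a b) 0).comp
            continuous_subtype_val⟩
      map_add' := fun u v => by
        ext s
        have h : ∀ τ, extendI (u + v) τ = extendI u τ + extendI v τ := fun τ => rfl
        simp only [ContinuousMap.coe_mk, ContinuousMap.add_apply, h]
        exact intervalIntegral.integral_add ((extendI u).continuous.intervalIntegrable _ _)
          ((extendI v).continuous.intervalIntegrable _ _)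
      map_smul' := fun c u => by
        ext s
        have h : ∀ τ, extendI (c • u) τ = c • extendI u τ := fun τ => rfl
        simp [h] } 1
    (fun u => by
      rw [one_mul]
      refine (ContinuousMap.norm_le _ (norm_nonneg _)).2 fun s => ?_
      have h := intervalIntegral.norm_integral_le_of_norm_le_const (a := 0) (b := (s : ℝ))
        (f := extendI u) (C := ‖u‖) (fun τ _ => norm_extendI_le u τ)
      refine h.trans (mul_le_of_le_one_right (norm_nonneg _) ?_)
      rw [sub_zero, abs_of_nonneg s.2.1]
      exact s.2.2)

lemma primitive_apply (u : C(I01, E)) (s : I01) :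
    primitive u s = ∫ τ in (0 : ℝ)..s, extendI u τ := rfl

/-- The constant functions, as a continuous linear map. -/
def constI : E →L[ℝ] C(I01, E) :=
  LinearMap.mkContinuous
    { toFun := fun x => ContinuousMap.const _ x
      map_add' := fun _ _ => rfl
      map_smul' := fun _ _ => rfl } 1
    (fun x => by
      rw [one_mul]
      exact (ContinuousMap.norm_le _ (norm_nonneg _)).2 fun s => le_rfl)

@[simp] lemma constI_apply (x : E) (s : I01) : constI x s = x := rfl

/-- The inclusion of the unit interval in the line. -/
def inclI : C(I01, ℝ) := ⟨fun s => s, continuous_subtype_val⟩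

@[simp] lemma inclI_apply (s : I01) : inclI s = s := rfl

/-- The graph map `(u, z) ↦ (s ↦ (s, u(s), z))`. -/
def graphI (x : C(I01, E) × P) : C(I01, ℝ × E × P) :=
  inclI.prodMk (x.1.prodMk (ContinuousMap.const _ x.2))

@[simp] lemma graphI_apply (x : C(I01, E) × P) (s : I01) : graphI x s = (↑s, x.1 s, x.2) := rfl

/-- This form shows that the graph map is affine and continuous, hence smooth. -/
lemma graphI_eq (x : C(I01, E) × P) : graphI x =
    ((ContinuousLinearMap.inl ℝ ℝ (E × P)).compLeftContinuous ℝ I01 inclI) +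
    (((ContinuousLinearMap.inr ℝ ℝ (E × P)).comp (ContinuousLinearMap.inl ℝ E P)).compLeftContinuous
      ℝ I01 x.1 + constI (0, 0, x.2)) := by
  ext s <;> simp [ContinuousLinearMap.compLeftContinuous]

lemma contDiff_graphI : ContDiff ℝ ∞ (graphI : C(I01, E) × P → C(I01, ℝ × E × P)) := by
  have : (graphI : C(I01, E) × P → C(I01, ℝ × E × P)) = fun x => _ := funext graphI_eq
  rw [this]
  refine contDiff_const.add ((ContinuousLinearMap.contDiff _).comp contDiff_fst |>.add ?_)
  exact (ContinuousLinearMap.contDiff (constI (E := ℝ × E × P))).comp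
    (contDiff_const.prodMk (contDiff_const.prodMk contDiff_snd))

variable [CompleteSpace E]

/-- Smooth dependence of an integral on parameters. -/
lemma contDiff_integral_parameter {F : ℝ × P → E} (hF : ContDiff ℝ ∞ F) :
    ContDiff ℝ ∞ (fun x : P => ∫ s in (0 : ℝ)..1, F (s, x)) := by
  -- A dummy argument in `E` is added, to be fed the zero curve; the integral is then the value at 1
  -- of a primitive of a superposition.
  have hF' : ContDiff ℝ ∞ (fun q : ℝ × E × P => F (q.1, q.2.2)) :=
    hF.comp (contDiff_fst.prodMk (contDiff_snd.comp contDiff_snd))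
  have h := (ContinuousLinearMap.contDiff ((ContinuousMap.evalCLM ℝ
    (⟨1, by simp⟩ : I01)).comp (primitive (E := E)))).comp
    ((contDiff_superposition (K := I01) hF').comp ((contDiff_graphI (E := E) (P := P)).comp
      ((contDiff_const (c := (0 : C(I01, E)))).prodMk contDiff_id)))
  refine (funext fun x => ?_ : (fun x : P => ∫ s in (0 : ℝ)..1, F (s, x)) = _) ▸ h
  symm
  refine intervalIntegral.integral_congr fun s hs => ?_
  rw [Set.uIcc_of_le zero_le_one] at hs
  exact extendI_apply _ (⟨s, hs⟩ : I01)

variable [CompleteSpace P]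

/-- A smooth time-dependent vector field depending on a parameter `z` and vanishing for `z = 0`
has solutions on `[0, 1]` for small `z`, which depend smoothly on the initial value and on `z`. -/
lemma exists_smooth_solution_family {F : ℝ × E × P → E} (hF : ContDiff ℝ ∞ F)
    (h0 : ∀ s y, F (s, y, 0) = 0) (y₀ : E) {N : Set E} (hN : N ∈ nhds y₀) :
    ∃ (U : Set (E × P)) (u : ℝ → E × P → E), IsOpen U ∧ (y₀, 0) ∈ U ∧
      ContDiffOn ℝ ∞ (u 1) U ∧ (∀ x, u 0 x = x.1) ∧
      ∀ x ∈ U, ∀ s ∈ Set.Icc (0 : ℝ) 1,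
        HasDerivAt (fun τ => u τ x) (F (s, u s x, x.2)) s ∧ u s x ∈ N := by
  -- `Q` is the Picard operator. The integral equation for the solution with initial value y and
  -- parameter z is `T (u, z) = (constI y, z)`, so solving it smoothly means inverting `T` near the
  -- constant curve `y₀`.
  set Q : C(I01, E) × P → C(I01, E) := fun x =>
    primitive ((⟨F, hF.continuous⟩ : C(ℝ × E × P, E)).comp (graphI x)) with hQ
  have hQs : ContDiff ℝ ∞ Q := (ContinuousLinearMap.contDiff (primitive (E := E))).comp
    ((contDiff_superposition (K := I01) hF).comp contDiff_graphI)
  set T : C(I01, E) × P → C(I01, E) × P := fun x => (x.1 - Q x, x.2) with hT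
  have hTs : ContDiff ℝ ∞ T := (contDiff_fst.sub hQs).prodMk contDiff_snd
  set x₀ : C(I01, E) × P := (constI y₀, 0)
  have hQ0 : ∀ v, Q (v, 0) = 0 := fun v => by
    ext s
    simp only [hQ, primitive_apply, ContinuousMap.zero_apply]
    have : ∀ τ, extendI ((⟨F, hF.continuous⟩ : C(ℝ × E × P, E)).comp (graphI (v, (0 : P)))) τ = 0 :=
      fun τ => h0 _ _
    simp [this]
  set D := fderiv ℝ Q x₀
  have hD : HasFDerivAt Q D x₀ := (hQs.differentiable (by simp) x₀).hasFDerivAt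
  have hD0 : ∀ v, D (v, 0) = 0 := fun v => by
    have h1 : HasFDerivAt (fun v : C(I01, E) => Q (v, 0))
        (D.comp (ContinuousLinearMap.inl ℝ C(I01, E) P)) (constI y₀) :=
      hD.comp (f := fun v : C(I01, E) => ((v, 0) : C(I01, E) × P)) (constI y₀)
        (hasFDerivAt_prodMk_left _ _)
    have h2 : HasFDerivAt (fun v : C(I01, E) => Q (v, 0)) (0 : C(I01, E) →L[ℝ] C(I01, E))
        (constI y₀) := by
      simp only [hQ0]
      exact hasFDerivAt_const _ _
    exact DFunLike.congr_fun (h1.unique h2) v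
  have hDs : ∀ x, D x = D (0, x.2) := fun x => by
    have : x = (x.1, 0) + (0, x.2) := by simp
    conv_lhs => rw [this, map_add, hD0, zero_add]
  -- Since `F` vanishes for z = 0, so does `Q`, and `D` only sees the parameter component. Hence the
  -- derivative of `T` is unipotent, and its inverse is found by changing the sign of `D`.
  let T' : (C(I01, E) × P) ≃L[ℝ] (C(I01, E) × P) :=
    ContinuousLinearEquiv.equivOfInverse
      ((ContinuousLinearMap.fst ℝ _ _ - D).prod (ContinuousLinearMap.snd ℝ _ _))
      ((ContinuousLinearMap.fst ℝ _ _ + D).prod (ContinuousLinearMap.snd ℝ _ _))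
      (fun x => by
        ext1
        · simp only [ContinuousLinearMap.prod_apply, add_apply,
            sub_apply, ContinuousLinearMap.coe_fst',
            ContinuousLinearMap.coe_snd']
          rw [hDs (x.1 - D x, x.2), hDs x, sub_add_cancel]
        · rfl)
      (fun x => by
        ext1
        · simp only [ContinuousLinearMap.prod_apply, add_apply,
            sub_apply, ContinuousLinearMap.coe_fst',
            ContinuousLinearMap.coe_snd']
          rw [hDs (x.1 + D x, x.2), hDs x, add_sub_cancel_right]
        · rfl)
  have hT' : HasFDerivAt T (T' : (C(I01, E) × P) →L[ℝ] (C(I01, E) × P)) x₀ :=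
    (hasFDerivAt_fst.sub hD).prodMk hasFDerivAt_snd
  obtain ⟨ρ, hρ, hρN⟩ := Metric.mem_nhds_iff.1 hN
  set O : Set (C(I01, E) × P) := {x | x.1 ∈ Metric.ball (constI y₀ : C(I01, E)) ρ}
  have hO : IsOpen O := Metric.isOpen_ball.preimage continuous_fst
  obtain ⟨e, hex, heO, heT, hes⟩ := exists_smooth_local_inverse hO hTs.contDiffOn
    (show x₀ ∈ O from Metric.mem_ball_self hρ) hT'
  have hTx₀ : T x₀ = x₀ := by simp [hT, x₀, hQ0]
  set c : E × P → C(I01, E) × P := fun x => (constI x.1, x.2)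
  have hc : ContDiff ℝ ∞ c :=
    ((ContinuousLinearMap.contDiff (constI (E := E))).comp contDiff_fst).prodMk contDiff_snd
  set H : E × P → C(I01, E) := fun x => (e.symm (c x)).1
  set f : E × P → C(I01, E) := fun x => (⟨F, hF.continuous⟩ : C(ℝ × E × P, E)).comp
    (graphI (H x, x.2))
  have hfix : ∀ x ∈ c ⁻¹' e.target, e.symm (c x) = (H x, x.2) ∧ H x = constI x.1 + primitive (f x) := by
    intro x hx
    have h1 : T (e.symm (c x)) = c x := by rw [← heT]; exact e.right_inv hx
    have h2 : (e.symm (c x)).2 = x.2 := congrArg Prod.snd h1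
    have h3 : e.symm (c x) = (H x, x.2) := Prod.ext rfl h2
    refine ⟨h3, ?_⟩
    have h4 : (e.symm (c x)).1 - Q (e.symm (c x)) = constI x.1 := congrArg Prod.fst h1
    rw [h3] at h4
    exact sub_eq_iff_eq_add.1 h4
  -- The integrand is continued by constants outside [0, 1], so that `u` has two-sided derivatives
  -- at 0 and 1 as well.
  set u : ℝ → E × P → E := fun s x => x.1 + ∫ τ in (0 : ℝ)..s, extendI (f x) τ
  have huH : ∀ x ∈ c ⁻¹' e.target, ∀ s : I01, u s x = H x s := by
    intro x hx s
    rw [(hfix x hx).2]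
    rfl
  refine ⟨c ⁻¹' e.target, u, e.open_target.preimage hc.continuous, ?_, ?_, ?_, ?_⟩
  · have : c (y₀, 0) = e x₀ := by rw [heT, hTx₀]
    rw [Set.mem_preimage, this]
    exact e.map_source hex
  · refine ContDiffOn.congr (f := fun x => H x ⟨1, by simp⟩) ?_
      (fun x hx => huH x hx ⟨1, by simp⟩)
    exact (ContinuousLinearMap.contDiff (ContinuousMap.evalCLM ℝ
      (⟨1, by simp⟩ : I01))).comp_contDiffOn
        (contDiff_fst.comp_contDiffOn (hes.comp hc.contDiffOn fun x hx => hx))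
  · intro x
    simp [u]
  · intro x hx s hs
    have hs' := huH x hx ⟨s, hs⟩
    change u s x = _ at hs'
    constructor
    · have h1 : HasDerivAt (fun τ => u τ x) (extendI (f x) s) s :=
        (intervalIntegral.integral_hasDerivAt_right
          ((extendI (f x)).continuous.intervalIntegrable _ _)
          ((extendI (f x)).continuous.stronglyMeasurableAtFilter _ _)
          (extendI (f x)).continuous.continuousAt).const_add x.1
      rw [show extendI (f x) s = F (s, u s x, x.2) by
        rw [hs']; exact extendI_apply (f x) ⟨s, hs⟩] at h1
      exact h1
    · rw [hs']
      apply hρN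
      have h1 : e.symm (c x) ∈ O := heO (e.map_target hx)
      exact (ContinuousMap.dist_apply_le_dist (f := H x) (g := constI y₀) ⟨s, hs⟩).trans_lt h1

end Family

/-! ### Pullback of forms to normed spaces, and naturality of the exterior derivative. -/

section Pullback

variable {d : ℕ} {M : Type u} [TopologicalSpace M] [ChartedSpace (EuclideanSpace ℝ (Fin d)) M]
  {X : Type} [NormedAddCommGroup X] [NormedSpace ℝ X]

/-- The pullback of a 1-form to a normed space. -/
def pullForm (α : OneForm d M) (F : X → M) (x : X) : X →L[ℝ] ℝ :=
  (α (F x)).comp (mfderiv 𝓘(ℝ, X) (𝓡 d) F x)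

/-- The value at `x` of the exterior derivative of a 1-form on a normed space. -/
def extD (β : X → X →L[ℝ] ℝ) (x v w : X) : ℝ := fderiv ℝ β x v w - fderiv ℝ β x w v

lemma extD_self (β : X → X →L[ℝ] ℝ) (x v : X) : extD β x v v = 0 := sub_self _

lemma extD_swap (β : X → X →L[ℝ] ℝ) (x v w : X) : extD β x v w = -extD β x w v :=
  (neg_sub _ _).symm

lemma extD_add_left (β : X → X →L[ℝ] ℝ) (x v v' w : X) :
    extD β x (v + v') w = extD β x v w + extD β x v' w := by
  simp only [extD, map_add, add_apply]; ring

lemma extD_smul_left (β : X → X →L[ℝ] ℝ) (x : X) (c : ℝ) (v w : X) :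
    extD β x (c • v) w = c * extD β x v w := by
  simp only [extD, map_smul, smul_apply, smul_eq_mul]; ring

variable [IsManifold (𝓡 d) ∞ M]

lemma contDiffOn_pullForm [FiniteDimensional ℝ X] {α : OneForm d M} (hα : IsSmoothForm α)
    {F : X → M} {U : Set X} (hU : IsOpen U) (hF : ContMDiffOn 𝓘(ℝ, X) (𝓡 d) ∞ F U) :
    ContDiffOn ℝ ∞ (pullForm α F) U := by
  rw [contDiffOn_clm_apply]
  intro v x hx
  have h1 : ContMDiffOn 𝓘(ℝ, X) (𝓡 d).tangent ∞
      (fun y => (⟨F y, mfderiv 𝓘(ℝ, X) (𝓡 d) F y v⟩ : TangentBundle (𝓡 d) M)) U := by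
    have h2 := (hF.contMDiffOn_tangentMapWithin (m := ∞) (by simp) hU.uniqueMDiffOn).comp
      (t := (Bundle.TotalSpace.proj ⁻¹' U)) (s := U)
      (f := fun y => (⟨y, v⟩ : TangentBundle 𝓘(ℝ, X) X))
      ((contMDiffOn_vectorSpace_iff_contDiffOn (V := fun _ => v)).2 contDiffOn_const)
      (fun y hy => hy)
    refine h2.congr fun y hy => ?_
    simp only [Function.comp, tangentMapWithin, mfderivWithin_of_isOpen hU hy]
  have h3 := ContMDiffAt.clm_bundle_apply (x := x) (b := F) (F₁ := EuclideanSpace ℝ (Fin d))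
    (E₁ := fun q : M => TangentSpace (𝓡 d) q) (F₂ := ℝ) (E₂ := Bundle.Trivial M ℝ)
    (ϕ := fun y => α (F y)) (v := fun y => mfderiv 𝓘(ℝ, X) (𝓡 d) F y v)
    (hα.contMDiffAt.comp x (hF.contMDiffAt (hU.mem_nhds hx)))
    (h1.contMDiffAt (hU.mem_nhds hx))
  rw [Bundle.contMDiffAt_totalSpace] at h3
  exact (contMDiffAt_iff_contDiffAt.1 h3.2).contDiffWithinAt

/-- With `G` the expression of `F` in the chart at `F x` and `l` that of the form, the pullback is
`l (G y) ∘ G' y`. Antisymmetrizing its derivative removes the term with the second derivative of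
`G`, which is symmetric. This frees `dForm` from its preferred chart. -/
lemma dForm_pullForm {α : OneForm d M} (hα : IsSmoothForm α)
    {F : X → M} {U : Set X} (hU : IsOpen U) (hF : ContMDiffOn 𝓘(ℝ, X) (𝓡 d) ∞ F U)
    {x : X} (hx : x ∈ U) (v w : X) :
    dForm α (F x) (mfderiv 𝓘(ℝ, X) (𝓡 d) F x v) (mfderiv 𝓘(ℝ, X) (𝓡 d) F x w) =
      extD (pullForm α F) x v w := by
  set q := F x with hq
  set c := extChartAt (𝓡 d) q with hc
  set G : X → EuclideanSpace ℝ (Fin d) := fun y => c (F y) with hG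
  set l := localForm α q with hl
  have hFx : ContMDiffAt 𝓘(ℝ, X) (𝓡 d) ∞ F x := hF.contMDiffAt (hU.mem_nhds hx)
  have hGs : ContDiffAt ℝ ∞ G x :=
    contMDiffAt_iff_contDiffAt.1 ((contMDiffAt_extChartAt' (mem_chart_source _ _)).comp x hFx)
  have hls : ContDiffOn ℝ ∞ l c.target :=
    contDiffOn_pullForm hα (isOpen_extChartAt_target q) (contMDiffOn_extChartAt_symm q)
  have hlx : ContDiffAt ℝ ∞ l (G x) :=
    hls.contDiffAt ((isOpen_extChartAt_target q).mem_nhds (mem_extChartAt_target q))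
  have hsrc : ∀ᶠ y in nhds x, y ∈ U ∧ F y ∈ c.source :=
    (show ∀ᶠ y in nhds x, y ∈ U from hU.mem_nhds hx).and
      (hFx.continuousAt.preimage_mem_nhds (extChartAt_source_mem_nhds (I := 𝓡 d) q))
  have hpull : pullForm α F =ᶠ[nhds x] fun y => (l (G y)).comp (fderiv ℝ G y) := by
    filter_upwards [hsrc, hsrc.eventually_nhds] with y hy hy'
    have h1 : F =ᶠ[nhds y] c.symm ∘ G := by
      filter_upwards [hy'] with y' hy'
      exact (c.left_inv hy'.2).symm
    have hGy : MDifferentiableAt 𝓘(ℝ, X) 𝓘(ℝ, EuclideanSpace ℝ (Fin d)) G y :=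
      ((contMDiffAt_extChartAt' (by simpa [hc] using hy.2)).comp y
        (hF.contMDiffAt (hU.mem_nhds hy.1))).mdifferentiableAt (n := ∞) (by simp)
    have hcy : MDifferentiableAt 𝓘(ℝ, EuclideanSpace ℝ (Fin d)) (𝓡 d) c.symm (G y) :=
      ((contMDiffOn_extChartAt_symm (n := ∞) q).contMDiffAt
        ((isOpen_extChartAt_target q).mem_nhds (c.map_source hy.2))).mdifferentiableAt (by simp)
    have h2 : mfderiv 𝓘(ℝ, X) (𝓡 d) F y =
        (mfderiv 𝓘(ℝ, EuclideanSpace ℝ (Fin d)) (𝓡 d) c.symm (G y)).comp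
          (mfderiv 𝓘(ℝ, X) 𝓘(ℝ, EuclideanSpace ℝ (Fin d)) G y) := by
      rw [h1.mfderiv_eq]; exact mfderiv_comp y hcy hGy
    have h3 : c.symm (G y) = F y := c.left_inv hy.2
    unfold pullForm
    rw [h2, mfderiv_eq_fderiv]
    simp only [hl, localForm]
    rw [h3]
    rfl
  have hG' : ∀ v, (mfderiv (𝓡 d) 𝓘(ℝ, EuclideanSpace ℝ (Fin d)) c q
      (mfderiv 𝓘(ℝ, X) (𝓡 d) F x v) : EuclideanSpace ℝ (Fin d)) = fderiv ℝ G x v := by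
    intro v
    rw [← mfderiv_eq_fderiv]
    exact (DFunLike.congr_fun (mfderiv_comp x (mdifferentiableAt_extChartAt (mem_chart_source _ _))
      (hFx.mdifferentiableAt (by simp))) v).symm
  have hβ : HasFDerivAt (pullForm α F) _ x :=
    (((hlx.differentiableAt (by simp)).hasFDerivAt.comp x
      (hGs.differentiableAt (by simp)).hasFDerivAt).clm_comp
        ((hGs.fderiv_right (m := ∞) (by simp)).differentiableAt (by simp)).hasFDerivAt
          ).congr_of_eventuallyEq hpull
  have hsymm := (hGs.isSymmSndFDerivAt (by
    rw [minSmoothness_of_isRCLikeNormedField]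
    exact WithTop.coe_le_coe.2 (le_top (a := (2 : ℕ∞))))) v w
  unfold extD
  rw [hβ.fderiv]
  unfold dForm
  simp only [← hl, ← hc]
  rw [hG' v, hG' w]
  have hGx : c q = G x := rfl
  rw [hGx]
  simp only [add_apply, ContinuousLinearMap.comp_apply, ContinuousLinearMap.compL_apply,
    ContinuousLinearMap.flip_apply, Function.comp_apply]
  rw [hsymm]
  ring

end Pullback

/-! ### Combinatorics of the contact volume: splitting off an orthogonal pair. -/

section Block

variable (n : ℕ)

/-- The first position of the `i`-th pair in `contactVolume`. -/
def pairFst {n : ℕ} (i : Fin n) : Fin (2 * n + 1) := ⟨2 * (i : ℕ) + 1, by omega⟩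

/-- The second position of the `i`-th pair in `contactVolume`. -/
def pairSnd {n : ℕ} (i : Fin n) : Fin (2 * n + 1) := ⟨2 * (i : ℕ) + 2, by omega⟩

lemma pair_cases {n : ℕ} (k : Fin (2 * n + 1)) :
    k = 0 ∨ ∃ i : Fin n, k = pairFst i ∨ k = pairSnd i := by
  obtain ⟨k, hk⟩ := k
  rcases Nat.eq_zero_or_pos k with rfl | h
  · exact Or.inl rfl
  · refine Or.inr ⟨⟨(k - 1) / 2, by omega⟩, ?_⟩
    simp only [pairFst, pairSnd, Fin.mk.injEq]
    omega

lemma pairFst_ne_zero {n : ℕ} (i : Fin n) : pairFst i ≠ 0 := fun h => by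
  simpa [pairFst] using congrArg Fin.val h

lemma pairSnd_ne_zero {n : ℕ} (i : Fin n) : pairSnd i ≠ 0 := fun h => by
  simpa [pairSnd] using congrArg Fin.val h

lemma pairFst_ne_pairSnd {n : ℕ} (i j : Fin n) : pairFst i ≠ pairSnd j := fun h => by
  have := congrArg Fin.val h
  simp only [pairFst, pairSnd] at this
  omega

lemma pairFst_injective {n : ℕ} : Function.Injective (pairFst (n := n)) := fun i j h => by
  have := congrArg Fin.val h
  simp only [pairFst] at this
  exact Fin.ext (by omega)

lemma pairSnd_injective {n : ℕ} : Function.Injective (pairSnd (n := n)) := fun i j h => by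
  have := congrArg Fin.val h
  simp only [pairSnd] at this
  exact Fin.ext (by omega)

/-- A summand of `contactVolume`. -/
def volumeTerm {n : ℕ} (a : Fin (2 * n + 1) → ℝ) (w : Fin (2 * n + 1) → Fin (2 * n + 1) → ℝ)
    (σ : Equiv.Perm (Fin (2 * n + 1))) : ℝ :=
  ((Equiv.Perm.sign σ : ℤ) : ℝ) * (a (σ 0) * ∏ i : Fin n, w (σ (pairFst i)) (σ (pairSnd i)))

lemma contactVolume_eq_sum {V : Type*} (n : ℕ) (a : V → ℝ) (w : V → V → ℝ)
    (v : Fin (2 * n + 1) → V) :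
    contactVolume n a w v = ∑ σ, volumeTerm (fun i => a (v i)) (fun i j => w (v i) (v j)) σ := rfl

variable {n} {a : Fin (2 * n + 1) → ℝ} {w : Fin (2 * n + 1) → Fin (2 * n + 1) → ℝ}

/-- The swap changes the sign of the permutation and the sign of one factor `w`. -/
lemma volumeTerm_mul_swap_pair (hw : ∀ i j, w i j = -w j i) (σ : Equiv.Perm (Fin (2 * n + 1)))
    (i : Fin n) : volumeTerm a w (σ * Equiv.swap (pairFst i) (pairSnd i)) = volumeTerm a w σ := by
  unfold volumeTerm
  rw [Equiv.Perm.sign_mul, Equiv.Perm.sign_swap (pairFst_ne_pairSnd i i), Equiv.Perm.mul_apply,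
    Equiv.swap_apply_of_ne_of_ne (pairFst_ne_zero i).symm (pairSnd_ne_zero i).symm]
  have h : ∀ j ∈ Finset.univ.erase i, w ((σ * Equiv.swap (pairFst i) (pairSnd i)) (pairFst j))
      ((σ * Equiv.swap (pairFst i) (pairSnd i)) (pairSnd j)) =
        w (σ (pairFst j)) (σ (pairSnd j)) := by
    intro j hj
    have hj : j ≠ i := Finset.ne_of_mem_erase hj
    rw [Equiv.Perm.mul_apply, Equiv.Perm.mul_apply,
      Equiv.swap_apply_of_ne_of_ne (pairFst_injective.ne hj) (pairFst_ne_pairSnd j i),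
      Equiv.swap_apply_of_ne_of_ne (pairFst_ne_pairSnd i j).symm (pairSnd_injective.ne hj)]
  rw [← Finset.mul_prod_erase _ _ (Finset.mem_univ i), Finset.prod_congr rfl h,
    ← Finset.mul_prod_erase _ (fun j => w (σ (pairFst j)) (σ (pairSnd j))) (Finset.mem_univ i),
    Equiv.Perm.mul_apply, Equiv.Perm.mul_apply, Equiv.swap_apply_left, Equiv.swap_apply_right,
    hw (σ (pairSnd i))]
  push_cast
  ring

lemma swap_swap_pairFst (i j k : Fin n) :
    (Equiv.swap (pairFst i) (pairFst j) * Equiv.swap (pairSnd i) (pairSnd j)) (pairFst k) =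
      pairFst (Equiv.swap i j k) := by
  rw [Equiv.Perm.mul_apply, Equiv.swap_apply_of_ne_of_ne (pairFst_ne_pairSnd k i)
    (pairFst_ne_pairSnd k j), pairFst_injective.swap_apply]

lemma swap_swap_pairSnd (i j k : Fin n) :
    (Equiv.swap (pairFst i) (pairFst j) * Equiv.swap (pairSnd i) (pairSnd j)) (pairSnd k) =
      pairSnd (Equiv.swap i j k) := by
  rw [Equiv.Perm.mul_apply, pairSnd_injective.swap_apply,
    Equiv.swap_apply_of_ne_of_ne (pairFst_ne_pairSnd i _).symm (pairFst_ne_pairSnd j _).symm]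

/-- Exchanging two whole pairs is an even permutation that only reorders the factors of the product.
-/
lemma volumeTerm_mul_swap_swap (σ : Equiv.Perm (Fin (2 * n + 1))) (i j : Fin n) :
    volumeTerm a w (σ * (Equiv.swap (pairFst i) (pairFst j) * Equiv.swap (pairSnd i) (pairSnd j))) =
      volumeTerm a w σ := by
  rcases eq_or_ne i j with rfl | hij
  · rw [Equiv.swap_self, Equiv.swap_self]
    rfl
  unfold volumeTerm
  rw [Equiv.Perm.sign_mul, Equiv.Perm.sign_mul, Equiv.Perm.sign_swap (pairFst_injective.ne hij),
    Equiv.Perm.sign_swap (pairSnd_injective.ne hij)]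
  simp only [Equiv.Perm.mul_apply σ, swap_swap_pairFst, swap_swap_pairSnd]
  rw [Equiv.prod_comp (Equiv.swap i j) (fun k => w (σ (pairFst k)) (σ (pairSnd k))),
    Equiv.Perm.mul_apply, Equiv.swap_apply_of_ne_of_ne (pairSnd_ne_zero i).symm
      (pairSnd_ne_zero j).symm, Equiv.swap_apply_of_ne_of_ne (pairFst_ne_zero i).symm
      (pairFst_ne_zero j).symm]
  simp

/-- The share of the volume from the permutations that put `x` at position `k` is the same for all
positions related by symmetries of the summand. -/
lemma sum_ite_comp_mul (τ : Equiv.Perm (Fin (2 * n + 1)))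
    (hτ : ∀ σ, volumeTerm a w (σ * τ) = volumeTerm a w σ) (x k : Fin (2 * n + 1)) :
    ∑ σ : Equiv.Perm (Fin (2 * n + 1)), (if σ k = x then volumeTerm a w σ else 0) =
      ∑ σ : Equiv.Perm (Fin (2 * n + 1)), (if σ (τ k) = x then volumeTerm a w σ else 0) := by
  rw [← Equiv.sum_comp (Equiv.mulRight τ)]
  refine Finset.sum_congr rfl fun σ _ => ?_
  rw [Equiv.coe_mulRight, hτ, Equiv.Perm.mul_apply]

/-- If the last pair of vectors is orthogonal to the other ones, the contact volume splits. -/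
lemma sum_volumeTerm_block {a : Fin (2 * (n + 1) + 1) → ℝ}
    {w : Fin (2 * (n + 1) + 1) → Fin (2 * (n + 1) + 1) → ℝ} (hw : ∀ i j, w i j = -w j i)
    (ha : a (pairFst (Fin.last n)) = 0)
    (hX : ∀ j, j ≠ pairSnd (Fin.last n) → w (pairFst (Fin.last n)) j = 0) :
    ∑ σ, volumeTerm a w σ = 2 * (n + 1) * (w (pairFst (Fin.last n)) (pairSnd (Fin.last n)) *
      ∑ σ, volumeTerm (n := n) (fun i => a i.castSucc.castSucc)
        (fun i j => w i.castSucc.castSucc j.castSucc.castSucc) σ) := by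
  set X : Fin (2 * (n + 1) + 1) := pairFst (Fin.last n) with hXdef
  set Y : Fin (2 * (n + 1) + 1) := pairSnd (Fin.last n) with hYdef
  -- `f k` collects the permutations with the index `X` in position `k`. Position 0 gives nothing
  -- because `a X = 0`. The other 2(n+1) positions are related by the pair symmetries and give equal
  -- shares, whence the constant.
  set f : Fin (2 * (n + 1) + 1) → ℝ := fun k => ∑ σ : Equiv.Perm (Fin (2 * (n + 1) + 1)),
    (if σ k = X then volumeTerm a w σ else 0) with hf
  have hsum : ∑ σ, volumeTerm a w σ = ∑ k, f k := by
    rw [hf, Finset.sum_comm]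
    refine Finset.sum_congr rfl fun σ _ => ?_
    rw [Finset.sum_eq_single (σ.symm X)]
    · simp
    · intro k _ hk
      rw [if_neg]
      intro h
      exact hk (by rw [← h, Equiv.symm_apply_apply])
    · simp
  have hf0 : f 0 = 0 := by
    refine Finset.sum_eq_zero fun σ _ => ?_
    split_ifs with h
    · simp [volumeTerm, h, ha]
    · rfl
  have hfk : ∀ k, k ≠ 0 → f k = f X := by
    have h1 : ∀ i, f (pairFst i) = f X := fun i => by
      have h := sum_ite_comp_mul (a := a) (w := w) _
        (fun σ => volumeTerm_mul_swap_swap σ i (Fin.last n)) X (pairFst i)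
      rw [swap_swap_pairFst, Equiv.swap_apply_left] at h
      exact h
    intro k hk
    rcases pair_cases k with rfl | ⟨i, rfl | rfl⟩
    · exact absurd rfl hk
    · exact h1 i
    · have h := sum_ite_comp_mul (a := a) (w := w) _
        (fun σ => volumeTerm_mul_swap_pair hw σ i) X (pairSnd i)
      rw [Equiv.swap_apply_right] at h
      exact h.trans (h1 i)
  have hfX : ∑ k, f k = 2 * (n + 1) * f X := by
    rw [← Finset.add_sum_erase _ _ (Finset.mem_univ 0), hf0, zero_add,
      Finset.sum_congr rfl fun k hk => hfk k (Finset.ne_of_mem_erase hk), Finset.sum_const,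
      Finset.card_erase_of_mem (Finset.mem_univ _), Finset.card_univ, Fintype.card_fin,
      nsmul_eq_mul]
    push_cast
    simp
  rw [hsum, hfX]
  congr 1
  let p : Fin (2 * (n + 1) + 1) → Prop := fun k => (k : ℕ) < 2 * n + 1
  let e : Fin (2 * n + 1) ≃ Subtype p :=
    { toFun := fun i => ⟨i.castSucc.castSucc, i.2⟩
      invFun := fun k => ⟨k.1, k.2⟩
      left_inv := fun i => rfl
      right_inv := fun k => rfl }
  have hnp : ∀ k, ¬ p k → k = X ∨ k = Y := fun k hk => by
    have h2 := k.2
    simp only [p] at hk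
    have : (k : ℕ) = 2 * n + 1 ∨ (k : ℕ) = 2 * n + 2 := by omega
    rcases this with h | h
    · exact Or.inl (Fin.ext h)
    · exact Or.inr (Fin.ext h)
  have hpX : ¬ p X := by simp [p, hXdef, pairFst]
  have hpY : ¬ p Y := by simp [p, hYdef, pairSnd]
  -- With `X` in the first slot of the last pair, the factor of that pair vanishes unless `Y` is in
  -- its second slot. The surviving permutations fix both, so they are the permutations of the first
  -- 2n+1 indices.
  have h1 : f X = ∑ σ : {σ : Equiv.Perm (Fin (2 * (n + 1) + 1)) // ∀ k, ¬ p k → σ k = k},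
      volumeTerm a w σ.1 := by
    rw [← Finset.sum_subtype (Finset.univ.filter
      fun σ : Equiv.Perm (Fin (2 * (n + 1) + 1)) => ∀ k, ¬ p k → σ k = k) (by simp),
      Finset.sum_filter]
    refine Finset.sum_congr rfl fun σ _ => ?_
    by_cases h : ∀ k, ¬ p k → σ k = k
    · rw [if_pos h, if_pos (h X hpX)]
    · rw [if_neg h]
      split_ifs with hX'
      · have hY' : σ Y ≠ Y := fun hY' => h fun k hk => by
          rcases hnp k hk with rfl | rfl
          exacts [hX', hY']
        have : w (σ X) (σ Y) = 0 := by rw [hX', hX _ hY']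
        rw [volumeTerm, Finset.prod_eq_zero (Finset.mem_univ (Fin.last n)) this]
        ring
      · rfl
  rw [h1, ← Equiv.sum_comp (Equiv.Perm.subtypeEquivSubtypePerm p),
    ← Equiv.sum_comp e.permCongr, Finset.mul_sum]
  refine Finset.sum_congr rfl fun ρ _ => ?_
  set σ : Equiv.Perm (Fin (2 * (n + 1) + 1)) := Equiv.Perm.ofSubtype (e.permCongr ρ) with hσ
  change volumeTerm a w σ = _
  have hσe : ∀ j : Fin (2 * n + 1), σ j.castSucc.castSucc = (ρ j).castSucc.castSucc := fun j => by
    have : σ (e j : Subtype p) = (e.permCongr ρ (e j) : Subtype p) :=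
      Equiv.Perm.ofSubtype_apply_coe _ _
    rw [Equiv.permCongr_apply, Equiv.symm_apply_apply] at this
    exact this
  have hσX : σ X = X := Equiv.Perm.ofSubtype_apply_of_not_mem _ hpX
  have hσY : σ Y = Y := Equiv.Perm.ofSubtype_apply_of_not_mem _ hpY
  have hF : ∀ i : Fin n, pairFst i.castSucc = (pairFst i).castSucc.castSucc := fun i => rfl
  have hS : ∀ i : Fin n, pairSnd i.castSucc = (pairSnd i).castSucc.castSucc := fun i => rfl
  have h0 : (0 : Fin (2 * (n + 1) + 1)) = (0 : Fin (2 * n + 1)).castSucc.castSucc := rfl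
  unfold volumeTerm
  rw [Fin.prod_univ_castSucc, ← hXdef, ← hYdef, hσX, hσY, h0, hσe]
  simp only [hF, hS, hσe]
  rw [hσ, Equiv.Perm.sign_ofSubtype, Equiv.Perm.sign_permCongr]
  ring

end Block

/-! ### Nonzero contact volume implies nondegeneracy. -/

section Nondegenerate

variable {V : Type*} [AddCommGroup V] [Module ℝ V] {n : ℕ}

/-- The multilinear map `a(v₀) w(v₁, v₂) ⋯ w(v₂ₙ₋₁, v₂ₙ)`. -/
def pairingMap (n : ℕ) (a : V →ₗ[ℝ] ℝ) (w : V →ₗ[ℝ] V →ₗ[ℝ] ℝ) :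
    MultilinearMap ℝ (fun _ : Fin (2 * n + 1) => V) ℝ :=
  -- Each argument occurs in exactly one factor of the product, which is why the product is linear
  -- in it.
  have key : ∀ (v : Fin (2 * n + 1) → V) (k : Fin (2 * n + 1)), ∃ L : V →ₗ[ℝ] ℝ, ∀ x,
      a (Function.update v k x 0) * ∏ i : Fin n, w (Function.update v k x (pairFst i))
        (Function.update v k x (pairSnd i)) = L x := by
    intro v k
    rcases pair_cases k with rfl | ⟨i, hk⟩
    · refine ⟨(∏ i : Fin n, w (v (pairFst i)) (v (pairSnd i))) • a, fun x => ?_⟩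
      simp [Function.update_of_ne, pairFst_ne_zero, pairSnd_ne_zero, mul_comm]
    · have hk0 : (0 : Fin (2 * n + 1)) ≠ k := by
        rcases hk with rfl | rfl
        exacts [(pairFst_ne_zero i).symm, (pairSnd_ne_zero i).symm]
      have h : ∀ x, ∀ j ∈ Finset.univ.erase i, w (Function.update v k x (pairFst j))
          (Function.update v k x (pairSnd j)) = w (v (pairFst j)) (v (pairSnd j)) := by
        intro x j hj
        have hj : j ≠ i := Finset.ne_of_mem_erase hj
        have h1 : pairFst j ≠ k := by
          rcases hk with rfl | rfl
          exacts [pairFst_injective.ne hj, pairFst_ne_pairSnd j i]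
        have h2 : pairSnd j ≠ k := by
          rcases hk with rfl | rfl
          exacts [(pairFst_ne_pairSnd i j).symm, pairSnd_injective.ne hj]
        rw [Function.update_of_ne h1, Function.update_of_ne h2]
      have h' : ∀ x, a (Function.update v k x 0) * ∏ i : Fin n,
          w (Function.update v k x (pairFst i)) (Function.update v k x (pairSnd i)) =
            (a (v 0) * ∏ j ∈ Finset.univ.erase i, w (v (pairFst j)) (v (pairSnd j))) *
              w (Function.update v k x (pairFst i)) (Function.update v k x (pairSnd i)) := by
        intro x
        rw [← Finset.mul_prod_erase _ _ (Finset.mem_univ i), Finset.prod_congr rfl (h x),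
          Function.update_of_ne hk0]
        ring
      rcases hk with rfl | rfl
      · refine ⟨(a (v 0) * ∏ j ∈ Finset.univ.erase i, w (v (pairFst j)) (v (pairSnd j))) •
          w.flip (v (pairSnd i)), fun x => ?_⟩
        rw [h', Function.update_self, Function.update_of_ne (pairFst_ne_pairSnd i i).symm]
        rfl
      · refine ⟨(a (v 0) * ∏ j ∈ Finset.univ.erase i, w (v (pairFst j)) (v (pairSnd j))) •
          w (v (pairFst i)), fun x => ?_⟩
        rw [h', Function.update_self, Function.update_of_ne (pairFst_ne_pairSnd i i)]
        rfl
  MultilinearMap.mk' (fun v => a (v 0) * ∏ i : Fin n, w (v (pairFst i)) (v (pairSnd i)))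
    (fun v k x y => by
      obtain ⟨L, hL⟩ := key v k
      simp only [hL, map_add])
    (fun v k c x => by
      obtain ⟨L, hL⟩ := key v k
      simp only [hL, map_smul])

lemma contactVolume_eq_alternatization (a : V →ₗ[ℝ] ℝ) (w : V →ₗ[ℝ] V →ₗ[ℝ] ℝ)
    (v : Fin (2 * n + 1) → V) : contactVolume n (fun x => a x) (fun x y => w x y) v =
      MultilinearMap.alternatization (pairingMap n a w) v := by
  rw [MultilinearMap.alternatization_apply]
  refine Finset.sum_congr rfl fun σ _ => ?_
  rw [Units.smul_def, zsmul_eq_mul]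
  rfl

/-- A pair consisting of a linear form and a bilinear form such that the bilinear form is
nondegenerate on the kernel of the linear form. -/
def ContactNondegenerate (a : V → ℝ) (w : V → V → ℝ) : Prop :=
  (∃ e, a e ≠ 0) ∧ ∀ u, a u = 0 → (∀ x, a x = 0 → w u x = 0) → u = 0

/-- Suppose that u ≠ 0 in ker a is w-orthogonal to ker a. Complete u to a basis of ker a and add a
vector e outside it. On this basis each summand either evaluates a on a kernel vector or pairs u
with a kernel vector, so the alternating map vanishes on a basis and hence everywhere. -/
lemma contactNondegenerate_of_contactVolume_ne_zero [FiniteDimensional ℝ V]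
    (hV : Module.finrank ℝ V = 2 * n + 1) (a : V →ₗ[ℝ] ℝ) (w : V →ₗ[ℝ] V →ₗ[ℝ] ℝ)
    (hw : ∀ x y, w x y = -w y x) {v : Fin (2 * n + 1) → V}
    (hv : contactVolume n (fun x => a x) (fun x y => w x y) v ≠ 0) :
    ContactNondegenerate (fun x => a x) (fun x y => w x y) := by
  have he : ∃ e, a e ≠ 0 := by
    by_contra! h
    apply hv
    refine Finset.sum_eq_zero fun σ _ => ?_
    simp [h]
  refine ⟨he, fun u hu hux => ?_⟩
  obtain ⟨e, he⟩ := he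
  by_contra hu0
  set K := LinearMap.ker a
  let uK : K := ⟨u, hu⟩
  have huK : uK ≠ 0 := fun h => hu0 (congrArg Subtype.val h)
  have hli : LinearIndepOn ℝ id ({uK} : Set K) := LinearIndepOn.singleton huK
  let bK := Module.Basis.extend hli
  have hfr : Module.finrank ℝ K = 2 * n := by
    have h1 : Module.finrank ℝ (LinearMap.range a) + Module.finrank ℝ K = Module.finrank ℝ V :=
      LinearMap.finrank_range_add_finrank_ker a
    have h2 : LinearMap.range a = ⊤ :=
      LinearMap.range_eq_top.2 (LinearMap.surjective fun h => he (by rw [h]; rfl))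
    rw [h2, finrank_top, Module.finrank_self, hV] at h1
    omega
  have hfin : Finite (hli.extend (Set.subset_univ _)) := Module.Finite.finite_basis bK
  have := Fintype.ofFinite (hli.extend (Set.subset_univ _))
  let ε : Fin (2 * n) ≃ hli.extend (Set.subset_univ _) :=
    (Fintype.equivFinOfCardEq (by rw [← hfr, Module.finrank_eq_card_basis bK])).symm
  let c : Fin (2 * n) → V := fun i => (bK (ε i) : K)
  have hc : ∀ i, a (c i) = 0 := fun i => (bK (ε i)).2
  let b' : Fin (2 * n + 1) → V := Fin.cons e c
  have hb' : LinearIndependent ℝ b' := by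
    refine linearIndependent_finCons.2 ⟨?_, fun h => he ?_⟩
    · exact (bK.linearIndependent.comp ε ε.injective).map' K.subtype K.ker_subtype
    · have : Submodule.span ℝ (Set.range c) ≤ K := by
        rw [Submodule.span_le]
        rintro _ ⟨i, rfl⟩
        exact hc i
      exact this h
  let b := basisOfLinearIndependentOfCardEqFinrank hb' (by rw [hV, Fintype.card_fin])
  rw [contactVolume_eq_alternatization] at hv
  have hA : MultilinearMap.alternatization (pairingMap n a w) b ≠ 0 :=
    (AlternatingMap.map_basis_ne_zero_iff b _).2 fun h => hv (by rw [h]; rfl)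
  rw [← contactVolume_eq_alternatization,
    show (b : Fin (2 * n + 1) → V) = b' from coe_basisOfLinearIndependentOfCardEqFinrank _ _] at hA
  apply hA
  obtain ⟨j, hj⟩ : ∃ j, c j = u := by
    refine ⟨ε.symm ⟨uK, hli.subset_extend _ rfl⟩, ?_⟩
    simp only [c, Equiv.apply_symm_apply, bK, Module.Basis.extend_apply_self]
    rfl
  rw [contactVolume_eq_sum]
  refine Finset.sum_eq_zero fun σ _ => ?_
  unfold volumeTerm
  beta_reduce
  by_cases h0 : σ 0 = 0
  · have hz : ∀ k, k ≠ 0 → a (b' (σ k)) = 0 := by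
      intro k hk
      have : σ k ≠ 0 := fun h => hk (σ.injective (h.trans h0.symm))
      obtain ⟨i, hi⟩ := Fin.exists_succ_eq.2 this
      rw [← hi]
      exact hc i
    obtain ⟨k, hk⟩ := σ.surjective j.succ
    have hk' : b' (σ k) = u := by rw [hk]; exact hj
    rcases pair_cases k with rfl | ⟨i, rfl | rfl⟩
    · exact absurd (h0.symm.trans hk) (Fin.succ_ne_zero j).symm
    · rw [Finset.prod_eq_zero (Finset.mem_univ i)]
      · ring
      · rw [hk']
        exact hux _ (hz _ (pairSnd_ne_zero i))
    · rw [Finset.prod_eq_zero (Finset.mem_univ i)]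
      · ring
      · rw [hk', hw]
        exact neg_eq_zero.2 (hux _ (hz _ (pairFst_ne_zero i)))
  · obtain ⟨i, hi⟩ := Fin.exists_succ_eq.2 h0
    have : a (b' (σ 0)) = 0 := by rw [← hi]; exact hc i
    rw [this]
    ring

end Nondegenerate

/-! ### The linear system of a nondegenerate pair, and the Reeb vector. -/

section ContactMap

variable {V : Type*} [NormedAddCommGroup V] [NormedSpace ℝ V]

/-- The linear map `(v, μ) ↦ (i_v Ω - μ a, a(v))`. -/
def contactMap (a : V →L[ℝ] ℝ) (Ω : V →L[ℝ] V →L[ℝ] ℝ) : V × ℝ →L[ℝ] (V →L[ℝ] ℝ) × ℝ :=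
  (Ω.comp (ContinuousLinearMap.fst ℝ V ℝ) - (ContinuousLinearMap.snd ℝ V ℝ).smulRight a).prod
    (a.comp (ContinuousLinearMap.fst ℝ V ℝ))

lemma contactMap_apply (a : V →L[ℝ] ℝ) (Ω : V →L[ℝ] V →L[ℝ] ℝ) (x : V × ℝ) :
    contactMap a Ω x = (Ω x.1 - x.2 • a, a x.1) := rfl

variable [FiniteDimensional ℝ V]

/-- A kernel element satisfies i_v Ω = μ a and a(v) = 0, so v = 0 by nondegeneracy, and then μ = 0
on evaluating at a vector outside ker a. Dimensions agree, so injectivity suffices. -/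
lemma ContactNondegenerate.exists_equiv {a : V →L[ℝ] ℝ} {Ω : V →L[ℝ] V →L[ℝ] ℝ}
    (h : ContactNondegenerate (fun x => a x) (fun x y => Ω x y)) :
    ∃ e : (V × ℝ) ≃L[ℝ] (V →L[ℝ] ℝ) × ℝ, (e : V × ℝ →L[ℝ] (V →L[ℝ] ℝ) × ℝ) = contactMap a Ω := by
  have hinj : Function.Injective (contactMap a Ω : V × ℝ →ₗ[ℝ] (V →L[ℝ] ℝ) × ℝ) := by
    rw [← LinearMap.ker_eq_bot, LinearMap.ker_eq_bot']
    rintro ⟨v, μ⟩ hv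
    rw [ContinuousLinearMap.coe_coe, contactMap_apply, Prod.mk_eq_zero] at hv
    obtain ⟨h1, h2⟩ := hv
    have h3 : ∀ x, Ω v x = μ * a x := fun x => by
      have := DFunLike.congr_fun h1 x
      simp only [sub_apply, smul_apply, smul_eq_mul] at this
      exact sub_eq_zero.1 this
    have hv0 : v = 0 := h.2 v h2 fun x hx =>
      (h3 x).trans (by rw [show a x = 0 from hx, mul_zero])
    obtain ⟨e, he⟩ := h.1
    have h4 := h3 e
    rw [hv0, map_zero] at h4
    have hμ : μ = 0 := (mul_eq_zero.1 h4.symm).resolve_right he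
    rw [hv0, hμ]
    rfl
  have hdim : Module.finrank ℝ (V × ℝ) = Module.finrank ℝ ((V →L[ℝ] ℝ) × ℝ) := by
    rw [Module.finrank_prod, Module.finrank_prod,
      ← (LinearMap.toContinuousLinearMap (𝕜 := ℝ) (E := V) (F' := ℝ)).finrank_eq]
    exact congrArg (· + _) (Subspace.dual_finrank_eq (K := ℝ) (V := V)).symm
  refine ⟨(LinearMap.linearEquivOfInjective _ hinj hdim).toContinuousLinearEquiv, ?_⟩
  ext x <;> rfl

/-- Solve the system with right-hand side (0, 1); pairing i_R Ω = μ a with R itself shows μ = 0. -/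
lemma ContactNondegenerate.exists_reeb {a : V →L[ℝ] ℝ} {Ω : V →L[ℝ] V →L[ℝ] ℝ}
    (hΩ : ∀ x, Ω x x = 0) (h : ContactNondegenerate (fun x => a x) (fun x y => Ω x y)) :
    ∃ R, a R = 1 ∧ ∀ x, Ω R x = 0 := by
  obtain ⟨e, he⟩ := h.exists_equiv
  obtain ⟨⟨R, μ⟩, hR⟩ := e.surjective (0, 1)
  have h0 : contactMap a Ω (R, μ) = (0, 1) := by rw [← he]; exact hR
  rw [contactMap_apply, Prod.mk.injEq] at h0
  obtain ⟨h1, h2⟩ := h0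
  have h3 : ∀ x, Ω R x = μ * a x := fun x => by
    have := DFunLike.congr_fun h1 x
    simp only [sub_apply, smul_apply, smul_eq_mul] at this
    exact sub_eq_zero.1 this
  have hμ : μ = 0 := by
    have := h3 R
    rw [hΩ, h2, mul_one] at this
    exact this.symm
  exact ⟨R, h2, fun x => by rw [h3, hμ, zero_mul]⟩

end ContactMap

/-! ### Local diffeomorphisms of manifolds without boundary. -/

section LocalDiffeomorphism

variable {E₁ E₂ H₁ H₂ N₁ N₂ : Type*} [NormedAddCommGroup E₁] [NormedSpace ℝ E₁]
  [NormedAddCommGroup E₂] [NormedSpace ℝ E₂] [TopologicalSpace H₁] [TopologicalSpace H₂]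
  {I : ModelWithCorners ℝ E₁ H₁} {J : ModelWithCorners ℝ E₂ H₂}
  [TopologicalSpace N₁] [ChartedSpace H₁ N₁] [TopologicalSpace N₂] [ChartedSpace H₂ N₂]

/-- The preferred chart at a point of a manifold without boundary, as a partial diffeomorphism. -/
def chartDiffeo (I : ModelWithCorners ℝ E₁ H₁) [I.Boundaryless] [IsManifold I ∞ N₁] (x : N₁) :
    PartialDiffeomorph I 𝓘(ℝ, E₁) N₁ E₁ ∞ where
  toPartialEquiv := extChartAt I x
  open_source := isOpen_extChartAt_source x
  open_target := isOpen_extChartAt_target x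
  contMDiffOn_toFun := by
    have := contMDiffOn_extChartAt (I := I) (x := x) (n := ∞)
    rwa [← extChartAt_source I] at this
  contMDiffOn_invFun := contMDiffOn_extChartAt_symm x

/-- The inverse function theorem for manifolds without boundary. -/
lemma isLocalDiffeomorphAt_of_mfderiv [CompleteSpace E₁] [CompleteSpace E₂] [I.Boundaryless] [J.Boundaryless]
    [IsManifold I ∞ N₁] [IsManifold J ∞ N₂] {F : N₁ → N₂} {W : Set N₁} (hW : IsOpen W)
    (hF : ContMDiffOn I J ∞ F W) {x : N₁} (hx : x ∈ W)
    (hbij : Function.Bijective (mfderiv I J F x)) : IsLocalDiffeomorphAt I J ∞ F x := by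
  set c := extChartAt I x
  set c' := extChartAt J (F x)
  let L : E₁ →L[ℝ] E₂ := mfderiv I J F x
  let F' : E₁ ≃L[ℝ] E₂ := ContinuousLinearEquiv.ofBijective L
    (LinearMap.ker_eq_bot.2 hbij.1) (LinearMap.range_eq_top.2 hbij.2)
  have hWopen : IsOpen (W ∩ F ⁻¹' c'.source) :=
    hF.continuousOn.isOpen_inter_preimage hW (isOpen_extChartAt_source _)
  set U : Set E₁ := c.target ∩ c.symm ⁻¹' (W ∩ F ⁻¹' c'.source)
  have hU : IsOpen U := (continuousOn_extChartAt_symm x).isOpen_inter_preimage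
    (isOpen_extChartAt_target x) hWopen
  have hxs : c.symm (c x) = x := extChartAt_to_inv x
  have hxU : c x ∈ U := ⟨mem_extChartAt_target x, by
    rw [Set.mem_preimage, hxs]; exact ⟨hx, mem_extChartAt_source _⟩⟩
  have hf : ContDiffOn ℝ ∞ (writtenInExtChartAt I J x F) U := by
    rw [← contMDiffOn_iff_contDiffOn]
    refine ContMDiffOn.comp (t := c'.source) (I' := J) ?_ ?_ (fun y hy => hy.2.2)
    · have := contMDiffOn_extChartAt (I := J) (x := F x) (n := ∞)
      rwa [← extChartAt_source J] at this
    · exact hF.comp ((contMDiffOn_extChartAt_symm x).mono Set.inter_subset_left)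
        (fun y hy => hy.2.1)
  have hd : HasFDerivAt (writtenInExtChartAt I J x F) (F' : E₁ →L[ℝ] E₂) (c x) := by
    have h1 : HasFDerivWithinAt (writtenInExtChartAt I J x F) L (Set.range I) (c x) :=
      ((hF.contMDiffAt (hW.mem_nhds hx)).mdifferentiableAt (by simp)).hasMFDerivAt.2
    rw [I.range_eq_univ, hasFDerivWithinAt_univ] at h1
    exact h1
  obtain ⟨e, hxe, heU, heq, hes⟩ := exists_smooth_local_inverse hU hf hxU hd
  let Φe : PartialDiffeomorph 𝓘(ℝ, E₁) 𝓘(ℝ, E₂) E₁ E₂ ∞ :=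
    { toPartialEquiv := e.toPartialEquiv
      open_source := e.open_source
      open_target := e.open_target
      contMDiffOn_toFun := contMDiffOn_iff_contDiffOn.2
        ((hf.mono heU).congr fun y _ => heq y)
      contMDiffOn_invFun := contMDiffOn_iff_contDiffOn.2 hes }
  refine ⟨((chartDiffeo I x).trans Φe).trans (chartDiffeo J (F x)).symm, ?_, ?_⟩
  · refine ⟨⟨mem_extChartAt_source x, hxe⟩, ?_⟩
    change e (c x) ∈ c'.target
    rw [heq]
    change c' (F (c.symm (c x))) ∈ _
    rw [hxs]
    exact mem_extChartAt_target _
  · intro y hy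
    have hy1 : y ∈ c.source := hy.1.1
    have hy2 : c y ∈ U := heU hy.1.2
    change F y = c'.symm (e (c y))
    rw [heq]
    change F y = c'.symm (c' (F (c.symm (c y))))
    have h3 : F (c.symm (c y)) ∈ c'.source := hy2.2.2
    rw [c.left_inv hy1] at h3 ⊢
    exact (c'.left_inv h3).symm

/-- An injective local diffeomorphism on an open set is a partial diffeomorphism. -/
lemma exists_partialDiffeomorph_of_injOn {F : N₁ → N₂} {S : Set N₁} (hS : IsOpen S)
    (hinj : Set.InjOn F S) (hloc : ∀ x ∈ S, IsLocalDiffeomorphAt I J ∞ F x) (r : N₂ → N₁) :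
    ∃ ψ : PartialDiffeomorph I J N₁ N₂ ∞, ψ.source = S ∧ ∀ x, ψ x = F x := by
  classical
  -- `PartialDiffeomorph` needs a total inverse function; `r` only supplies values off the image of
  -- `S`.
  let g : N₂ → N₁ := fun y => if h : ∃ x ∈ S, F x = y then h.choose else r y
  have hg : ∀ x ∈ S, g (F x) = x := fun x hx => by
    have h : ∃ x' ∈ S, F x' = F x := ⟨x, hx, rfl⟩
    simp only [g, dif_pos h]
    exact hinj h.choose_spec.1 hx h.choose_spec.2
  have key : ∀ x ∈ S, ∃ V ∈ nhds (F x), V ⊆ F '' S ∧ ContMDiffAt J I ∞ g (F x) := by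
    intro x hx
    obtain ⟨Φ, hxΦ, hΦ⟩ := hloc x hx
    have hΦx : F x ∈ Φ.target := by rw [hΦ hxΦ]; exact Φ.map_source hxΦ
    have hcont : ContinuousAt Φ.invFun (F x) :=
      (Φ.contMDiffOn_invFun.contMDiffAt (Φ.open_target.mem_nhds hΦx)).continuousAt
    have hinv : Φ.invFun (F x) = x := by rw [hΦ hxΦ]; exact Φ.left_inv hxΦ
    have hev : ∀ᶠ y in nhds (F x), y ∈ Φ.target ∧ Φ.invFun y ∈ S :=
      (show ∀ᶠ y in nhds (F x), y ∈ Φ.target from Φ.open_target.mem_nhds hΦx).and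
        (hcont.preimage_mem_nhds (by rw [hinv]; exact hS.mem_nhds hx))
    have hF : ∀ y ∈ Φ.target, F (Φ.invFun y) = y := fun y hy => by
      have h := hΦ (Φ.map_target hy)
      exact h.trans (Φ.right_inv hy)
    refine ⟨_, hev, fun y hy => ⟨Φ.invFun y, hy.2, hF y hy.1⟩, ?_⟩
    refine (Φ.contMDiffOn_invFun.contMDiffAt (Φ.open_target.mem_nhds hΦx)).congr_of_eventuallyEq ?_
    filter_upwards [hev] with y hy
    have := hg _ hy.2
    rwa [hF y hy.1] at this
  refine ⟨{ toFun := F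
            invFun := g
            source := S
            target := F '' S
            map_source' := fun x hx => ⟨x, hx, rfl⟩
            map_target' := ?_
            left_inv' := hg
            right_inv' := ?_
            open_source := hS
            open_target := ?_
            contMDiffOn_toFun := ?_
            contMDiffOn_invFun := ?_ }, rfl, fun x => rfl⟩
  · rintro _ ⟨x, hx, rfl⟩
    rwa [hg x hx]
  · rintro _ ⟨x, hx, rfl⟩
    rw [hg x hx]
  · rw [isOpen_iff_mem_nhds]
    rintro _ ⟨x, hx, rfl⟩
    obtain ⟨V, hV, hVS, -⟩ := key x hx
    exact Filter.mem_of_superset hV hVS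
  · exact fun x hx => (hloc x hx).contMDiffAt.contMDiffWithinAt
  · rintro _ ⟨x, hx, rfl⟩
    obtain ⟨V, -, -, h⟩ := key x hx
    exact h.contMDiffWithinAt

end LocalDiffeomorphism

/-! ### Uniform tubes around the zero section of B × ℂ. -/

section Tube

variable {B : Type*} [TopologicalSpace B] [CompactSpace B]

lemma exists_ball_subset {W : Set (B × ℂ)} (hW : IsOpen W) (h : ∀ p, (p, (0 : ℂ)) ∈ W) :
    ∃ δ > 0, Set.univ ×ˢ Metric.ball (0 : ℂ) δ ⊆ W := by
  obtain ⟨u, v, -, hv, hu, h0, huv⟩ := generalized_tube_lemma (s := (Set.univ : Set B))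
    isCompact_univ (isCompact_singleton (x := (0 : ℂ))) hW (by rintro ⟨p, z⟩ ⟨-, rfl⟩; exact h p)
  obtain ⟨δ, hδ, hb⟩ := Metric.isOpen_iff.1 hv 0 (h0 rfl)
  exact ⟨δ, hδ, fun x hx => huv ⟨hu (Set.mem_univ _), hb hx.2⟩⟩

variable {E₀ H₀ E₂ H₂ N₂ : Type*} [NormedAddCommGroup E₀] [NormedSpace ℝ E₀]
  [NormedAddCommGroup E₂] [NormedSpace ℝ E₂] [TopologicalSpace H₀] [TopologicalSpace H₂]
  {I : ModelWithCorners ℝ E₀ H₀} {J : ModelWithCorners ℝ E₂ H₂} [ChartedSpace H₀ B]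
  [TopologicalSpace N₂] [ChartedSpace H₂ N₂]

lemma IsLocalDiffeomorphAt.eventually {E₁ H₁ N₁ : Type*} [NormedAddCommGroup E₁]
    [NormedSpace ℝ E₁] [TopologicalSpace H₁] {I : ModelWithCorners ℝ E₁ H₁} [TopologicalSpace N₁]
    [ChartedSpace H₁ N₁] {F : N₁ → N₂} {x : N₁} (h : IsLocalDiffeomorphAt I J ∞ F x) :
    ∀ᶠ y in nhds x, IsLocalDiffeomorphAt I J ∞ F y := by
  obtain ⟨Φ, hx, hΦ⟩ := h
  filter_upwards [Φ.open_source.mem_nhds hx] with y hy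
  exact ⟨Φ, hy, hΦ⟩

/-- A map that is a local diffeomorphism along the zero section of `B × ℂ` and injective on it is
a diffeomorphism of a neighbourhood `B × B²(δ)` onto an open set. -/
lemma exists_partialDiffeomorph_ball [T2Space N₂] {F : B × ℂ → N₂}
    (hloc : ∀ p, IsLocalDiffeomorphAt (I.prod 𝓘(ℝ, ℂ)) J ∞ F (p, 0))
    (hinj : ∀ p p', F (p, 0) = F (p', 0) → p = p') (r : N₂ → B × ℂ) {W : Set (B × ℂ)}
    (hW : IsOpen W) (hW0 : ∀ p, (p, (0 : ℂ)) ∈ W) :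
    ∃ δ > 0, ∃ ψ : PartialDiffeomorph (I.prod 𝓘(ℝ, ℂ)) J (B × ℂ) N₂ ∞,
      ψ.source = Set.univ ×ˢ Metric.ball (0 : ℂ) δ ∧ ψ.source ⊆ W ∧ ∀ x, ψ x = F x := by
  have hK : IsCompact ((Set.univ : Set B) ×ˢ ({0} : Set ℂ)) :=
    isCompact_univ.prod isCompact_singleton
  have hinjK : Set.InjOn F ((Set.univ : Set B) ×ˢ ({0} : Set ℂ)) := by
    rintro ⟨p, z⟩ ⟨-, rfl⟩ ⟨p', z'⟩ ⟨-, rfl⟩ h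
    rw [hinj p p' h]
  -- Injectivity on the compact zero section together with local injectivity around its points gives
  -- injectivity on a neighbourhood.
  obtain ⟨t, ht, htinj⟩ := hinjK.exists_mem_nhdsSet hK
    (by rintro ⟨p, z⟩ ⟨-, rfl⟩; exact (hloc p).contMDiffAt.continuousAt)
    (by
      rintro ⟨p, z⟩ ⟨-, rfl⟩
      obtain ⟨Φ, hx, hΦ⟩ := hloc p
      exact ⟨Φ.source, Φ.open_source.mem_nhds hx, fun x hx y hy h =>
        Φ.injOn hx hy (by rw [← hΦ hx, ← hΦ hy, h])⟩)
  obtain ⟨t', ht'o, hKt', ht't⟩ := mem_nhdsSet_iff_exists.1 ht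
  set O : Set (B × ℂ) := interior {x | IsLocalDiffeomorphAt (I.prod 𝓘(ℝ, ℂ)) J ∞ F x}
  obtain ⟨δ, hδ, hsub⟩ := exists_ball_subset ((ht'o.inter isOpen_interior).inter hW)
    (W := t' ∩ O ∩ W) (fun p => ⟨⟨hKt' ⟨Set.mem_univ _, rfl⟩,
      mem_interior_iff_mem_nhds.2 (IsLocalDiffeomorphAt.eventually (hloc p))⟩, hW0 p⟩)
  obtain ⟨ψ, hψ, hψF⟩ := exists_partialDiffeomorph_of_injOn (I := I.prod 𝓘(ℝ, ℂ)) (J := J)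
    (isOpen_univ.prod (Metric.isOpen_ball (x := (0 : ℂ)) (ε := δ)))
    (htinj.mono fun x hx => ht't (hsub hx).1.1)
    (fun x hx => interior_subset (s := {x | IsLocalDiffeomorphAt (I.prod 𝓘(ℝ, ℂ)) J ∞ F x})
      (hsub hx).1.2) r
  exact ⟨δ, hδ, ψ, hψ, hψ ▸ fun x hx => (hsub hx).2, hψF⟩

end Tube

/-! ### Characteristic lifts of vectors of the disk, in a chart of B. -/

section Characteristic

variable {E : Type} [NormedAddCommGroup E] [NormedSpace ℝ E]

/-- `v + ζ` lies in the kernel of `a` and is `w`-orthogonal to the kernel of `a` on the slice. -/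
def IsCharacteristic (a : E × ℂ → ℝ) (w : E × ℂ → E × ℂ → ℝ) (v : E) (ζ : ℂ) : Prop :=
  a (v, ζ) = 0 ∧ ∀ u : E, a (u, 0) = 0 → w (v, ζ) (u, 0) = 0

/-- The restriction of `(a, w)` to the slice is nondegenerate. -/
def SliceNondegenerate (a : E × ℂ → ℝ) (w : E × ℂ → E × ℂ → ℝ) : Prop :=
  ContactNondegenerate (fun v : E => a (v, 0)) (fun v u => w (v, 0) (u, 0))

/-- The exterior derivative as a bilinear map. -/
def extDL {X : Type} [NormedAddCommGroup X] [NormedSpace ℝ X] (β : X → X →L[ℝ] ℝ) (x : X) :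
    X →L[ℝ] X →L[ℝ] ℝ := fderiv ℝ β x - (fderiv ℝ β x).flip

lemma contDiffOn_extDL {X : Type} [NormedAddCommGroup X] [NormedSpace ℝ X]
    [FiniteDimensional ℝ X] {β : X → X →L[ℝ] ℝ} {U : Set X}
    (hU : IsOpen U) (hβ : ContDiffOn ℝ ∞ β U) : ContDiffOn ℝ ∞ (extDL β) U := by
  have h := hβ.fderiv_of_isOpen (m := ∞) hU (by simp)
  refine contDiffOn_clm_apply.2 fun v => contDiffOn_clm_apply.2 fun w => ?_
  exact ((h.clm_apply contDiffOn_const).clm_apply contDiffOn_const).sub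
    ((h.clm_apply contDiffOn_const).clm_apply contDiffOn_const)

/-- A linear form that vanishes on the kernel of another one is a multiple of it. -/
lemma exists_eq_smul_of_ker_le {a l : E →L[ℝ] ℝ} (h : ∀ u, a u = 0 → l u = 0) :
    ∃ μ : ℝ, l = μ • a := by
  by_cases ha : ∃ e, a e ≠ 0
  · obtain ⟨e, he⟩ := ha
    refine ⟨l e / a e, ?_⟩
    ext u
    have h1 := h (u - (a u / a e) • e) (by simp [he])
    simp only [map_sub, map_smul, smul_eq_mul, sub_eq_zero] at h1
    simp only [smul_apply, smul_eq_mul]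
    rw [h1]
    field_simp
  · push Not at ha
    exact ⟨0, by ext u; simp [h u (ha u)]⟩

variable [FiniteDimensional ℝ E]

/-- The linear map whose inverse computes the characteristic direction. -/
def sliceMap (β : E × ℂ → E × ℂ →L[ℝ] ℝ) (x : E × ℂ) : E × ℝ →L[ℝ] (E →L[ℝ] ℝ) × ℝ :=
  contactMap ((β x).comp (ContinuousLinearMap.inl ℝ E ℂ))
    ((extDL β x).bilinearComp (ContinuousLinearMap.inl ℝ E ℂ) (ContinuousLinearMap.inl ℝ E ℂ))

/-- The inhomogeneous part of the equation for the characteristic direction. -/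
def sliceRhs (β : E × ℂ → E × ℂ →L[ℝ] ℝ) (x : E × ℂ) : ℂ →L[ℝ] (E →L[ℝ] ℝ) × ℝ :=
  (-((extDL β x).bilinearComp (ContinuousLinearMap.inr ℝ E ℂ)
      (ContinuousLinearMap.inl ℝ E ℂ))).prod
    (-((β x).comp (ContinuousLinearMap.inr ℝ E ℂ)))

/-- A Lagrange multiplier: i_{(v, ζ)} dβ vanishes on the kernel of β in the slice exactly when it
equals μ β there. This makes the condition a linear system for (v, μ) with right-hand side linear in
ζ. -/
lemma isCharacteristic_iff_exists (β : E × ℂ → E × ℂ →L[ℝ] ℝ) (x : E × ℂ) (v : E) (ζ : ℂ) :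
    IsCharacteristic (fun u => β x u) (extD β x) v ζ ↔
      ∃ μ : ℝ, sliceMap β x (v, μ) = sliceRhs β x ζ := by
  have hsplit : ((v, ζ) : E × ℂ) = (v, 0) + (0, ζ) := by simp
  have h0 : β x (v, ζ) = β x (v, 0) + β x (0, ζ) := by rw [← map_add, ← hsplit]
  have h1 : ∀ u : E × ℂ, extD β x (v, ζ) u = extD β x (v, 0) u + extD β x (0, ζ) u := fun u => by
    rw [← extD_add_left, ← hsplit]
  have h2 : ∀ μ : ℝ, sliceMap β x (v, μ) = sliceRhs β x ζ ↔
      (∀ u : E, extD β x (v, 0) (u, 0) - μ * β x (u, 0) = -extD β x (0, ζ) (u, 0)) ∧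
        β x (v, 0) = -β x (0, ζ) := by
    intro μ
    rw [Prod.ext_iff]
    refine and_congr ⟨fun h u => ?_, fun h => ?_⟩ Iff.rfl
    · exact DFunLike.congr_fun h u
    · exact ContinuousLinearMap.ext h
  simp only [h2]
  constructor
  · rintro ⟨ha, hu⟩
    obtain ⟨μ, hμ⟩ := exists_eq_smul_of_ker_le (a := (β x).comp (ContinuousLinearMap.inl ℝ E ℂ))
      (l := (extDL β x (v, ζ)).comp (ContinuousLinearMap.inl ℝ E ℂ)) (fun u hu' => hu u hu')
    refine ⟨μ, fun u => ?_, by linarith⟩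
    have h3 : extD β x (v, ζ) (u, 0) = μ * β x (u, 0) := DFunLike.congr_fun hμ u
    rw [h1] at h3
    linarith
  · rintro ⟨μ, hμ, ha⟩
    refine ⟨by show β x (v, ζ) = 0; linarith, fun u hu => ?_⟩
    have h3 := hμ u
    rw [h1, show extD β x (v, 0) (u, 0) = μ * β x (u, 0) - extD β x (0, ζ) (u, 0) by linarith,
      show β x (u, 0) = 0 from hu]
    ring

/-- A degenerate slice yields a kernel element: (0, 1) if β vanishes on the slice, and (v, μ) if v
is orthogonal to the contact planes. As invertibility is open, so is the contact condition on
slices. -/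
lemma sliceNondegenerate_of_injective {β : E × ℂ → E × ℂ →L[ℝ] ℝ} {x : E × ℂ}
    (h : Function.Injective (sliceMap β x)) :
    SliceNondegenerate (fun u => β x u) (extD β x) := by
  have hz : sliceMap β x 0 = 0 := map_zero _
  constructor
  · by_contra! hβ
    have : sliceMap β x (0, 1) = sliceMap β x 0 := by
      rw [hz, sliceMap, contactMap_apply]
      refine Prod.ext ?_ (hβ 0)
      ext u
      have : β x (u, 0) = 0 := hβ u
      simp [this]
    simpa using congrArg Prod.snd (h this)
  · intro v hv hvu
    have h1 : IsCharacteristic (fun u => β x u) (extD β x) v 0 := ⟨hv, hvu⟩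
    obtain ⟨μ, hμ⟩ := (isCharacteristic_iff_exists β x v 0).1 h1
    rw [map_zero, ← hz] at hμ
    exact congrArg Prod.fst (h hμ)

/-- Near a point where the slices are contact, the characteristic direction depends smoothly on
the point. -/
lemma exists_characteristic_field {β : E × ℂ → E × ℂ →L[ℝ] ℝ} {U : Set (E × ℂ)} (hU : IsOpen U)
    (hβ : ContDiffOn ℝ ∞ β U) {x₀ : E × ℂ} (hx₀ : x₀ ∈ U)
    (hnd : SliceNondegenerate (fun u => β x₀ u) (extD β x₀)) :
    ∃ (U' : Set (E × ℂ)) (V : E × ℂ → ℂ →L[ℝ] E), IsOpen U' ∧ x₀ ∈ U' ∧ U' ⊆ U ∧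
      ContDiffOn ℝ ∞ V U' ∧ ∀ x ∈ U', SliceNondegenerate (fun u => β x u) (extD β x) ∧
        ∀ v ζ, IsCharacteristic (fun u => β x u) (extD β x) v ζ ↔ v = V x ζ := by
  have hω := contDiffOn_extDL hU hβ
  have ha : ContDiffOn ℝ ∞ (fun x => (β x).comp (ContinuousLinearMap.inl ℝ E ℂ)) U :=
    hβ.clm_comp contDiffOn_const
  have hbil : ∀ (X : Type) [NormedAddCommGroup X] [NormedSpace ℝ X] (L : X →L[ℝ] E × ℂ),
      ContDiffOn ℝ ∞ (fun x => (extDL β x).bilinearComp L (ContinuousLinearMap.inl ℝ E ℂ)) U := by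
    intro X _ _ L
    have : ∀ x, (extDL β x).bilinearComp L (ContinuousLinearMap.inl ℝ E ℂ) =
        ((ContinuousLinearMap.compL ℝ E (E × ℂ) ℝ).flip (ContinuousLinearMap.inl ℝ E ℂ)).comp
          ((extDL β x).comp L) := fun x => rfl
    simp only [this]
    exact contDiffOn_const.clm_comp (hω.clm_comp contDiffOn_const)
  have hmap : ContDiffOn ℝ ∞ (sliceMap β) U := by
    let L' : ((E × ℝ →L[ℝ] (E →L[ℝ] ℝ)) × (E × ℝ →L[ℝ] ℝ)) →L[ℝ]
        (E × ℝ →L[ℝ] (E →L[ℝ] ℝ) × ℝ) :=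
      (ContinuousLinearMap.prodₗᵢ (𝕜 := ℝ) ℝ).toContinuousLinearEquiv.toContinuousLinearMap
    have h1 : ContDiffOn ℝ ∞ (fun x => ((ContinuousLinearMap.snd ℝ E ℝ).smulRight
        ((β x).comp (ContinuousLinearMap.inl ℝ E ℂ)))) U :=
      contDiffOn_clm_apply.2 fun u => contDiffOn_const.smul ha
    have h2 := ((hbil E (ContinuousLinearMap.inl ℝ E ℂ)).clm_comp
      (contDiffOn_const (c := ContinuousLinearMap.fst ℝ E ℝ))).sub h1
    have h3 := ha.clm_comp (contDiffOn_const (c := ContinuousLinearMap.fst ℝ E ℝ))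
    exact (ContinuousLinearMap.contDiff (F := E × ℝ →L[ℝ] (E →L[ℝ] ℝ) × ℝ) L').comp_contDiffOn (h2.prodMk h3)
  have hrhs : ContDiffOn ℝ ∞ (sliceRhs β) U := by
    have h2 := (hbil ℂ (ContinuousLinearMap.inr ℝ E ℂ)).neg
    have h3 := (hβ.clm_comp (contDiffOn_const (c := ContinuousLinearMap.inr ℝ E ℂ))).neg
    let L' : ((ℂ →L[ℝ] (E →L[ℝ] ℝ)) × (ℂ →L[ℝ] ℝ)) →L[ℝ] (ℂ →L[ℝ] (E →L[ℝ] ℝ) × ℝ) :=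
      (ContinuousLinearMap.prodₗᵢ (𝕜 := ℝ) ℝ).toContinuousLinearEquiv.toContinuousLinearMap
    exact (ContinuousLinearMap.contDiff (F := ℂ →L[ℝ] (E →L[ℝ] ℝ) × ℝ) L').comp_contDiffOn (h2.prodMk h3)
  obtain ⟨e, he⟩ := ContactNondegenerate.exists_equiv
    (a := (β x₀).comp (ContinuousLinearMap.inl ℝ E ℂ))
    (Ω := (extDL β x₀).bilinearComp (ContinuousLinearMap.inl ℝ E ℂ) (ContinuousLinearMap.inl ℝ E ℂ))
    hnd
  -- On the open set where the system is invertible, `V` is the E-component of its solution, and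
  -- inversion of operators is smooth.
  refine ⟨U ∩ sliceMap β ⁻¹' Set.range ((↑) : ((E × ℝ) ≃L[ℝ] (E →L[ℝ] ℝ) × ℝ) → _),
    fun x => (ContinuousLinearMap.fst ℝ E ℝ).comp ((sliceMap β x).inverse.comp (sliceRhs β x)),
    hmap.continuousOn.isOpen_inter_preimage hU ContinuousLinearEquiv.isOpen, ⟨hx₀, e, he⟩,
    Set.inter_subset_left, ?_, ?_⟩
  · rintro x ⟨hx, e', he'⟩
    refine contDiffWithinAt_const.clm_comp (ContDiffWithinAt.clm_comp ?_
      ((hrhs x hx).mono Set.inter_subset_left))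
    have h1 : ContDiffAt ℝ ∞ (ContinuousLinearMap.inverse (R := ℝ) (M := E × ℝ)
        (M₂ := (E →L[ℝ] ℝ) × ℝ)) (sliceMap β x) := by
      rw [← he']
      exact contDiffAt_map_inverse e'
    exact h1.comp_contDiffWithinAt x ((hmap x hx).mono Set.inter_subset_left)
  · rintro x ⟨hx, e', he'⟩
    have hmap' : ∀ y, sliceMap β x y = e' y := fun y => by rw [← he']; rfl
    refine ⟨sliceNondegenerate_of_injective fun y y' h => e'.injective ?_, fun v ζ => ?_⟩
    · rwa [hmap', hmap'] at h
    · rw [isCharacteristic_iff_exists]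
      simp only [ContinuousLinearMap.comp_apply, ContinuousLinearMap.coe_fst', ← he',
        ContinuousLinearMap.inverse_equiv, ContinuousLinearEquiv.coe_coe]
      constructor
      · rintro ⟨μ, hμ⟩
        rw [← hμ, ContinuousLinearEquiv.symm_apply_apply]
      · rintro hv
        exact ⟨(e'.symm (sliceRhs β x ζ)).2, by rw [hv, Prod.mk.eta, e'.apply_symm_apply]⟩

end Characteristic

/-! ### Lifted radii in a chart. -/

section RayFamily

/-- A locally defined smooth function agrees near a given point with a globally defined one. -/
lemma exists_contDiff_eventuallyEq {X Y : Type*} [NormedAddCommGroup X] [NormedSpace ℝ X]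
    [FiniteDimensional ℝ X] [NormedAddCommGroup Y] [NormedSpace ℝ Y] {f : X → Y} {U : Set X}
    (hU : IsOpen U) (hf : ContDiffOn ℝ ∞ f U) {x : X} (hx : x ∈ U) :
    ∃ g : X → Y, ContDiff ℝ ∞ g ∧ g =ᶠ[nhds x] f := by
  obtain ⟨ε, hε, hεU⟩ := Metric.isOpen_iff.1 hU x hx
  let φ : ContDiffBump x := ⟨ε / 4, ε / 2, by linarith, by linarith⟩
  refine ⟨fun y => φ y • f y, contDiff_iff_contDiffAt.2 fun y => ?_, ?_⟩
  · by_cases hy : y ∈ U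
    · exact φ.contDiffAt.smul (hf.contDiffAt (hU.mem_nhds hy))
    · have hy' : y ∉ tsupport φ := fun h => by
        rw [φ.tsupport_eq] at h
        exact hy (hεU (Metric.closedBall_subset_ball (by show ε / 2 < ε; linarith) h))
      refine (contDiffAt_const (c := (0 : Y))).congr_of_eventuallyEq ?_
      filter_upwards [(isClosed_tsupport φ).isOpen_compl.mem_nhds hy'] with z hz
      rw [image_eq_zero_of_notMem_tsupport hz, zero_smul]
  · filter_upwards [φ.eventuallyEq_one] with y hy
    rw [hy, Pi.one_apply, one_smul]

variable {E : Type} [NormedAddCommGroup E] [NormedSpace ℝ E] [FiniteDimensional ℝ E]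

/-- The rays of a smooth family of directions `V` over the zero section. -/
lemma exists_ray_family {V : E × ℂ → ℂ →L[ℝ] E} {U' : Set (E × ℂ)} (hU' : IsOpen U')
    (hV : ContDiffOn ℝ ∞ V U') {y₀ : E} (hy₀ : (y₀, (0 : ℂ)) ∈ U') :
    ∃ (U : Set (E × ℂ)) (u : ℝ → E × ℂ → E), IsOpen U ∧ (y₀, 0) ∈ U ∧
      ContDiffOn ℝ ∞ (u 1) U ∧ (∀ x, u 0 x = x.1) ∧
      ∀ x ∈ U, ∀ s ∈ Set.Icc (0 : ℝ) 1,
        HasDerivAt (fun τ => u τ x) (V (u s x, s • x.2) x.2) s ∧ (u s x, s • x.2) ∈ U' := by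
  obtain ⟨W, hW, hWV⟩ := exists_contDiff_eventuallyEq hU' hV hy₀
  have hev : ∀ᶠ x in nhds (y₀, (0 : ℂ)), x ∈ U' ∧ W x = V x :=
    (show ∀ᶠ x in nhds (y₀, (0 : ℂ)), x ∈ U' from hU'.mem_nhds hy₀).and hWV
  rw [nhds_prod_eq, Filter.eventually_prod_iff] at hev
  obtain ⟨pa, hpa, pb, hpb, hab⟩ := hev
  obtain ⟨ε, hε, hεb⟩ := Metric.eventually_nhds_iff_ball.1 hpb
  -- The lifted radius in direction z solves u' = V(u, sz) z. The right-hand side is linear in z, so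
  -- it vanishes at z = 0, and for small z the solution lasts until s = 1. `W` replaces `V` because
  -- the solution lemma takes a globally defined field.
  obtain ⟨U, u, hU, hyU, hu1, hu0, hu⟩ := exists_smooth_solution_family
    (F := fun q : ℝ × E × ℂ => W (q.2.1, q.1 • q.2.2) q.2.2)
    (by
      refine ContDiff.clm_apply (hW.comp ?_) (contDiff_snd.comp contDiff_snd)
      exact (contDiff_fst.comp contDiff_snd).prodMk
        (contDiff_fst.smul (contDiff_snd.comp contDiff_snd)))
    (fun s y => map_zero _) y₀ hpa
  refine ⟨U ∩ Prod.snd ⁻¹' Metric.ball 0 ε, u,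
    hU.inter (Metric.isOpen_ball.preimage continuous_snd), ⟨hyU, Metric.mem_ball_self hε⟩,
    hu1.mono Set.inter_subset_left, hu0, ?_⟩
  rintro x ⟨hxU, hxε⟩ s hs
  obtain ⟨hd, hN⟩ := hu x hxU s hs
  have hs' : s • x.2 ∈ Metric.ball (0 : ℂ) ε := by
    rw [Set.mem_preimage, mem_ball_zero_iff] at hxε
    rw [mem_ball_zero_iff, norm_smul, Real.norm_of_nonneg hs.1]
    exact (mul_le_of_le_one_left (norm_nonneg _) hs.2).trans_lt hxε
  obtain ⟨h1, h2⟩ := hab hN (hεb _ hs')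
  refine ⟨?_, h1⟩
  rw [← h2]
  exact hd

end RayFamily

/-! ### Transfer between B × ℂ and the charts of B. -/

section Product

variable {b d : ℕ}
  {B : Type v} [TopologicalSpace B] [ChartedSpace (EuclideanSpace ℝ (Fin b)) B]
  {M : Type u} [TopologicalSpace M] [ChartedSpace (EuclideanSpace ℝ (Fin d)) M]

/-- The pullback of `α` by `F : B × ℂ → M`. -/
def formAt (F : B × ℂ → M) (α : OneForm d M) (x : B × ℂ)
    (u : EuclideanSpace ℝ (Fin b) × ℂ) : ℝ :=
  α (F x) (mfderiv ((𝓡 b).prod 𝓘(ℝ, ℂ)) (𝓡 d) F x u)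

/-- The pullback of `dα` by `F : B × ℂ → M`. -/
def dFormAt (F : B × ℂ → M) (α : OneForm d M) (x : B × ℂ)
    (u w : EuclideanSpace ℝ (Fin b) × ℂ) : ℝ :=
  dForm α (F x) (mfderiv ((𝓡 b).prod 𝓘(ℝ, ℂ)) (𝓡 d) F x u)
    (mfderiv ((𝓡 b).prod 𝓘(ℝ, ℂ)) (𝓡 d) F x w)

/-- A map on `B × ℂ` in the chart of `B` at `q`. -/
def chartMap (F : B × ℂ → M) (q : B) (x : EuclideanSpace ℝ (Fin b) × ℂ) : M :=
  F ((extChartAt (𝓡 b) q).symm x.1, x.2)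

/-- The part of a set in `B × ℂ` that lies in the chart of `B` at `q`. -/
def chartDomain (S : Set (B × ℂ)) (q : B) : Set (EuclideanSpace ℝ (Fin b) × ℂ) :=
  {x | x.1 ∈ (extChartAt (𝓡 b) q).target ∧ ((extChartAt (𝓡 b) q).symm x.1, x.2) ∈ S}

/-- The derivative of the inverse of the chart of `B` at `q`. -/
def chartD (q : B) (y : EuclideanSpace ℝ (Fin b)) :
    EuclideanSpace ℝ (Fin b) →L[ℝ] EuclideanSpace ℝ (Fin b) :=
  mfderiv 𝓘(ℝ, EuclideanSpace ℝ (Fin b)) (𝓡 b) (extChartAt (𝓡 b) q).symm y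

/-- The derivative of the chart of `B` at `q`. -/
def chartDInv (q p : B) : EuclideanSpace ℝ (Fin b) →L[ℝ] EuclideanSpace ℝ (Fin b) :=
  mfderiv (𝓡 b) 𝓘(ℝ, EuclideanSpace ℝ (Fin b)) (extChartAt (𝓡 b) q) p

lemma isOpen_chartDomain {S : Set (B × ℂ)} (hS : IsOpen S) (q : B) :
    IsOpen (chartDomain (b := b) S q) := by
  have h : ContinuousOn (fun x : EuclideanSpace ℝ (Fin b) × ℂ =>
      ((extChartAt (𝓡 b) q).symm x.1, x.2)) ((extChartAt (𝓡 b) q).target ×ˢ Set.univ) :=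
    ((continuousOn_extChartAt_symm q).comp continuousOn_fst fun _ hx => hx.1).prodMk
      continuousOn_snd
  have := h.isOpen_inter_preimage ((isOpen_extChartAt_target q).prod isOpen_univ) hS
  convert this using 1
  ext x
  simp [chartDomain]

lemma mem_chartDomain {S : Set (B × ℂ)} {q : B} {x : B × ℂ}
    (hx : x.1 ∈ (extChartAt (𝓡 b) q).source) (hxS : x ∈ S) :
    (extChartAt (𝓡 b) q x.1, x.2) ∈ chartDomain (b := b) S q := by
  refine ⟨(extChartAt (𝓡 b) q).map_source hx, ?_⟩
  simpa only [(extChartAt (𝓡 b) q).left_inv hx] using hxS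

variable [IsManifold (𝓡 b) ∞ B] [IsManifold (𝓡 d) ∞ M]

lemma chartD_chartDInv {q p : B} (hp : p ∈ (extChartAt (𝓡 b) q).source)
    (v : EuclideanSpace ℝ (Fin b)) :
    chartD q (extChartAt (𝓡 b) q p) (chartDInv q p v) = v := by
  have : IsManifold (𝓡 b) 1 B := .of_le (n := ∞) (by simp)
  have h := mfderivWithin_extChartAt_symm_comp_mfderiv_extChartAt' (I := 𝓡 b) hp
  rw [show Set.range (𝓡 b) = Set.univ from ModelWithCorners.range_eq_univ _,
    mfderivWithin_univ] at h
  exact DFunLike.congr_fun h v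

lemma chartDInv_chartD {q p : B} (hp : p ∈ (extChartAt (𝓡 b) q).source)
    (v : EuclideanSpace ℝ (Fin b)) :
    chartDInv q p (chartD q (extChartAt (𝓡 b) q p) v) = v := by
  have : IsManifold (𝓡 b) 1 B := .of_le (n := ∞) (by simp)
  have h := mfderiv_extChartAt_comp_mfderivWithin_extChartAt_symm' (I := 𝓡 b) hp
  rw [show Set.range (𝓡 b) = Set.univ from ModelWithCorners.range_eq_univ _,
    mfderivWithin_univ] at h
  exact DFunLike.congr_fun h v

lemma chartD_self (q : B) (v : EuclideanSpace ℝ (Fin b)) :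
    chartD q (extChartAt (𝓡 b) q q) v = v := by
  have : IsManifold (𝓡 b) 1 B := .of_le (n := ∞) (by simp)
  have h := chartD_chartDInv (mem_extChartAt_source (I := 𝓡 b) q) v
  have h2 : chartDInv q q v = v := DFunLike.congr_fun (mfderiv_extChartAt_self (I := 𝓡 b) (x := q)) v
  rwa [h2] at h

lemma contMDiffOn_chart_prod (S : Set (B × ℂ)) (q : B) :
    ContMDiffOn 𝓘(ℝ, EuclideanSpace ℝ (Fin b) × ℂ) ((𝓡 b).prod 𝓘(ℝ, ℂ)) ∞
      (fun x : EuclideanSpace ℝ (Fin b) × ℂ => ((extChartAt (𝓡 b) q).symm x.1, x.2))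
      (chartDomain S q) :=
  ((contMDiffOn_extChartAt_symm q).comp contDiff_fst.contMDiff.contMDiffOn
    fun _ hx => hx.1).prodMk contDiff_snd.contMDiff.contMDiffOn

lemma contMDiffOn_chartMap {F : B × ℂ → M} {S : Set (B × ℂ)}
    (hF : ContMDiffOn ((𝓡 b).prod 𝓘(ℝ, ℂ)) (𝓡 d) ∞ F S) (q : B) :
    ContMDiffOn 𝓘(ℝ, EuclideanSpace ℝ (Fin b) × ℂ) (𝓡 d) ∞ (chartMap (b := b) F q)
      (chartDomain S q) :=
  hF.comp (contMDiffOn_chart_prod S q) fun _ hx => hx.2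

lemma hasMFDerivAt_chart_prod (q : B) {x : EuclideanSpace ℝ (Fin b) × ℂ}
    (hx : x.1 ∈ (extChartAt (𝓡 b) q).target) :
    HasMFDerivAt 𝓘(ℝ, EuclideanSpace ℝ (Fin b) × ℂ) ((𝓡 b).prod 𝓘(ℝ, ℂ))
      (fun x : EuclideanSpace ℝ (Fin b) × ℂ => ((extChartAt (𝓡 b) q).symm x.1, x.2)) x
      (((chartD q x.1).comp (ContinuousLinearMap.fst ℝ _ ℂ)).prod
        (ContinuousLinearMap.snd ℝ (EuclideanSpace ℝ (Fin b)) ℂ)) := by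
  have h1 : HasMFDerivAt 𝓘(ℝ, EuclideanSpace ℝ (Fin b)) (𝓡 b) (extChartAt (𝓡 b) q).symm x.1
      (chartD q x.1) :=
    (((contMDiffOn_extChartAt_symm (n := ∞) q).contMDiffAt
      ((isOpen_extChartAt_target q).mem_nhds hx)).mdifferentiableAt (by simp)).hasMFDerivAt
  exact (h1.comp x hasFDerivAt_fst.hasMFDerivAt).prodMk hasFDerivAt_snd.hasMFDerivAt

lemma mfderiv_chartMap {F : B × ℂ → M} {S : Set (B × ℂ)} (hS : IsOpen S)
    (hF : ContMDiffOn ((𝓡 b).prod 𝓘(ℝ, ℂ)) (𝓡 d) ∞ F S) (q : B)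
    {x : EuclideanSpace ℝ (Fin b) × ℂ} (hx : x ∈ chartDomain S q)
    (u : EuclideanSpace ℝ (Fin b) × ℂ) :
    mfderiv 𝓘(ℝ, EuclideanSpace ℝ (Fin b) × ℂ) (𝓡 d) (chartMap F q) x u =
      mfderiv ((𝓡 b).prod 𝓘(ℝ, ℂ)) (𝓡 d) F ((extChartAt (𝓡 b) q).symm x.1, x.2)
        ((chartD q x.1 u.1, u.2) : EuclideanSpace ℝ (Fin b) × ℂ) := by
  have hFx : MDifferentiableAt ((𝓡 b).prod 𝓘(ℝ, ℂ)) (𝓡 d) F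
      ((extChartAt (𝓡 b) q).symm x.1, x.2) :=
    (hF.contMDiffAt (hS.mem_nhds hx.2)).mdifferentiableAt (by simp)
  have h := (hFx.hasMFDerivAt.comp x (hasMFDerivAt_chart_prod q hx.1)).mfderiv
  exact DFunLike.congr_fun h u

/-- The pullback of a form by a map on `B × ℂ`, in the chart of `B` at `q`. -/
def chartForm (F : B × ℂ → M) (α : OneForm d M) (q : B) :
    EuclideanSpace ℝ (Fin b) × ℂ → EuclideanSpace ℝ (Fin b) × ℂ →L[ℝ] ℝ :=
  pullForm α (chartMap F q)

section ChartForm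

variable {α : OneForm d M} {F : B × ℂ → M} {S : Set (B × ℂ)}

lemma contDiffOn_chartForm (hα : IsSmoothForm α) (hS : IsOpen S)
    (hF : ContMDiffOn ((𝓡 b).prod 𝓘(ℝ, ℂ)) (𝓡 d) ∞ F S) (q : B) :
    ContDiffOn ℝ ∞ (chartForm F α q) (chartDomain (b := b) S q) :=
  contDiffOn_pullForm hα (isOpen_chartDomain hS q) (contMDiffOn_chartMap hF q)

lemma chartForm_apply (hS : IsOpen S)
    (hF : ContMDiffOn ((𝓡 b).prod 𝓘(ℝ, ℂ)) (𝓡 d) ∞ F S) {q : B}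
    {x : EuclideanSpace ℝ (Fin b) × ℂ} (hx : x ∈ chartDomain S q)
    (u : EuclideanSpace ℝ (Fin b) × ℂ) :
    chartForm F α q x u =
      formAt F α ((extChartAt (𝓡 b) q).symm x.1, x.2) (chartD q x.1 u.1, u.2) := by
  have h := mfderiv_chartMap hS hF q hx u
  exact congrArg (α (chartMap F q x)) h

lemma extD_chartForm (hα : IsSmoothForm α) (hS : IsOpen S)
    (hF : ContMDiffOn ((𝓡 b).prod 𝓘(ℝ, ℂ)) (𝓡 d) ∞ F S) {q : B}
    {x : EuclideanSpace ℝ (Fin b) × ℂ} (hx : x ∈ chartDomain S q)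
    (u w : EuclideanSpace ℝ (Fin b) × ℂ) :
    extD (chartForm F α q) x u w =
      dFormAt F α ((extChartAt (𝓡 b) q).symm x.1, x.2) (chartD q x.1 u.1, u.2)
        (chartD q x.1 w.1, w.2) := by
  have h := dForm_pullForm hα (isOpen_chartDomain hS q) (contMDiffOn_chartMap hF q) hx u w
  rw [mfderiv_chartMap hS hF q hx u, mfderiv_chartMap hS hF q hx w] at h
  exact h.symm

lemma chartForm_apply' (hS : IsOpen S)
    (hF : ContMDiffOn ((𝓡 b).prod 𝓘(ℝ, ℂ)) (𝓡 d) ∞ F S) {q : B}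
    {x : B × ℂ} (hq : x.1 ∈ (extChartAt (𝓡 b) q).source) (hx : x ∈ S)
    (u : EuclideanSpace ℝ (Fin b) × ℂ) :
    chartForm F α q (extChartAt (𝓡 b) q x.1, x.2) u =
      formAt F α x (chartD q (extChartAt (𝓡 b) q x.1) u.1, u.2) := by
  rw [chartForm_apply hS hF (mem_chartDomain hq hx)]
  simp only [(extChartAt (𝓡 b) q).left_inv hq]

lemma extD_chartForm' (hα : IsSmoothForm α) (hS : IsOpen S)
    (hF : ContMDiffOn ((𝓡 b).prod 𝓘(ℝ, ℂ)) (𝓡 d) ∞ F S) {q : B}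
    {x : B × ℂ} (hq : x.1 ∈ (extChartAt (𝓡 b) q).source) (hx : x ∈ S)
    (u w : EuclideanSpace ℝ (Fin b) × ℂ) :
    extD (chartForm F α q) (extChartAt (𝓡 b) q x.1, x.2) u w =
      dFormAt F α x (chartD q (extChartAt (𝓡 b) q x.1) u.1, u.2)
        (chartD q (extChartAt (𝓡 b) q x.1) w.1, w.2) := by
  rw [extD_chartForm hα hS hF (mem_chartDomain hq hx)]
  simp only [(extChartAt (𝓡 b) q).left_inv hq]

/-- The chart transfers characteristic vectors. -/
lemma isCharacteristic_chartForm (hα : IsSmoothForm α) (hS : IsOpen S)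
    (hF : ContMDiffOn ((𝓡 b).prod 𝓘(ℝ, ℂ)) (𝓡 d) ∞ F S) {q : B}
    {x : B × ℂ} (hq : x.1 ∈ (extChartAt (𝓡 b) q).source) (hx : x ∈ S)
    (v : EuclideanSpace ℝ (Fin b)) (ζ : ℂ) :
    IsCharacteristic (fun u => chartForm F α q (extChartAt (𝓡 b) q x.1, x.2) u)
        (extD (chartForm F α q) (extChartAt (𝓡 b) q x.1, x.2)) v ζ ↔
      IsCharacteristic (formAt F α x) (dFormAt F α x)
        (chartD q (extChartAt (𝓡 b) q x.1) v) ζ := by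
  simp only [IsCharacteristic, chartForm_apply' hS hF hq hx, extD_chartForm' hα hS hF hq hx]
  refine and_congr Iff.rfl ⟨fun h u hu => ?_, fun h u hu => h _ hu⟩
  have := h (chartDInv q x.1 u)
  rw [chartD_chartDInv hq] at this
  exact this hu

lemma sliceNondegenerate_chartForm (hα : IsSmoothForm α) (hS : IsOpen S)
    (hF : ContMDiffOn ((𝓡 b).prod 𝓘(ℝ, ℂ)) (𝓡 d) ∞ F S) {q : B}
    {x : B × ℂ} (hq : x.1 ∈ (extChartAt (𝓡 b) q).source) (hx : x ∈ S) :
    SliceNondegenerate (fun u => chartForm F α q (extChartAt (𝓡 b) q x.1, x.2) u)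
        (extD (chartForm F α q) (extChartAt (𝓡 b) q x.1, x.2)) ↔
      SliceNondegenerate (formAt (b := b) F α x) (dFormAt (b := b) F α x) := by
  simp only [SliceNondegenerate, ContactNondegenerate, chartForm_apply' hS hF hq hx,
    extD_chartForm' hα hS hF hq hx]
  refine and_congr ⟨fun ⟨e, he⟩ => ⟨_, he⟩, fun ⟨e, he⟩ => ⟨chartDInv (b := b) q x.1 e, ?_⟩⟩
    ⟨fun h u hu hu' => ?_, fun h u hu hu' => ?_⟩
  · rwa [chartD_chartDInv hq]
  · have h1 := h (chartDInv q x.1 u)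
    simp only [chartD_chartDInv hq] at h1
    have h2 := congrArg (chartD q (extChartAt (𝓡 b) q x.1)) (h1 hu fun w hw => hu' _ hw)
    rwa [chartD_chartDInv hq, map_zero] at h2
  · have h1 := h (chartD q (extChartAt (𝓡 b) q x.1) u) hu fun w hw => by
      have := hu' (chartDInv q x.1 w)
      rw [chartD_chartDInv hq] at this
      exact this hw
    have h2 := congrArg (chartDInv q x.1) h1
    rwa [chartDInv_chartD hq, map_zero] at h2

end ChartForm

end Product

section Linear

variable {b d : ℕ}
  {B : Type v} [TopologicalSpace B] [ChartedSpace (EuclideanSpace ℝ (Fin b)) B]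
  {M : Type u} [TopologicalSpace M] [ChartedSpace (EuclideanSpace ℝ (Fin d)) M]

/-- The exterior derivative of a 1-form as a bilinear map. -/
def dFormL (α : OneForm d M) (q : M) :
    EuclideanSpace ℝ (Fin d) →L[ℝ] EuclideanSpace ℝ (Fin d) →L[ℝ] ℝ :=
  let c : EuclideanSpace ℝ (Fin d) →L[ℝ] EuclideanSpace ℝ (Fin d) :=
    mfderiv (𝓡 d) 𝓘(ℝ, EuclideanSpace ℝ (Fin d)) (extChartAt (𝓡 d) q) q
  (extDL (localForm α q) (extChartAt (𝓡 d) q q)).bilinearComp c c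

lemma dForm_swap (α : OneForm d M) (q : M) (v w : TangentSpace (𝓡 d) q) :
    dForm α q v w = -dForm α q w v := (neg_sub _ _).symm

lemma dForm_self (α : OneForm d M) (q : M) (v : TangentSpace (𝓡 d) q) :
    dForm α q v v = 0 := sub_self _

/-- The derivative of a map on `B × ℂ`, as a map of vector spaces. -/
def derivAt (F : B × ℂ → M) (x : B × ℂ) :
    EuclideanSpace ℝ (Fin b) × ℂ →L[ℝ] EuclideanSpace ℝ (Fin d) :=
  mfderiv ((𝓡 b).prod 𝓘(ℝ, ℂ)) (𝓡 d) F x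

/-- The pullback of `α` by `F` as a linear form. -/
def formAtL (F : B × ℂ → M) (α : OneForm d M) (x : B × ℂ) :
    EuclideanSpace ℝ (Fin b) × ℂ →L[ℝ] ℝ :=
  let a : EuclideanSpace ℝ (Fin d) →L[ℝ] ℝ := α (F x)
  a.comp (derivAt F x)

/-- The pullback of `dα` by `F` as a bilinear map. -/
def dFormAtL (F : B × ℂ → M) (α : OneForm d M) (x : B × ℂ) :
    EuclideanSpace ℝ (Fin b) × ℂ →L[ℝ] EuclideanSpace ℝ (Fin b) × ℂ →L[ℝ] ℝ :=
  (dFormL α (F x)).bilinearComp (derivAt F x) (derivAt F x)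

lemma formAt_eq_formAtL (F : B × ℂ → M) (α : OneForm d M) (x : B × ℂ)
    (u : EuclideanSpace ℝ (Fin b) × ℂ) : formAt F α x u = formAtL F α x u := rfl

lemma dFormAt_eq_dFormAtL (F : B × ℂ → M) (α : OneForm d M) (x : B × ℂ)
    (u w : EuclideanSpace ℝ (Fin b) × ℂ) : dFormAt F α x u w = dFormAtL F α x u w := rfl

end Linear

/-! ### Lifted radii in B × ℂ: uniqueness and smooth endpoints. -/

section Rays

variable {b d : ℕ}
  {B : Type v} [TopologicalSpace B] [ChartedSpace (EuclideanSpace ℝ (Fin b)) B]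
  {M : Type u} [TopologicalSpace M] [ChartedSpace (EuclideanSpace ℝ (Fin d)) M]

/-- A curve `γ` in `B` such that the curve `s ↦ (γ s, s z)` in `B × ℂ`, which starts at `(p, 0)`,
is tangent to the characteristic directions. -/
structure IsRay (F : B × ℂ → M) (α : OneForm d M) (S : Set (B × ℂ)) (p : B) (z : ℂ)
    (γ : ℝ → B) : Prop where
  zero : γ 0 = p
  mem : ∀ s ∈ Set.Icc (0 : ℝ) 1, (γ s, s • z) ∈ S
  deriv : ∀ s ∈ Set.Icc (0 : ℝ) 1, ∃ v : EuclideanSpace ℝ (Fin b),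
    HasMFDerivAt 𝓘(ℝ, ℝ) (𝓡 b) γ s (ContinuousLinearMap.toSpanSingleton ℝ v) ∧
      IsCharacteristic (formAt F α (γ s, s • z)) (dFormAt F α (γ s, s • z)) v z

lemma isCharacteristic_smul {F : B × ℂ → M} {α : OneForm d M} {x : B × ℂ}
    {v : EuclideanSpace ℝ (Fin b)} {ζ : ℂ}
    (h : IsCharacteristic (formAt F α x) (dFormAt F α x) v ζ) (t : ℝ) :
    IsCharacteristic (formAt F α x) (dFormAt F α x) (t • v) (t • ζ) := by
  simp only [IsCharacteristic, formAt_eq_formAtL, dFormAt_eq_dFormAtL] at h ⊢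
  simp only [← Prod.smul_mk, map_smul, smul_apply, smul_eq_mul]
  exact ⟨by rw [h.1, mul_zero], fun u hu => by rw [h.2 u hu, mul_zero]⟩

/-- Being characteristic is homogeneous in the direction, so an initial piece of a ray traversed at
slower speed is again a ray. Consequently the endpoint for the direction tz is the point at time t
of the ray for z. -/
lemma IsRay.rescale {F : B × ℂ → M} {α : OneForm d M} {S : Set (B × ℂ)} {p : B} {z : ℂ}
    {γ : ℝ → B} (h : IsRay (b := b) F α S p z γ) {t : ℝ} (ht : t ∈ Set.Icc (0 : ℝ) 1) :
    IsRay (b := b) F α S p (t • z) (fun s => γ (s * t)) := by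
  have hmem : ∀ s ∈ Set.Icc (0 : ℝ) 1, s * t ∈ Set.Icc (0 : ℝ) 1 := fun s hs =>
    ⟨mul_nonneg hs.1 ht.1, mul_le_one₀ hs.2 ht.1 ht.2⟩
  refine ⟨by simpa using h.zero, fun s hs => ?_, fun s hs => ?_⟩
  · rw [smul_smul]; exact h.mem _ (hmem s hs)
  · obtain ⟨v, hv, hc⟩ := h.deriv _ (hmem s hs)
    refine ⟨t • v, ?_, ?_⟩
    · have h1 : HasFDerivAt (fun s : ℝ => s * t) (ContinuousLinearMap.toSpanSingleton ℝ t) s := by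
        simpa using ((hasDerivAt_id s).mul_const t).hasFDerivAt
      have h2 : (ContinuousLinearMap.toSpanSingleton ℝ v).comp
          (ContinuousLinearMap.toSpanSingleton ℝ t) = ContinuousLinearMap.toSpanSingleton ℝ (t • v) := by
        ext; simp
      exact (hv.comp s h1.hasMFDerivAt).congr_mfderiv h2
    · rw [smul_smul]; exact isCharacteristic_smul hc t

lemma hasDerivAt_extChartAt_comp [IsManifold (𝓡 b) ∞ B] {γ : ℝ → B} {s : ℝ}
    {v : EuclideanSpace ℝ (Fin b)}
    (h : HasMFDerivAt 𝓘(ℝ, ℝ) (𝓡 b) γ s (ContinuousLinearMap.toSpanSingleton ℝ v)) {q : B}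
    (hq : γ s ∈ (extChartAt (𝓡 b) q).source) :
    HasDerivAt (fun τ => extChartAt (𝓡 b) q (γ τ)) (chartDInv q (γ s) v) s := by
  have h1 : HasMFDerivAt (𝓡 b) 𝓘(ℝ, EuclideanSpace ℝ (Fin b)) (extChartAt (𝓡 b) q) (γ s)
      (chartDInv q (γ s)) :=
    ((contMDiffAt_extChartAt' (n := ∞) (by simpa using hq)).mdifferentiableAt
      (by simp)).hasMFDerivAt
  have h2 : HasFDerivAt (fun τ => extChartAt (𝓡 b) q (γ τ))
      ((chartDInv q (γ s)).comp (ContinuousLinearMap.toSpanSingleton ℝ v)) s :=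
    (h1.comp s h).hasFDerivAt
  simpa using h2.hasDerivAt

variable [IsManifold (𝓡 b) ∞ B] [IsManifold (𝓡 d) ∞ M]
  {F : B × ℂ → M} {α : OneForm d M} {S : Set (B × ℂ)}

/-- Two rays that meet at some time agree for some time after. -/
lemma IsRay.eventually_eq (hα : IsSmoothForm α) (hS : IsOpen S)
    (hF : ContMDiffOn ((𝓡 b).prod 𝓘(ℝ, ℂ)) (𝓡 d) ∞ F S)
    (hnd : ∀ x ∈ S, SliceNondegenerate (formAt (b := b) F α x) (dFormAt (b := b) F α x))
    {p : B} {z : ℂ} {γ₁ γ₂ : ℝ → B} (h₁ : IsRay (b := b) F α S p z γ₁)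
    (h₂ : IsRay (b := b) F α S p z γ₂) {s : ℝ} (hs : s ∈ Set.Ico (0 : ℝ) 1)
    (heq : γ₁ s = γ₂ s) : ∀ᶠ τ in nhdsWithin s (Set.Ioi s), γ₁ τ = γ₂ τ := by
  have hsI : s ∈ Set.Icc (0 : ℝ) 1 := Set.Ico_subset_Icc_self hs
  set q := γ₁ s with hq
  set χ := extChartAt (𝓡 b) q with hχ
  have hqS : (q, s • z) ∈ S := h₁.mem s hsI
  have hx₀ := mem_chartDomain (b := b) (x := (q, s • z)) (mem_extChartAt_source q) hqS
  obtain ⟨U', V, hU', hxU', hU'S, hV, hVc⟩ := exists_characteristic_field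
    (isOpen_chartDomain hS q) (contDiffOn_chartForm hα hS hF q) hx₀
    ((sliceNondegenerate_chartForm hα hS hF (mem_extChartAt_source q) hqS).2 (hnd _ hqS))
  -- In the chart at the meeting point both curves solve the same equation y' = V(y, τz) z. Its C¹
  -- right-hand side is locally Lipschitz, so uniqueness of solutions applies.
  have hVz : ContDiffAt ℝ 1 (fun x => V x z) (χ q, s • z) :=
    ((hV.contDiffAt (hU'.mem_nhds hxU')).clm_apply contDiffAt_const).of_le (by simp)
  obtain ⟨K, t, ht, hK⟩ := hVz.exists_lipschitzOnWith
  have key : ∀ γ : ℝ → B, IsRay (b := b) F α S p z γ → γ s = q →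
      ContinuousAt γ s ∧ ∀ᶠ τ in nhds s, γ τ ∈ χ.source ∧ (χ (γ τ), τ • z) ∈ t ∧
        (τ ∈ Set.Icc (0 : ℝ) 1 →
          HasDerivAt (fun τ => χ (γ τ)) (V (χ (γ τ), τ • z) z) τ) := by
    intro γ h hγ
    obtain ⟨v, hv, -⟩ := h.deriv s hsI
    have hc : ContinuousAt γ s := hv.continuousAt
    have hsrc : ∀ᶠ τ in nhds s, γ τ ∈ χ.source :=
      hc.preimage_mem_nhds (by rw [hγ]; exact extChartAt_source_mem_nhds q)
    have hc' : ContinuousAt (fun τ => (χ (γ τ), τ • z)) s := by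
      refine ContinuousAt.prodMk ?_ (by fun_prop)
      refine ContinuousAt.comp (g := χ) ?_ hc
      rw [hγ]
      exact continuousAt_extChartAt q
    have ht' := hc'.preimage_mem_nhds (t := t ∩ U') (by
      simp only [hγ]; exact Filter.inter_mem ht (hU'.mem_nhds hxU'))
    refine ⟨hc, ?_⟩
    filter_upwards [hsrc, ht'] with τ h1 h2
    refine ⟨h1, h2.1, fun hτ => ?_⟩
    obtain ⟨v, hv, hch⟩ := h.deriv τ hτ
    have h3 := hasDerivAt_extChartAt_comp hv h1
    have h4 := ((hVc _ h2.2).2 (chartDInv q (γ τ) v) z).1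
      ((isCharacteristic_chartForm hα hS hF (x := (γ τ, τ • z)) h1 (h.mem τ hτ) _ z).2
        (by rw [chartD_chartDInv h1]; exact hch))
    rw [← h4]
    exact h3
  obtain ⟨-, k1⟩ := key γ₁ h₁ rfl
  obtain ⟨-, k2⟩ := key γ₂ h₂ heq.symm
  obtain ⟨ε, hε, hball⟩ := Metric.eventually_nhds_iff_ball.1 (k1.and k2)
  set c := min (s + ε / 2) 1 with hc
  have hsc : s < c := lt_min (by linarith) hs.2
  have hmem : ∀ τ ∈ Set.Icc s c, τ ∈ Metric.ball s ε ∧ τ ∈ Set.Icc (0 : ℝ) 1 := by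
    intro τ hτ
    have h1 : τ ≤ s + ε / 2 := hτ.2.trans (min_le_left _ _)
    refine ⟨?_, hs.1.trans hτ.1, hτ.2.trans (min_le_right _ _)⟩
    rw [Real.ball_eq_Ioo]
    exact ⟨by linarith [hτ.1], by linarith⟩
  have hode := ODE_solution_unique_of_mem_Icc_right (E := EuclideanSpace ℝ (Fin b))
    (v := fun τ y => V (y, τ • z) z) (s := fun τ => {y | (y, τ • z) ∈ t}) (K := K)
    (f := fun τ => χ (γ₁ τ)) (g := fun τ => χ (γ₂ τ)) (a := s) (b := c)
    (fun τ _ => by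
      have h1 := hK.comp (f := fun y : EuclideanSpace ℝ (Fin b) => (y, τ • z))
        (s := {y | (y, τ • z) ∈ t})
        ((LipschitzWith.prodMk_right (τ • z)).lipschitzOnWith) (fun y hy => hy)
      simpa [Function.comp_def] using h1)
    (fun τ hτ => (((hball τ (hmem τ hτ).1).1.2.2
      (hmem τ hτ).2).continuousAt.continuousWithinAt))
    (fun τ hτ => ((hball τ (hmem τ (Set.Ico_subset_Icc_self hτ)).1).1.2.2
      (hmem τ (Set.Ico_subset_Icc_self hτ)).2).hasDerivWithinAt)
    (fun τ hτ => (hball τ (hmem τ (Set.Ico_subset_Icc_self hτ)).1).1.2.1)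
    (fun τ hτ => (((hball τ (hmem τ hτ).1).2.2.2
      (hmem τ hτ).2).continuousAt.continuousWithinAt))
    (fun τ hτ => ((hball τ (hmem τ (Set.Ico_subset_Icc_self hτ)).1).2.2.2
      (hmem τ (Set.Ico_subset_Icc_self hτ)).2).hasDerivWithinAt)
    (fun τ hτ => (hball τ (hmem τ (Set.Ico_subset_Icc_self hτ)).1).2.2.1)
    (by simp only [← heq]; rfl)
  filter_upwards [Ioo_mem_nhdsGT hsc] with τ hτ
  have hτ' := Set.Ioo_subset_Icc_self hτ
  exact χ.injOn (hball τ (hmem τ hτ').1).1.1 (hball τ (hmem τ hτ').1).2.1 (hode hτ')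

lemma IsRay.continuousOn {p : B} {z : ℂ} {γ : ℝ → B} (h : IsRay (b := b) F α S p z γ) :
    ContinuousOn γ (Set.Icc 0 1) := fun s hs => by
  obtain ⟨v, hv, -⟩ := h.deriv s hs
  exact hv.continuousAt.continuousWithinAt

/-- The times of agreement form a closed set, since B is Hausdorff. It contains 0 and extends to the
right of each of its points before 1, so it is all of [0, 1]. -/
lemma IsRay.eqOn [T2Space B] (hα : IsSmoothForm α) (hS : IsOpen S)
    (hF : ContMDiffOn ((𝓡 b).prod 𝓘(ℝ, ℂ)) (𝓡 d) ∞ F S)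
    (hnd : ∀ x ∈ S, SliceNondegenerate (formAt (b := b) F α x) (dFormAt (b := b) F α x))
    {p : B} {z : ℂ} {γ₁ γ₂ : ℝ → B} (h₁ : IsRay (b := b) F α S p z γ₁)
    (h₂ : IsRay (b := b) F α S p z γ₂) : Set.EqOn γ₁ γ₂ (Set.Icc 0 1) := by
  have hcl : IsClosed ({s | γ₁ s = γ₂ s} ∩ Set.Icc (0 : ℝ) 1) := by
    have h := (h₁.continuousOn.prodMk h₂.continuousOn).preimage_isClosed_of_isClosed
      isClosed_Icc isClosed_diagonal
    rwa [Set.inter_comm] at h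
  exact hcl.Icc_subset_of_forall_mem_nhdsWithin (h₁.zero.trans h₂.zero.symm)
    fun s hs => h₁.eventually_eq hα hS hF hnd h₂ hs.2 hs.1

/-- Near a point of the zero section the endpoints of rays depend smoothly on the data. -/
lemma exists_ray_endpoints (hα : IsSmoothForm α) (hS : IsOpen S)
    (hF : ContMDiffOn ((𝓡 b).prod 𝓘(ℝ, ℂ)) (𝓡 d) ∞ F S)
    (hnd : ∀ x ∈ S, SliceNondegenerate (formAt (b := b) F α x) (dFormAt (b := b) F α x))
    {p : B} (hp : (p, (0 : ℂ)) ∈ S) :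
    ∃ (W : Set (B × ℂ)) (h : B × ℂ → B), IsOpen W ∧ (p, 0) ∈ W ∧
      ContMDiffOn ((𝓡 b).prod 𝓘(ℝ, ℂ)) (𝓡 b) ∞ h W ∧
      ∀ x ∈ W, ∃ γ, IsRay (b := b) F α S x.1 x.2 γ ∧ γ 1 = h x := by
  set χ := extChartAt (𝓡 b) p with hχ
  have hx₀ := mem_chartDomain (b := b) (x := (p, (0 : ℂ))) (mem_extChartAt_source p) hp
  obtain ⟨U', V, hU', hxU', hU'S, hV, hVc⟩ := exists_characteristic_field
    (isOpen_chartDomain hS p) (contDiffOn_chartForm hα hS hF p) hx₀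
    ((sliceNondegenerate_chartForm hα hS hF (mem_extChartAt_source p) hp).2 (hnd _ hp))
  obtain ⟨U, u, hU, hpU, hu1, hu0, hu⟩ := exists_ray_family hU' hV hxU'
  have hcχ : ContMDiffOn ((𝓡 b).prod 𝓘(ℝ, ℂ)) 𝓘(ℝ, EuclideanSpace ℝ (Fin b) × ℂ) ∞
      (fun x : B × ℂ => (χ x.1, x.2)) (χ.source ×ˢ Set.univ) :=
    (((contMDiffOn_extChartAt (n := ∞) (I := 𝓡 b) (x := p)).comp contMDiffOn_fst fun x hx => by
      simpa [hχ] using hx.1)).prodMk_space contMDiffOn_snd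
  refine ⟨(χ.source ×ˢ Set.univ) ∩ (fun x : B × ℂ => (χ x.1, x.2)) ⁻¹' U,
    fun x => χ.symm (u 1 (χ x.1, x.2)),
    hcχ.continuousOn.isOpen_inter_preimage ((isOpen_extChartAt_source p).prod isOpen_univ) hU,
    ⟨⟨mem_extChartAt_source p, trivial⟩, hpU⟩, ?_, ?_⟩
  · refine (contMDiffOn_extChartAt_symm (n := ∞) (I := 𝓡 b) p).comp (t := χ.target)
      (hu1.contMDiffOn.comp (hcχ.mono Set.inter_subset_left) fun x hx => hx.2) fun x hx => ?_
    exact (hU'S (hu _ hx.2 1 ⟨zero_le_one, le_rfl⟩).2).1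
  · rintro x ⟨hx1, hx2⟩
    have hcd := fun s hs => hU'S (hu _ hx2 s hs).2
    refine ⟨fun s => χ.symm (u s (χ x.1, x.2)), ⟨?_, fun s hs => (hcd s hs).2, fun s hs => ?_⟩, rfl⟩
    · simp only [hu0]
      exact χ.left_inv hx1.1
    · have hst := (hcd s hs).1
      refine ⟨_, ?_, (isCharacteristic_chartForm hα hS hF
        (x := (χ.symm (u s (χ x.1, x.2)), s • x.2)) (χ.map_target hst) (hcd s hs).2 
          (V (u s (χ x.1, x.2), s • x.2) x.2) x.2).1 ?_⟩
      · have h1 : HasMFDerivAt 𝓘(ℝ, EuclideanSpace ℝ (Fin b)) (𝓡 b) χ.symm (u s (χ x.1, x.2))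
            (chartD p (u s (χ x.1, x.2))) :=
          (((contMDiffOn_extChartAt_symm (n := ∞) p).contMDiffAt
            ((isOpen_extChartAt_target p).mem_nhds hst)).mdifferentiableAt (by simp)).hasMFDerivAt
        have h2 : (chartD p (u s (χ x.1, x.2))).comp (ContinuousLinearMap.toSpanSingleton ℝ
              (V (u s (χ x.1, x.2), s • x.2) x.2)) =
            ContinuousLinearMap.toSpanSingleton ℝ (chartD p (χ (χ.symm (u s (χ x.1, x.2))))
              (V (u s (χ x.1, x.2), s • x.2) x.2)) := by
          rw [χ.right_inv hst]
          ext
          simp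
        exact (h1.comp s (hu _ hx2 s hs).1.hasFDerivAt.hasMFDerivAt).congr_mfderiv h2
      · rw [χ.right_inv hst]
        exact ((hVc _ (hu _ hx2 s hs).2).2 _ _).2 rfl

end Rays

/-! ### The endpoint map of the lifted radii. -/

section RadialMap

variable {b d : ℕ}
  {B : Type v} [TopologicalSpace B] [ChartedSpace (EuclideanSpace ℝ (Fin b)) B]
  {M : Type u} [TopologicalSpace M] [ChartedSpace (EuclideanSpace ℝ (Fin d)) M]

lemma isRay_const {F : B × ℂ → M} {α : OneForm d M} {S : Set (B × ℂ)} {p : B}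
    (hp : (p, (0 : ℂ)) ∈ S) : IsRay (b := b) F α S p 0 (fun _ => p) := by
  refine ⟨rfl, fun s _ => by rwa [smul_zero], fun s _ => ⟨0, ?_, ?_⟩⟩
  · have h0 : (0 : ℝ →L[ℝ] EuclideanSpace ℝ (Fin b)) = ContinuousLinearMap.toSpanSingleton ℝ 0 := by
      ext; simp
    exact (hasMFDerivAt_const p s).congr_mfderiv h0
  · simp only [IsCharacteristic, formAt_eq_formAtL, dFormAt_eq_dFormAtL, Prod.mk_zero_zero, map_zero]
    exact ⟨trivial, fun _ _ => rfl⟩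

variable [IsManifold (𝓡 b) ∞ B] [IsManifold (𝓡 d) ∞ M]
  {F : B × ℂ → M} {α : OneForm d M} {S : Set (B × ℂ)}

/-- The map that sends `(p, z)` to the endpoint of the ray over `p` in the direction `z`. -/
lemma exists_radial_map [T2Space B] (hα : IsSmoothForm α) (hS : IsOpen S)
    (hF : ContMDiffOn ((𝓡 b).prod 𝓘(ℝ, ℂ)) (𝓡 d) ∞ F S)
    (hnd : ∀ x ∈ S, SliceNondegenerate (formAt (b := b) F α x) (dFormAt (b := b) F α x))
    (hS0 : ∀ p, (p, (0 : ℂ)) ∈ S) :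
    ∃ (W : Set (B × ℂ)) (h : B × ℂ → B), IsOpen W ∧ (∀ p, (p, 0) ∈ W) ∧
      ContMDiffOn ((𝓡 b).prod 𝓘(ℝ, ℂ)) (𝓡 b) ∞ h W ∧ (∀ p, h (p, 0) = p) ∧
      (∀ x ∈ W, (h x, x.2) ∈ S) ∧
      ∀ (p : B) (z : ℂ), (∀ τ ∈ Set.Icc (0 : ℝ) 1, (p, τ • z) ∈ W) →
        ∀ s ∈ Set.Icc (0 : ℝ) 1,
          IsCharacteristic (formAt F α (h (p, s • z), s • z)) (dFormAt F α (h (p, s • z), s • z))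
            (mfderiv ((𝓡 b).prod 𝓘(ℝ, ℂ)) (𝓡 b) h (p, s • z)
              ((0, z) : EuclideanSpace ℝ (Fin b) × ℂ)) z := by
  classical
  choose W h' hW hpW hh' hray using fun p => exists_ray_endpoints hα hS hF hnd (hS0 p)
  -- The ray is picked by choice, but uniqueness makes its endpoint independent of the choice. So
  -- `h` agrees with every local smooth endpoint map, and no gluing is needed.
  let h : B × ℂ → B := fun x =>
    if hx : ∃ γ, IsRay (b := b) F α S x.1 x.2 γ then hx.choose 1 else x.1
  have hh : ∀ p z γ, IsRay (b := b) F α S p z γ → h (p, z) = γ 1 := by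
    intro p z γ hγ
    have hx : ∃ γ, IsRay (b := b) F α S p z γ := ⟨γ, hγ⟩
    simp only [h, dif_pos hx]
    exact hx.choose_spec.eqOn hα hS hF hnd hγ ⟨zero_le_one, le_rfl⟩
  have hex : ∀ x ∈ ⋃ p, W p, ∃ γ, IsRay (b := b) F α S x.1 x.2 γ := by
    intro x hx
    obtain ⟨p, hp⟩ := Set.mem_iUnion.1 hx
    obtain ⟨γ, hγ, -⟩ := hray p x hp
    exact ⟨γ, hγ⟩
  have hhs : ContMDiffOn ((𝓡 b).prod 𝓘(ℝ, ℂ)) (𝓡 b) ∞ h (⋃ p, W p) := by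
    intro x hx
    obtain ⟨p, hp⟩ := Set.mem_iUnion.1 hx
    refine (ContMDiffAt.congr_of_eventuallyEq ((hh' p).contMDiffAt ((hW p).mem_nhds hp))
      ?_).contMDiffWithinAt
    filter_upwards [(hW p).mem_nhds hp] with y hy
    obtain ⟨γ, hγ, h1⟩ := hray p y hy
    rw [← h1, ← hh _ _ γ hγ]
  refine ⟨⋃ p, W p, h, isOpen_iUnion hW, fun p => Set.mem_iUnion.2 ⟨p, hpW p⟩, hhs,
    fun p => hh p 0 _ (isRay_const (hS0 p)), fun x hx => ?_, fun p z hpz s hs => ?_⟩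
  · obtain ⟨γ, hγ⟩ := hex x hx
    have h1 := hγ.mem 1 ⟨zero_le_one, le_rfl⟩
    rw [one_smul, ← hh _ _ γ hγ] at h1
    exact h1
  · obtain ⟨γ, hγ⟩ := hex (p, z) (by simpa using hpz 1 ⟨zero_le_one, le_rfl⟩)
    have hhγ : ∀ τ ∈ Set.Icc (0 : ℝ) 1, h (p, τ • z) = γ τ := fun τ hτ => by
      rw [hh _ _ _ (hγ.rescale hτ), one_mul]
    obtain ⟨v, hv, hc⟩ := hγ.deriv s hs
    have hD := ((hhs.contMDiffAt ((isOpen_iUnion hW).mem_nhds (hpz s hs))).mdifferentiableAt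
      (by simp)).hasMFDerivAt
    have hcurve : HasMFDerivAt 𝓘(ℝ, ℝ) ((𝓡 b).prod 𝓘(ℝ, ℂ)) (fun τ : ℝ => (p, τ • z)) s
        ((0 : ℝ →L[ℝ] EuclideanSpace ℝ (Fin b)).prod (ContinuousLinearMap.toSpanSingleton ℝ z)) := by
      refine (hasMFDerivAt_const p s).prodMk ?_
      have : HasFDerivAt (fun τ : ℝ => τ • z) (ContinuousLinearMap.toSpanSingleton ℝ z) s := by
        simpa using ((hasDerivAt_id s).smul_const z).hasFDerivAt
      exact this.hasMFDerivAt
    -- The identity h(p, τz) = γ τ is known only for τ in [0, 1], so the two derivatives are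
    -- compared within this interval, where they are still unique at the endpoints.
    have h1 := (hD.comp s hcurve).hasMFDerivWithinAt (s := Set.Icc (0 : ℝ) 1)
    have h2 := hv.hasMFDerivWithinAt (s := Set.Icc (0 : ℝ) 1) |>.congr_mono
      (f₁ := h ∘ fun τ : ℝ => (p, τ • z)) hhγ (hhγ s hs) subset_rfl
    have h3 := ((uniqueDiffOn_Icc (zero_lt_one (α := ℝ))).uniqueMDiffOn s hs).eq h1 h2
    have h4 : (mfderiv ((𝓡 b).prod 𝓘(ℝ, ℂ)) (𝓡 b) h (p, s • z)
        ((0, z) : EuclideanSpace ℝ (Fin b) × ℂ) : EuclideanSpace ℝ (Fin b)) = v := by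
      have h5 := DFunLike.congr_fun h3 (1 : ℝ)
      have h6 : (ContinuousLinearMap.toSpanSingleton ℝ v) (1 : ℝ) = v := by simp
      have h7 : ((0 : ℝ →L[ℝ] EuclideanSpace ℝ (Fin b)).prod
        (ContinuousLinearMap.toSpanSingleton ℝ z)) (1 : ℝ) = (0, z) := by simp
      rw [← h6, ← h7]
      exact h5
    rw [hhγ s hs]
    refine Eq.mpr ?_ hc
    exact congrArg (fun v => IsCharacteristic (formAt F α (γ s, s • z))
      (dFormAt F α (γ s, s • z)) v z) h4

end RadialMap

/-! ### Restriction of the form to the binding and to slices. -/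

section Slices

variable {b d : ℕ}
  {B : Type v} [TopologicalSpace B] [ChartedSpace (EuclideanSpace ℝ (Fin b)) B]
  [IsManifold (𝓡 b) ∞ B]
  {M : Type u} [TopologicalSpace M] [ChartedSpace (EuclideanSpace ℝ (Fin d)) M]
  [IsManifold (𝓡 d) ∞ M]

/-- The exterior derivative commutes with restriction. -/
lemma dForm_restrictForm {ι : B → M} {α : OneForm d M} (hα : IsSmoothForm α)
    (hι : ContMDiff (𝓡 b) (𝓡 d) ∞ ι) (p : B) (v w : EuclideanSpace ℝ (Fin b)) :
    dForm (restrictForm ι α) p v w =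
      dForm α (ι p) (mfderiv (𝓡 b) (𝓡 d) ι p v) (mfderiv (𝓡 b) (𝓡 d) ι p w) := by
  set χ := extChartAt (𝓡 b) p with hχ
  have hsm : ContMDiffOn 𝓘(ℝ, EuclideanSpace ℝ (Fin b)) (𝓡 d) ∞ (ι ∘ χ.symm) χ.target :=
    hι.comp_contMDiffOn (contMDiffOn_extChartAt_symm p)
  have hder : ∀ y ∈ χ.target, ∀ v : EuclideanSpace ℝ (Fin b),
      mfderiv 𝓘(ℝ, EuclideanSpace ℝ (Fin b)) (𝓡 d) (ι ∘ χ.symm) y v =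
        mfderiv (𝓡 b) (𝓡 d) ι (χ.symm y) (chartD p y v) := fun y hy v =>
    DFunLike.congr_fun (mfderiv_comp y (hι.mdifferentiableAt (by simp))
      (((contMDiffOn_extChartAt_symm (n := ∞) p).contMDiffAt
        ((isOpen_extChartAt_target p).mem_nhds hy)).mdifferentiableAt (by simp))) v
  have h1 : localForm (restrictForm ι α) p =ᶠ[nhds (χ p)] pullForm α (ι ∘ χ.symm) := by
    filter_upwards [(isOpen_extChartAt_target p).mem_nhds (mem_extChartAt_target p)] with y hy
    refine ContinuousLinearMap.ext fun v => ?_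
    exact (congrArg (α (ι (χ.symm y))) (hder y hy v)).symm
  have hid : ∀ v : EuclideanSpace ℝ (Fin b),
      mfderiv 𝓘(ℝ, EuclideanSpace ℝ (Fin b)) (𝓡 d) (ι ∘ χ.symm) (χ p) v =
        mfderiv (𝓡 b) (𝓡 d) ι p v := by
    intro v
    rw [hder _ (mem_extChartAt_target p), chartD_self, χ.left_inv (mem_extChartAt_source p)]
  have h2 := dForm_pullForm hα (isOpen_extChartAt_target p) hsm (mem_extChartAt_target p) v w
  rw [← hχ, hid, hid] at h2
  have h3 : dForm (restrictForm ι α) p v w =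
      extD (localForm (restrictForm ι α) p) (χ p) (chartDInv p p v) (chartDInv p p w) := rfl
  have h4 : ∀ v : EuclideanSpace ℝ (Fin b), chartDInv p p v = v := fun v => by
    have := chartDInv_chartD (mem_extChartAt_source (I := 𝓡 b) p) v
    rwa [chartD_self] at this
  rw [h3, h4, h4]
  have h5 : extD (localForm (restrictForm ι α) p) (χ p) v w =
      extD (pullForm α (ι ∘ χ.symm)) (χ p) v w := by
    unfold extD
    rw [h1.fderiv_eq]
  rw [h5, ← h2]
  have key : ∀ q, q = ι p → ∀ a c : EuclideanSpace ℝ (Fin d),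
      dForm α q a c = dForm α (ι p) a c := by
    rintro _ rfl a c; rfl
  exact key _ (congrArg ι (χ.left_inv (mem_extChartAt_source p))) _ _

variable {F : B × ℂ → M} {S : Set (B × ℂ)} {ι : B → M} {α : OneForm d M}

/-- The derivative of a map from `B × ℂ` to `B`, as a map of vector spaces. -/
def radialD (h : B × ℂ → B) (x : B × ℂ) :
    EuclideanSpace ℝ (Fin b) × ℂ →L[ℝ] EuclideanSpace ℝ (Fin b) :=
  mfderiv ((𝓡 b).prod 𝓘(ℝ, ℂ)) (𝓡 b) h x

lemma derivAt_comp_radial {h : B × ℂ → B} {x : B × ℂ}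
    (hF : MDifferentiableAt ((𝓡 b).prod 𝓘(ℝ, ℂ)) (𝓡 d) F (h x, x.2))
    (hh : MDifferentiableAt ((𝓡 b).prod 𝓘(ℝ, ℂ)) (𝓡 b) h x)
    (u : EuclideanSpace ℝ (Fin b) × ℂ) :
    derivAt (d := d) (fun x => F (h x, x.2)) x u =
      derivAt (d := d) F (h x, x.2) (radialD h x u, u.2) :=
  DFunLike.congr_fun
    (hF.hasMFDerivAt.comp x (hh.hasMFDerivAt.prodMk (hasMFDerivAt_snd x))).mfderiv u

lemma mfderiv_slice {N E' H' : Type*} [TopologicalSpace N] [NormedAddCommGroup E']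
    [NormedSpace ℝ E'] [TopologicalSpace H'] {J : ModelWithCorners ℝ E' H'} [ChartedSpace H' N]
    {F : B × ℂ → N} {z : ℂ} {p : B} {f : B → N}
    (hF : MDifferentiableAt ((𝓡 b).prod 𝓘(ℝ, ℂ)) J F (p, z)) (hf : ∀ p, F (p, z) = f p)
    (v : EuclideanSpace ℝ (Fin b)) :
    (mfderiv ((𝓡 b).prod 𝓘(ℝ, ℂ)) J F (p, z) ((v, 0) : EuclideanSpace ℝ (Fin b) × ℂ) : E') =
      mfderiv (𝓡 b) J f p v := by
  have h1 := (hF.hasMFDerivAt.comp p ((hasMFDerivAt_id p).prodMk (hasMFDerivAt_const z p))).mfderiv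
  have h2 : F ∘ (fun p : B => (p, z)) = f := funext hf
  have h3 := DFunLike.congr_fun h1 v
  rw [← h2]
  exact h3.symm

lemma contMDiff_of_slice
    (hF : ContMDiffOn ((𝓡 b).prod 𝓘(ℝ, ℂ)) (𝓡 d) ∞ F S) (hS0 : ∀ p, (p, (0 : ℂ)) ∈ S)
    (hι : ∀ p, F (p, 0) = ι p) : ContMDiff (𝓡 b) (𝓡 d) ∞ ι := by
  have h1 := hF.comp (contMDiff_id.prodMk (contMDiff_const (c := (0 : ℂ)))).contMDiffOn
    (t := S) (s := Set.univ) (f := fun p : B => (p, (0 : ℂ))) fun p _ => hS0 p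
  rw [contMDiffOn_univ] at h1
  convert h1 using 1
  exact funext fun p => (hι p).symm

lemma derivAt_zero (hS : IsOpen S)
    (hF : ContMDiffOn ((𝓡 b).prod 𝓘(ℝ, ℂ)) (𝓡 d) ∞ F S) (hS0 : ∀ p, (p, (0 : ℂ)) ∈ S)
    (hι : ∀ p, F (p, 0) = ι p) (p : B) (v : EuclideanSpace ℝ (Fin b)) :
    derivAt F (p, 0) (v, 0) = mfderiv (𝓡 b) (𝓡 d) ι p v :=
  mfderiv_slice ((hF.contMDiffAt (hS.mem_nhds (hS0 p))).mdifferentiableAt (by simp)) hι v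

lemma formAt_zero (hS : IsOpen S)
    (hF : ContMDiffOn ((𝓡 b).prod 𝓘(ℝ, ℂ)) (𝓡 d) ∞ F S) (hS0 : ∀ p, (p, (0 : ℂ)) ∈ S)
    (hι : ∀ p, F (p, 0) = ι p) (p : B) (v : EuclideanSpace ℝ (Fin b)) :
    formAt F α (p, 0) (v, 0) = restrictForm ι α p v := by
  have h1 : formAt F α (p, 0) (v, 0) = α (F (p, 0)) (derivAt F (p, 0) (v, 0)) := rfl
  rw [h1, derivAt_zero hS hF hS0 hι, hι]
  rfl

lemma dFormAt_zero (hα : IsSmoothForm α) (hS : IsOpen S)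
    (hF : ContMDiffOn ((𝓡 b).prod 𝓘(ℝ, ℂ)) (𝓡 d) ∞ F S) (hS0 : ∀ p, (p, (0 : ℂ)) ∈ S)
    (hι : ∀ p, F (p, 0) = ι p) (p : B) (v w : EuclideanSpace ℝ (Fin b)) :
    dFormAt F α (p, 0) (v, 0) (w, 0) = dForm (restrictForm ι α) p v w := by
  have h1 : dFormAt F α (p, 0) (v, 0) (w, 0) =
    dForm α (F (p, 0)) (derivAt F (p, 0) (v, 0)) (derivAt F (p, 0) (w, 0)) := rfl
  rw [h1, derivAt_zero hS hF hS0 hι, derivAt_zero hS hF hS0 hι, hι]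
  exact (dForm_restrictForm hα (contMDiff_of_slice hF hS0 hι) p v w).symm

/-- Nondegeneracy on the slices is an open condition. -/
lemma exists_isOpen_sliceNondegenerate (hα : IsSmoothForm α) (hS : IsOpen S)
    (hF : ContMDiffOn ((𝓡 b).prod 𝓘(ℝ, ℂ)) (𝓡 d) ∞ F S) {x₀ : B × ℂ} (hx₀ : x₀ ∈ S)
    (hnd : SliceNondegenerate (formAt (b := b) F α x₀) (dFormAt (b := b) F α x₀)) :
    ∃ S' ⊆ S, IsOpen S' ∧ x₀ ∈ S' ∧
      ∀ x ∈ S', SliceNondegenerate (formAt (b := b) F α x) (dFormAt (b := b) F α x) := by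
  set χ := extChartAt (𝓡 b) x₀.1 with hχ
  obtain ⟨U', V, hU', hxU', hU'S, -, hVc⟩ := exists_characteristic_field
    (isOpen_chartDomain hS x₀.1) (contDiffOn_chartForm hα hS hF x₀.1)
    (mem_chartDomain (mem_extChartAt_source x₀.1) hx₀)
    ((sliceNondegenerate_chartForm hα hS hF (mem_extChartAt_source x₀.1) hx₀).2 hnd)
  have hcont : ContinuousOn (fun x : B × ℂ => (χ x.1, x.2)) ((χ.source ×ˢ Set.univ) ∩ S) :=
    (((continuousOn_extChartAt x₀.1).comp continuousOn_fst fun x hx => hx.1).prodMk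
      continuousOn_snd).mono Set.inter_subset_left
  refine ⟨(χ.source ×ˢ Set.univ) ∩ S ∩ (fun x : B × ℂ => (χ x.1, x.2)) ⁻¹' U', fun x hx => hx.1.2,
    hcont.isOpen_inter_preimage (((isOpen_extChartAt_source x₀.1).prod isOpen_univ).inter hS) hU',
    ⟨⟨⟨mem_extChartAt_source x₀.1, trivial⟩, hx₀⟩, hxU'⟩, fun x hx => ?_⟩
  exact (sliceNondegenerate_chartForm hα hS hF hx.1.1.1 hx.1.2).1 (hVc _ hx.2).1

end Slices

/-! ### Trivializations with characteristic radii. -/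

section RadialTrivialization

variable {b d : ℕ}
  {B : Type v} [TopologicalSpace B] [ChartedSpace (EuclideanSpace ℝ (Fin b)) B]
  [IsManifold (𝓡 b) ∞ B]
  {M : Type u} [TopologicalSpace M] [ChartedSpace (EuclideanSpace ℝ (Fin d)) M]
  [IsManifold (𝓡 d) ∞ M]
  {ι : B → M} {π : M → Circle} {α : OneForm d M} {δ : ℝ}
  {φ : PartialDiffeomorph ((𝓡 b).prod 𝓘(ℝ, ℂ)) (𝓡 d) (B × ℂ) M ∞}

lemma derivAt_bijective {x : B × ℂ} (hx : x ∈ φ.source) :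
    Function.Bijective (derivAt (b := b) (d := d) φ x) :=
  ((φ.isLocalDiffeomorphAt _ _ _ hx).mfderivToContinuousLinearEquiv (by simp)).bijective

namespace IsBindingTrivialization

lemma mem_source (h : IsBindingTrivialization ι π δ φ) {x : B × ℂ} :
    x ∈ φ.source ↔ ‖x.2‖ < δ := by
  rw [h.source_eq]; simp

lemma zero_mem (h : IsBindingTrivialization ι π δ φ) (p : B) : (p, (0 : ℂ)) ∈ φ.source := by
  rw [h.mem_source]; simpa using h.pos

lemma injective (h : IsBindingTrivialization ι π δ φ) : Function.Injective ι := by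
  intro p p' hp
  rw [← h.zero_section, ← h.zero_section] at hp
  exact congrArg Prod.fst (φ.toPartialEquiv.injOn (h.zero_mem p) (h.zero_mem p') hp)

/-- A tubular neighbourhood of the binding can be reparametrized so that its radii are
characteristic. -/
lemma exists_radial [CompactSpace B] [T2Space B] [T2Space M] (hα : IsSmoothForm α)
    (h : IsBindingTrivialization ι π δ φ)
    (hnd : ∀ p : B, SliceNondegenerate (formAt (b := b) φ α (p, 0)) (dFormAt (b := b) φ α (p, 0))) :
    ∃ (δ' : ℝ) (ψ : PartialDiffeomorph ((𝓡 b).prod 𝓘(ℝ, ℂ)) (𝓡 d) (B × ℂ) M ∞),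
      IsBindingTrivialization ι π δ' ψ ∧
      ∀ (p : B) (z : ℂ), ‖z‖ < δ' → ∀ s ∈ Set.Icc (0 : ℝ) 1,
        IsCharacteristic (formAt ψ α (p, s • z)) (dFormAt ψ α (p, s • z))
          (0 : EuclideanSpace ℝ (Fin b)) z := by
  choose S' hS'S hS'o hpS' hS'nd using fun p => exists_isOpen_sliceNondegenerate hα
    φ.open_source φ.contMDiffOn_toFun (h.zero_mem p) (hnd p)
  set S : Set (B × ℂ) := ⋃ p, S' p with hSdef
  have hS : IsOpen S := isOpen_iUnion hS'o
  have hSφ : S ⊆ φ.source := Set.iUnion_subset hS'S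
  have hS0 : ∀ p, (p, (0 : ℂ)) ∈ S := fun p => Set.mem_iUnion.2 ⟨p, hpS' p⟩
  have hSnd : ∀ x ∈ S, SliceNondegenerate (formAt (b := b) φ α x) (dFormAt (b := b) φ α x) := by
    intro x hx
    obtain ⟨p, hp⟩ := Set.mem_iUnion.1 hx
    exact hS'nd p x hp
  have hφS : ContMDiffOn ((𝓡 b).prod 𝓘(ℝ, ℂ)) (𝓡 d) ∞ φ S := φ.contMDiffOn_toFun.mono hSφ
  obtain ⟨W, r, hW, hpW, hr, hr0, hrS, hrc⟩ := exists_radial_map hα hS hφS hSnd hS0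
  -- Only the B-coordinate is moved, to the endpoint of the lifted radius. The disk coordinate is
  -- unchanged, so the angle condition survives.
  let F : B × ℂ → M := fun x => φ (r x, x.2)
  have hφd : ∀ x ∈ W, MDifferentiableAt ((𝓡 b).prod 𝓘(ℝ, ℂ)) (𝓡 d) φ (r x, x.2) := fun x hx =>
    (hφS.contMDiffAt (hS.mem_nhds (hrS x hx))).mdifferentiableAt (by simp)
  have hrd : ∀ x ∈ W, MDifferentiableAt ((𝓡 b).prod 𝓘(ℝ, ℂ)) (𝓡 b) r x := fun x hx =>
    (hr.contMDiffAt (hW.mem_nhds hx)).mdifferentiableAt (by simp)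
  have hF : ContMDiffOn ((𝓡 b).prod 𝓘(ℝ, ℂ)) (𝓡 d) ∞ F W :=
    hφS.comp (hr.prodMk contMDiffOn_snd) hrS
  have hF0 : ∀ p, F (p, 0) = ι p := fun p => by
    simp only [F, hr0, h.zero_section]
  have hbij : ∀ p, Function.Bijective (derivAt (b := b) (d := d) F (p, 0)) := by
    intro p
    -- Since `r` is the identity on the zero section, its derivative there is (u, ζ) ↦ u + dr(0, ζ).
    -- So the derivative of `F` is that of `φ` composed with a shear.
    let A : EuclideanSpace ℝ (Fin b) × ℂ → EuclideanSpace ℝ (Fin b) × ℂ := fun u =>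
      (u.1 + radialD r (p, 0) (0, u.2), u.2)
    have hA : Function.Bijective A := by
      refine Function.bijective_iff_has_inverse.2
        ⟨fun u => (u.1 - radialD r (p, 0) (0, u.2), u.2), fun u => ?_, fun u => ?_⟩ <;> simp [A]
    have hFA : ⇑(derivAt (b := b) (d := d) F (p, 0)) = derivAt (b := b) (d := d) φ (p, 0) ∘ A := by
      funext u
      have h1 := derivAt_comp_radial (hφd _ (hpW p)) (hrd _ (hpW p)) u
      have h2 : radialD r (p, 0) u = u.1 + radialD r (p, 0) (0, u.2) := by
        have h3 : radialD r (p, 0) (u.1, 0) = u.1 := by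
          have h4 := mfderiv_slice (f := id) (hrd _ (hpW p)) hr0 u.1
          rw [mfderiv_id] at h4
          exact h4
        have h5 : radialD r (p, 0) u = radialD r (p, 0) (u.1, 0) + radialD r (p, 0) (0, u.2) := by
          rw [← map_add]; simp
        rwa [h3] at h5
      refine h1.trans ?_
      simp only [hr0]
      exact congrArg (fun v => derivAt (b := b) (d := d) φ (p, 0) (v, u.2)) h2
    rw [hFA]
    exact (derivAt_bijective (h.zero_mem p)).comp hA
  obtain ⟨δ', hδ', ψ, hψs, hψW, hψF⟩ := exists_partialDiffeomorph_ball
    (fun p => isLocalDiffeomorphAt_of_mfderiv hW hF (hpW p) (hbij p))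
    (fun p p' hp => h.injective (by rwa [hF0, hF0] at hp)) φ.toPartialEquiv.symm hW hpW
  have hψ : ⇑ψ = F := funext hψF
  refine ⟨δ', ψ, ⟨hδ', hψs, fun p => by rw [hψF, hF0], fun p s u hs hsδ => ?_⟩, ?_⟩
  · rw [hψF]
    have hn : ‖s • (u : ℂ)‖ = s := by rw [norm_smul, Circle.norm_coe, mul_one, Real.norm_of_nonneg hs.le]
    have hx : (p, s • (u : ℂ)) ∈ W := hψW (by
      rw [hψs]
      refine ⟨trivial, ?_⟩
      rwa [mem_ball_zero_iff, hn])
    refine h.angle _ s u hs ?_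
    have := h.mem_source.1 (hSφ (hrS _ hx))
    rwa [hn] at this
  · intro p z hz s hs
    have hmem : ∀ τ ∈ Set.Icc (0 : ℝ) 1, (p, τ • z) ∈ W := fun τ hτ => hψW (by
      rw [hψs]
      refine ⟨trivial, ?_⟩
      rw [mem_ball_zero_iff, norm_smul, Real.norm_of_nonneg hτ.1]
      exact (mul_le_of_le_one_left (norm_nonneg _) hτ.2).trans_lt hz)
    have hx := hmem s hs
    have h1 := hrc p z hmem s hs
    -- The map (p, z) ↦ (r(p, z), z) preserves the slices z = const. Its derivative sends slice
    -- vectors to slice vectors and the radial vector (0, z) to the characteristic vector (dr(0, z),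
    -- z).
    have h2 : ∀ u, derivAt (b := b) (d := d) F (p, s • z) u =
        derivAt φ (r (p, s • z), s • z) (radialD r (p, s • z) u, u.2) :=
      derivAt_comp_radial (hφd _ hx) (hrd _ hx)
    have h3 : ∀ u, formAt (b := b) F α (p, s • z) u =
        formAt φ α (r (p, s • z), s • z) (radialD r (p, s • z) u, u.2) := fun u =>
      congrArg (α (F (p, s • z))) (h2 u)
    have h4 : ∀ u w, dFormAt (b := b) F α (p, s • z) u w =
        dFormAt φ α (r (p, s • z), s • z) (radialD r (p, s • z) u, u.2)
          (radialD r (p, s • z) w, w.2) := fun u w =>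
      congrArg₂ (dForm α (F (p, s • z))) (h2 u) (h2 w)
    rw [hψ]
    refine ⟨?_, fun u hu => ?_⟩
    · rw [h3]; exact h1.1
    · rw [h4]
      rw [h3] at hu
      exact h1.2 _ hu

end IsBindingTrivialization

end RadialTrivialization

/-! ### The local normal form G β₀ + K r² dθ. -/

section NormalForm

/-- The form `r² dθ = x dy - y dx` on the plane, at `z`. -/
def rotForm (z ζ : ℂ) : ℝ := z.re * ζ.im - z.im * ζ.re

variable {X Y : Type*} [NormedAddCommGroup X] [NormedSpace ℝ X] [NormedAddCommGroup Y]
  [NormedSpace ℝ Y]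

lemma hasDerivAt_comp_line {f : X → Y} {x u : X} {s : ℝ} (hf : DifferentiableAt ℝ f (x + s • u)) :
    HasDerivAt (fun t : ℝ => f (x + t • u)) (fderiv ℝ f (x + s • u) u) s := by
  have h1 : HasDerivAt (fun t : ℝ => x + t • u) u s := by
    simpa using ((hasDerivAt_id s).smul_const u).const_add x
  exact hf.hasFDerivAt.comp_hasDerivAt s h1

lemma hasDerivAt_clm_comp_line {β : X → X →L[ℝ] ℝ} {x u : X} {s : ℝ}
    (hβ : DifferentiableAt ℝ β (x + s • u)) (w w' : X) :
    HasDerivAt (fun t : ℝ => β (x + t • u) (w + t • w'))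
      (fderiv ℝ β (x + s • u) u (w + s • w') + β (x + s • u) w') s := by
  have h1 : HasDerivAt (fun t : ℝ => w + t • w') w' s := by
    simpa using ((hasDerivAt_id s).smul_const w').const_add w
  exact (hasDerivAt_comp_line hβ).clm_apply h1

/-- A function that solves a linear equation along an interval and vanishes at its beginning
vanishes at its end. -/
lemma eq_zero_of_hasDerivAt_mul {D c : ℝ → ℝ} (hc : ContinuousOn c (Set.Icc 0 1))
    (hD : ∀ s ∈ Set.Icc (0 : ℝ) 1, HasDerivAt D (c s * D s) s) (h0 : D 0 = 0) : D 1 = 0 := by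
  obtain ⟨K, hK⟩ := isCompact_Icc.exists_bound_of_continuousOn hc
  refine eq_zero_of_abs_deriv_le_mul_abs_self_of_eq_zero_right (K := K)
    (fun s hs => (hD s hs).continuousAt.continuousWithinAt)
    (fun s hs => (hD s (Set.Ico_subset_Icc_self hs)).hasDerivWithinAt) h0 (fun s hs => ?_) 1
    ⟨zero_le_one, le_rfl⟩
  rw [norm_mul]
  exact mul_le_mul_of_nonneg_right (hK s (Set.Ico_subset_Icc_self hs)) (norm_nonneg _)

variable {E : Type} [NormedAddCommGroup E] [NormedSpace ℝ E]
  [FiniteDimensional ℝ E] {β : E × ℂ → E × ℂ →L[ℝ] ℝ} {N : Set E} {r : ℝ}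

/-- The exterior derivative on the plane factors through the determinant. -/
lemma extD_plane (x : E × ℂ) (z ζ : ℂ) :
    extD β x (0, z) (0, ζ) = rotForm z ζ * extD β x (0, 1) (0, Complex.I) := by
  have h : ∀ z : ℂ, ((0, z) : E × ℂ) = z.re • (0, 1) + z.im • (0, Complex.I) := fun z => by
    ext
    · simp
    · simp [Complex.re_add_im]
  have h1 := extD_swap β x (0, Complex.I) (0, 1)
  rw [h z, h ζ]
  rw [extD_add_left, extD_smul_left, extD_smul_left, extD_swap _ _ (0, 1),
    extD_swap _ _ (0, Complex.I), extD_add_left, extD_add_left, extD_smul_left, extD_smul_left,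
    extD_smul_left, extD_smul_left, extD_self, extD_self, h1]
  unfold rotForm
  ring

/-- The radial directions are characteristic. -/
def IsRadial (β : E × ℂ → E × ℂ →L[ℝ] ℝ) (N : Set E) (r : ℝ) : Prop :=
  ∀ y ∈ N, ∀ z : ℂ, ‖z‖ < r → ∀ s ∈ Set.Icc (0 : ℝ) 1,
    IsCharacteristic (fun u => β (y, s • z) u) (extD β (y, s • z)) 0 z

lemma norm_smul_lt {z : ℂ} (hz : ‖z‖ < r) {s : ℝ} (hs : s ∈ Set.Icc (0 : ℝ) 1) :
    ‖s • z‖ < r := by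
  rw [norm_smul, Real.norm_of_nonneg hs.1]
  exact (mul_le_of_le_one_left (norm_nonneg _) hs.2).trans_lt hz

lemma differentiableAt_of_mem (hN : IsOpen N) (hβ : ContDiffOn ℝ ∞ β (N ×ˢ Metric.ball 0 r))
    {y : E} (hy : y ∈ N) {z : ℂ} (hz : ‖z‖ < r) :
    DifferentiableAt ℝ β (y, z) :=
  (hβ.contDiffAt ((hN.prod Metric.isOpen_ball).mem_nhds ⟨hy, by simpa using hz⟩)).differentiableAt
    (by simp)

/-- Along a radius the restriction of the form to the slices only changes by a factor. -/
lemma IsRadial.slice (hrad : IsRadial β N r) (hN : IsOpen N)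
    (hβ : ContDiffOn ℝ ∞ β (N ×ˢ Metric.ball 0 r)) {y : E} (hy : y ∈ N) {z : ℂ} (hz : ‖z‖ < r) {e : E}
    (he : ∀ s ∈ Set.Icc (0 : ℝ) 1, β (y, s • z) (e, 0) ≠ 0) (v : E) :
    β (y, z) (v, 0) * β (y, 0) (e, 0) = β (y, 0) (v, 0) * β (y, z) (e, 0) := by
  have hline : ∀ s : ℝ, ((y, 0) : E × ℂ) + s • (0, z) = (y, s • z) := fun s => by simp
  have hdiff : ∀ s ∈ Set.Icc (0 : ℝ) 1, DifferentiableAt ℝ β (y, s • z) := fun s hs =>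
    differentiableAt_of_mem hN hβ hy (norm_smul_lt hz hs)
  -- The other half of the exterior derivative is zero: β(0, z) vanishes at (y, sz) for all y in
  -- `N`, so its derivative in a slice direction vanishes.
  have hA : ∀ v : E, ∀ s ∈ Set.Icc (0 : ℝ) 1,
      HasDerivAt (fun t : ℝ => β (y, t • z) (v, 0)) (extD β (y, s • z) (0, z) (v, 0)) s := by
    intro v s hs
    have h1 := hasDerivAt_clm_comp_line (β := β) (x := (y, 0)) (u := (0, z)) (s := s)
      (by rw [hline]; exact hdiff s hs) (v, 0) 0
    simp only [hline, smul_zero, add_zero, map_zero] at h1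
    have h2 : fderiv ℝ β (y, s • z) (v, 0) (0, z) = 0 := by
      have h3 := hasDerivAt_clm_comp_line (β := β) (x := (y, s • z)) (u := (v, 0)) (s := 0)
        (by rw [zero_smul, add_zero]; exact hdiff s hs) (0, z) 0
      simp only [zero_smul, smul_zero, add_zero, map_zero] at h3
      refine h3.unique ((hasDerivAt_const (0 : ℝ) (0 : ℝ)).congr_of_eventuallyEq ?_)
      have hc : ContinuousAt (fun t : ℝ => y + t • v) 0 := by fun_prop
      filter_upwards [hc.preimage_mem_nhds (by simpa using hN.mem_nhds hy)] with t ht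
      simpa using (hrad _ ht z hz s hs).1
    unfold extD
    rw [h2, sub_zero]
    exact h1
  have hev : ∀ s ∈ Set.Icc (0 : ℝ) 1, extD β (y, s • z) (0, z) (v, 0) * β (y, s • z) (e, 0) =
      β (y, s • z) (v, 0) * extD β (y, s • z) (0, z) (e, 0) := by
    intro s hs
    obtain ⟨μ, hμ⟩ := exists_eq_smul_of_ker_le
      (a := (β (y, s • z)).comp (ContinuousLinearMap.inl ℝ E ℂ))
      (l := (extDL β (y, s • z) (0, z)).comp (ContinuousLinearMap.inl ℝ E ℂ))
      (fun u hu => (hrad y hy z hz s hs).2 u hu)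
    have h1 : ∀ v, extD β (y, s • z) (0, z) (v, 0) = μ * β (y, s • z) (v, 0) :=
      fun v => DFunLike.congr_fun hμ v
    rw [h1, h1]
    ring
  have hcont : ∀ v : E, ContinuousOn (fun s : ℝ => β (y, s • z) (v, 0)) (Set.Icc 0 1) :=
    fun v s hs => (hA v s hs).continuousAt.continuousWithinAt
  have hcont' : ContinuousOn (fun s : ℝ => extD β (y, s • z) (0, z) (e, 0)) (Set.Icc 0 1) := by
    have h1 := (contDiffOn_extDL (hN.prod Metric.isOpen_ball) hβ).continuousOn
    have h2 : ContinuousOn (fun s : ℝ => extDL β (y, s • z)) (Set.Icc 0 1) :=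
      h1.comp (by fun_prop) fun s hs => ⟨hy, by simpa using norm_smul_lt hz hs⟩
    exact (h2.clm_apply continuousOn_const).clm_apply continuousOn_const
  -- Along the radius dβ(z, ·) = μ β on the slice, so all values β(v, 0) grow at the same rate μ.
  -- The cross difference `D` then solves D' = μ D, where μ is read off from the vector `e` as `c`.
  have key := eq_zero_of_hasDerivAt_mul
    (D := fun s => β (y, s • z) (v, 0) * β (y, 0) (e, 0) - β (y, 0) (v, 0) * β (y, s • z) (e, 0))
    (c := fun s => extD β (y, s • z) (0, z) (e, 0) / β (y, s • z) (e, 0))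
    (hcont'.div (hcont e) he)
    (fun s hs => by
      refine (((hA v s hs).mul_const (β (y, 0) (e, 0))).sub
        ((hA e s hs).const_mul (β (y, 0) (v, 0)))).congr_deriv ?_
      have := hev s hs
      have h0 := he s hs
      field_simp
      linear_combination (β (y, 0) (e, 0)) * this)
    (by simp)
  simp only [one_smul] at key
  linarith

/-- On a fibre the form is determined by its exterior derivative. -/
lemma IsRadial.fibre (hrad : IsRadial β N r) (hN : IsOpen N)
    (hβ : ContDiffOn ℝ ∞ β (N ×ˢ Metric.ball 0 r)) {y : E} (hy : y ∈ N) {z : ℂ} (hz : ‖z‖ < r) (ζ : ℂ) :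
    β (y, z) (0, ζ) =
      (∫ s in (0 : ℝ)..1, s * extD β (y, s • z) (0, 1) (0, Complex.I)) * rotForm z ζ := by
  have hdiff : ∀ s ∈ Set.Icc (0 : ℝ) 1, DifferentiableAt ℝ β (y, s • z) := fun s hs =>
    differentiableAt_of_mem hN hβ hy (norm_smul_lt hz hs)
  have hcont' : ContinuousOn (fun s : ℝ => extD β (y, s • z) (0, 1) (0, Complex.I))
      (Set.Icc 0 1) := by
    have h1 := (contDiffOn_extDL (hN.prod Metric.isOpen_ball) hβ).continuousOn
    have h2 : ContinuousOn (fun s : ℝ => extDL β (y, s • z)) (Set.Icc 0 1) :=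
      h1.comp (by fun_prop) fun s hs => ⟨hy, by simpa using norm_smul_lt hz hs⟩
    exact (h2.clm_apply continuousOn_const).clm_apply continuousOn_const
  have hd : ∀ s ∈ Set.uIcc (0 : ℝ) 1, HasDerivAt (fun t : ℝ => t * β (y, t • z) (0, ζ))
      (rotForm z ζ * (s * extD β (y, s • z) (0, 1) (0, Complex.I))) s := by
    intro s hs
    rw [Set.uIcc_of_le zero_le_one] at hs
    have hline : ∀ s : ℝ, ((y, 0) : E × ℂ) + s • (0, z) = (y, s • z) := fun s => by simp
    have h1 := hasDerivAt_clm_comp_line (β := β) (x := (y, 0)) (u := (0, z)) (s := s)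
      (by rw [hline]; exact hdiff s hs) (0, ζ) 0
    simp only [hline, smul_zero, add_zero, map_zero] at h1
    have h2 := (hasDerivAt_id s).mul h1
    -- The identity β(y, w)(0, w) = 0 on the disk is differentiated at w = sz in the direction ζ. It
    -- turns the derivative of s β(y, sz)(0, ζ) into s dβ(z, ζ), which is then integrated from 0 to
    -- 1.
    have h3 : fderiv ℝ β (y, s • z) (0, ζ) (0, s • z) + β (y, s • z) (0, ζ) = 0 := by
      have h4 := hasDerivAt_clm_comp_line (β := β) (x := (y, s • z)) (u := (0, ζ)) (s := 0)
        (by rw [zero_smul, add_zero]; exact hdiff s hs) (0, s • z) (0, ζ)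
      simp only [zero_smul, add_zero] at h4
      refine h4.unique ((hasDerivAt_const (0 : ℝ) (0 : ℝ)).congr_of_eventuallyEq ?_)
      have hc : ContinuousAt (fun t : ℝ => s • z + t • ζ) 0 := by fun_prop
      filter_upwards [hc.preimage_mem_nhds (Metric.isOpen_ball.mem_nhds (x := s • z + (0 : ℝ) • ζ)
        (s := Metric.ball 0 r) (by simpa using norm_smul_lt hz hs))] with t ht
      have h5 := (hrad y hy _ (by simpa using ht) 1 ⟨zero_le_one, le_rfl⟩).1
      simpa using h5
    have h6 : ((0, s • z) : E × ℂ) = s • (0, z) := by simp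
    rw [h6, map_smul, smul_eq_mul] at h3
    have h7 := extD_plane (β := β) (y, s • z) z ζ
    unfold extD at h7
    refine h2.congr_deriv ?_
    simp only [id]
    unfold extD
    linear_combination s * h7 + h3
  have hint := intervalIntegral.integral_eq_sub_of_hasDerivAt hd
    (ContinuousOn.intervalIntegrable (by
      rw [Set.uIcc_of_le zero_le_one]
      exact continuousOn_const.mul (continuousOn_id.mul hcont')))
  rw [intervalIntegral.integral_const_mul] at hint
  simp only [one_smul, one_mul, zero_mul, sub_zero] at hint
  rw [← hint, mul_comm]

/-- A form whose radii are characteristic is, near the zero section, `G β₀ + K r² dθ`. -/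
lemma IsRadial.exists_normal_form (hrad : IsRadial β N r) (hN : IsOpen N)
    (hβ : ContDiffOn ℝ ∞ β (N ×ˢ Metric.ball 0 r)) {y₀ : E} (hy₀ : y₀ ∈ N) (hr : 0 < r) {e : E}
    (he : β (y₀, 0) (e, 0) ≠ 0) :
    ∃ (O : Set (E × ℂ)) (G K : E × ℂ → ℝ), IsOpen O ∧ (y₀, 0) ∈ O ∧ O ⊆ N ×ˢ Metric.ball 0 r ∧
      ContDiffOn ℝ ∞ G O ∧ ContDiffOn ℝ ∞ K O ∧
      (∀ x ∈ O, 0 < G x ∧ ∀ v ζ, β x (v, ζ) = G x * β (x.1, 0) (v, 0) + K x * rotForm x.2 ζ) ∧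
      ∀ y, (y, (0 : ℂ)) ∈ O → K (y, 0) = extD β (y, 0) (0, 1) (0, Complex.I) / 2 := by
  have hopen : IsOpen (N ×ˢ Metric.ball (0 : ℂ) r) := hN.prod Metric.isOpen_ball
  have hmem : (y₀, (0 : ℂ)) ∈ N ×ˢ Metric.ball (0 : ℂ) r := ⟨hy₀, Metric.mem_ball_self hr⟩
  have hκ : ContDiffOn ℝ ∞ (fun x => extD β x (0, 1) (0, Complex.I)) (N ×ˢ Metric.ball 0 r) :=
    ((contDiffOn_extDL hopen hβ).clm_apply contDiffOn_const).clm_apply contDiffOn_const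
  -- A global extension is needed to integrate with smooth dependence on the parameters.
  obtain ⟨κ, hκs, hκe⟩ := exists_contDiff_eventuallyEq hopen hκ hmem
  have hβe : ContDiffOn ℝ ∞ (fun x => β x (e, 0)) (N ×ˢ Metric.ball 0 r) :=
    hβ.clm_apply contDiffOn_const
  -- Multiplying by the value at the base point treats both signs at once and makes the quotient `G`
  -- positive.
  have hpos : ∀ᶠ x in nhds (y₀, (0 : ℂ)), 0 < β x (e, 0) * β (y₀, 0) (e, 0) := by
    have hc : ContinuousAt (fun x => β x (e, 0) * β (y₀, 0) (e, 0)) (y₀, 0) :=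
      (hβe.continuousOn.continuousAt (hopen.mem_nhds hmem)).mul continuousAt_const
    exact hc.eventually (lt_mem_nhds (mul_self_pos.2 he))
  have hev : ∀ᶠ x in nhds (y₀, (0 : ℂ)), x ∈ N ×ˢ Metric.ball (0 : ℂ) r ∧
      κ x = extD β x (0, 1) (0, Complex.I) ∧ 0 < β x (e, 0) * β (y₀, 0) (e, 0) :=
    (show ∀ᶠ x in nhds (y₀, (0 : ℂ)), x ∈ N ×ˢ Metric.ball (0 : ℂ) r from
      hopen.mem_nhds hmem).and (hκe.and hpos)
  rw [nhds_prod_eq, Filter.eventually_prod_iff] at hev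
  obtain ⟨pa, hpa, pb, hpb, hab⟩ := hev
  obtain ⟨A, hA, hAo, hyA⟩ := eventually_nhds_iff.1 hpa
  obtain ⟨ε, hε, hεb⟩ := Metric.eventually_nhds_iff_ball.1 hpb
  -- The neighbourhood is a product with a disk, so it contains the whole radius to each of its
  -- points.
  have hO : ∀ x ∈ A ×ˢ Metric.ball (0 : ℂ) ε, ∀ s ∈ Set.Icc (0 : ℝ) 1,
      (x.1, s • x.2) ∈ N ×ˢ Metric.ball (0 : ℂ) r ∧
      κ (x.1, s • x.2) = extD β (x.1, s • x.2) (0, 1) (0, Complex.I) ∧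
      0 < β (x.1, s • x.2) (e, 0) * β (y₀, 0) (e, 0) := fun x hx s hs =>
    hab (hA _ hx.1) (hεb _ (by simpa using norm_smul_lt (by simpa using hx.2) hs))
  have hO1 : ∀ x ∈ A ×ˢ Metric.ball (0 : ℂ) ε, x ∈ N ×ˢ Metric.ball (0 : ℂ) r ∧
      0 < β x (e, 0) * β (y₀, 0) (e, 0) := fun x hx => by
    have := hO x hx 1 ⟨zero_le_one, le_rfl⟩
    rw [one_smul] at this
    exact ⟨this.1, this.2.2⟩
  have hO0 : ∀ x ∈ A ×ˢ Metric.ball (0 : ℂ) ε, 0 < β (x.1, 0) (e, 0) * β (y₀, 0) (e, 0) :=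
    fun x hx => by
      have := hO x hx 0 ⟨le_rfl, zero_le_one⟩
      rw [zero_smul] at this
      exact this.2.2
  have hne : ∀ c : ℝ, 0 < c * β (y₀, 0) (e, 0) → c ≠ 0 := by
    rintro c hc rfl
    simp at hc
  refine ⟨A ×ˢ Metric.ball 0 ε, fun x => β x (e, 0) / β (x.1, 0) (e, 0),
    fun x => ∫ s in (0 : ℝ)..1, s * κ (x.1, s • x.2), hAo.prod Metric.isOpen_ball,
    ⟨hyA, Metric.mem_ball_self hε⟩, fun x hx => (hO1 x hx).1, ?_, ?_, fun x hx => ⟨?_, ?_⟩, ?_⟩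
  · refine (hβe.mono fun x hx => (hO1 x hx).1).div ?_ fun x hx => hne _ (hO0 x hx)
    exact hβe.comp (contDiff_fst.prodMk contDiff_const).contDiffOn
      fun x hx => ⟨(hO1 x hx).1.1, Metric.mem_ball_self hr⟩
  · refine ContDiff.contDiffOn (contDiff_integral_parameter
      (F := fun q : ℝ × E × ℂ => q.1 * κ (q.2.1, q.1 • q.2.2)) ?_)
    exact contDiff_fst.mul (hκs.comp ((contDiff_fst.comp contDiff_snd).prodMk
      (contDiff_fst.smul (contDiff_snd.comp contDiff_snd))))
  · have h1 := (hO1 x hx).2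
    have h2 := hO0 x hx
    have h3 : β x (e, 0) / β (x.1, 0) (e, 0) = (β x (e, 0) * β (y₀, 0) (e, 0)) /
        (β (x.1, 0) (e, 0) * β (y₀, 0) (e, 0)) := by
      rw [mul_div_mul_right _ _ he]
    simp only [h3]
    positivity
  · intro v ζ
    have hxN := (hO1 x hx).1
    have hxr : ‖x.2‖ < r := by simpa using hxN.2
    have h1 := hrad.slice hN hβ hxN.1 hxr (e := e) (fun s hs => hne _ (hO x hx s hs).2.2) v
    have h2 := hrad.fibre hN hβ hxN.1 hxr ζ
    have h3 : ∫ s in (0 : ℝ)..1, s * κ (x.1, s • x.2) =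
        ∫ s in (0 : ℝ)..1, s * extD β (x.1, s • x.2) (0, 1) (0, Complex.I) := by
      refine intervalIntegral.integral_congr fun s hs => ?_
      rw [Set.uIcc_of_le zero_le_one] at hs
      simp only [(hO x hx s hs).2.1]
    have h4 : β x (v, ζ) = β x (v, 0) + β x (0, ζ) := by rw [← map_add]; simp
    have h5 := hne _ (hO0 x hx)
    simp only
    rw [h3, h4, ← h2]
    have h6 : β x (v, 0) = β x (e, 0) / β (x.1, 0) (e, 0) * β (x.1, 0) (v, 0) := by
      field_simp
      linarith
    rw [← h6]
  · intro y hy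
    have h1 : ∫ s in (0 : ℝ)..1, s * κ (y, s • (0 : ℂ)) =
        ∫ s in (0 : ℝ)..1, s * extD β (y, 0) (0, 1) (0, Complex.I) := by
      refine intervalIntegral.integral_congr fun s hs => ?_
      rw [Set.uIcc_of_le zero_le_one] at hs
      have := (hO _ hy s hs).2.1
      simp only [smul_zero] at this ⊢
      rw [this]
    simp only
    rw [h1, intervalIntegral.integral_mul_const, integral_id]
    ring

end NormalForm

/-! ### The normal form on a neighbourhood of the binding. -/

section GlobalNormalForm

variable {b d : ℕ}
  {B : Type v} [TopologicalSpace B] [ChartedSpace (EuclideanSpace ℝ (Fin b)) B]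
  [IsManifold (𝓡 b) ∞ B]
  {M : Type u} [TopologicalSpace M] [ChartedSpace (EuclideanSpace ℝ (Fin d)) M]
  [IsManifold (𝓡 d) ∞ M]
  {ι : B → M} {π : M → Circle} {α : OneForm d M} {δ : ℝ}
  {ψ : PartialDiffeomorph ((𝓡 b).prod 𝓘(ℝ, ℂ)) (𝓡 d) (B × ℂ) M ∞}

lemma rotForm_zero_right (z : ℂ) : rotForm z 0 = 0 := by simp [rotForm]

lemma rotForm_zero_left (ζ : ℂ) : rotForm 0 ζ = 0 := by simp [rotForm]

lemma rotForm_I_mul (z : ℂ) : rotForm z (Complex.I * z) = Complex.normSq z := by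
  simp [rotForm, Complex.normSq_apply]

/-- The conformal factor of a radial form on the slices. -/
def sliceFactor (ψ : B × ℂ → M) (α : OneForm d M) (e : B → EuclideanSpace ℝ (Fin b))
    (x : B × ℂ) : ℝ := formAt ψ α x (e x.1, 0)

/-- The factor of `r² dθ` in a radial form. -/
def fibreFactor (b : ℕ) {B : Type v} [TopologicalSpace B]
    [ChartedSpace (EuclideanSpace ℝ (Fin b)) B] (ψ : B × ℂ → M) (α : OneForm d M)
    (x : B × ℂ) : ℝ :=
  open Classical in
  if x.2 = 0 then dFormAt (b := b) ψ α x (0, 1) (0, Complex.I) / 2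
  else formAt (b := b) ψ α x (0, Complex.I * x.2) / Complex.normSq x.2

lemma contMDiffOn_chart_times (q : B) :
    ContMDiffOn ((𝓡 b).prod 𝓘(ℝ, ℂ)) 𝓘(ℝ, EuclideanSpace ℝ (Fin b) × ℂ) ∞
      (fun x : B × ℂ => (extChartAt (𝓡 b) q x.1, x.2))
      ((extChartAt (𝓡 b) q).source ×ˢ Set.univ) :=
  ((contMDiffOn_extChartAt (n := ∞) (I := 𝓡 b) (x := q)).comp (contMDiffOn_fst (N := ℂ))
    fun x hx => by simpa using hx.1).prodMk_space contMDiffOn_snd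

/-- The factors are defined by values of α and dα, so the local normal forms in different charts
need not be glued. The choice of `e` need not be continuous: in the normal form every vector with
α_B(e) = 1 reads off the same G. -/
lemma IsBindingTrivialization.exists_normal_form_at (hα : IsSmoothForm α)
    (h : IsBindingTrivialization ι π δ ψ)
    (hrad : ∀ (p : B) (z : ℂ), ‖z‖ < δ → ∀ s ∈ Set.Icc (0 : ℝ) 1,
      IsCharacteristic (formAt ψ α (p, s • z)) (dFormAt ψ α (p, s • z))
        (0 : EuclideanSpace ℝ (Fin b)) z)
    {e : B → EuclideanSpace ℝ (Fin b)} (he : ∀ p, restrictForm ι α p (e p) = 1) (q : B) :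
    ∃ O : Set (B × ℂ), IsOpen O ∧ (q, 0) ∈ O ∧ O ⊆ ψ.source ∧
      ContMDiffOn ((𝓡 b).prod 𝓘(ℝ, ℂ)) 𝓘(ℝ, ℝ) ∞ (sliceFactor ψ α e) O ∧
      ContMDiffOn ((𝓡 b).prod 𝓘(ℝ, ℂ)) 𝓘(ℝ, ℝ) ∞ (fibreFactor b ψ α) O ∧
      ∀ x ∈ O, 0 < sliceFactor ψ α e x ∧ ∀ (v : EuclideanSpace ℝ (Fin b)) (ζ : ℂ),
        formAt ψ α x (v, ζ) = sliceFactor ψ α e x * restrictForm ι α x.1 v +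
          fibreFactor b ψ α x * rotForm x.2 ζ := by
  set χ := extChartAt (𝓡 b) q with hχ
  have hS := ψ.open_source
  have hF := ψ.contMDiffOn_toFun
  have hS0 := h.zero_mem
  have hN : IsOpen χ.target := isOpen_extChartAt_target q
  have hdom : chartDomain (b := b) ψ.source q = χ.target ×ˢ Metric.ball 0 δ := by
    ext x
    simp only [chartDomain, h.source_eq]
    simp [hχ]
  have hβ : ContDiffOn ℝ ∞ (chartForm ψ α q) (χ.target ×ˢ Metric.ball 0 δ) := by
    rw [← hdom]
    exact contDiffOn_chartForm hα hS hF q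
  have hr : IsRadial (chartForm (b := b) ψ α q) χ.target δ := by
    intro y hy z hz s hs
    have hmem : (χ.symm y, s • z) ∈ ψ.source := h.mem_source.2 (norm_smul_lt hz hs)
    have h1 := (isCharacteristic_chartForm hα hS hF (x := (χ.symm y, s • z)) (χ.map_target hy)
      hmem 0 z).2 (by rw [map_zero]; exact hrad _ z hz s hs)
    rwa [χ.right_inv hy] at h1
  have hqs : q ∈ χ.source := mem_extChartAt_source q
  have hzero : ∀ p ∈ χ.source, ∀ v : EuclideanSpace ℝ (Fin b),
      chartForm ψ α q (χ p, 0) (v, 0) = restrictForm ι α p (chartD q (χ p) v) := fun p hp v => by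
    have h1 := chartForm_apply' (α := α) hS hF (x := (p, 0)) hp (hS0 p) (v, 0)
    rw [h1]
    exact formAt_zero hS hF hS0 h.zero_section p _
  have he1 : ∀ p ∈ χ.source, chartForm ψ α q (χ p, 0) (chartDInv q p (e p), 0) = 1 :=
    fun p hp => by rw [hzero p hp, chartD_chartDInv hp]; exact he p
  obtain ⟨O, G, K, hO, hqO, hOs, hG, hK, hGK, hK0⟩ := hr.exists_normal_form hN hβ
    (χ.map_source hqs) h.pos (e := chartDInv q q (e q)) (by rw [he1 q hqs]; exact one_ne_zero)
  set O' : Set (B × ℂ) := (χ.source ×ˢ Set.univ) ∩ (fun x : B × ℂ => (χ x.1, x.2)) ⁻¹' O with hO'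
  have hO's : ∀ x ∈ O', x ∈ ψ.source := fun x hx => h.mem_source.2 (by simpa using (hOs hx.2).2)
  have hform : ∀ x ∈ O', ∀ (v : EuclideanSpace ℝ (Fin b)) (ζ : ℂ), formAt ψ α x (v, ζ) =
      G (χ x.1, x.2) * restrictForm ι α x.1 v + K (χ x.1, x.2) * rotForm x.2 ζ := by
    intro x hx v ζ
    have hxs := hx.1.1
    have h1 := (hGK _ hx.2).2 (chartDInv q x.1 v) ζ
    rw [chartForm_apply' hS hF hxs (hO's x hx)] at h1
    simp only [hzero x.1 hxs] at h1
    rw [chartD_chartDInv hxs] at h1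
    exact h1
  have hG' : ∀ x ∈ O', sliceFactor ψ α e x = G (χ x.1, x.2) := fun x hx => by
    rw [sliceFactor, hform x hx, rotForm_zero_right, he]
    ring
  have hK' : ∀ x ∈ O', fibreFactor b ψ α x = K (χ x.1, x.2) := fun x hx => by
    -- On the zero section the integral for K reduces to κ ∫ s ds, whence the half. Elsewhere K is
    -- read off from the angular vector iz, on which r² dθ equals |z|².
    unfold fibreFactor
    split_ifs with h0
    · rw [h0]
      have h1 := hK0 (χ x.1) (by have := hx.2; rw [Set.mem_preimage, h0] at this; exact this)
      rw [h1]
      congr 1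
      have hx0 : x = (x.1, 0) := Prod.ext rfl h0
      have h2 := extD_chartForm' hα hS hF (x := (x.1, 0)) hx.1.1 (hS0 x.1) (0, 1) (0, Complex.I)
      rw [h2, ← hx0]
      simp only [map_zero]
    · rw [hform x hx, rotForm_I_mul]
      have : restrictForm ι α x.1 (0 : EuclideanSpace ℝ (Fin b)) = 0 :=
        map_zero (restrictForm ι α x.1)
      rw [this]
      have : Complex.normSq x.2 ≠ 0 := fun h => h0 (Complex.normSq_eq_zero.1 h)
      field_simp
      ring
  have hcc := (contMDiffOn_chart_times (b := b) q)
  refine ⟨O', hcc.continuousOn.isOpen_inter_preimage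
    ((isOpen_extChartAt_source q).prod isOpen_univ) hO, ⟨⟨hqs, trivial⟩, hqO⟩, hO's, ?_, ?_, ?_⟩
  · exact (hG.contMDiffOn.comp (hcc.mono Set.inter_subset_left) fun x hx => hx.2).congr hG'
  · exact (hK.contMDiffOn.comp (hcc.mono Set.inter_subset_left) fun x hx => hx.2).congr hK'
  · intro x hx
    rw [hG' x hx, hK' x hx]
    exact ⟨(hGK _ hx.2).1, hform x hx⟩

/-- A form whose radii are characteristic is `G α_B + K r² dθ` near the binding. -/
lemma IsBindingTrivialization.exists_normal_form (hα : IsSmoothForm α)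
    (h : IsBindingTrivialization ι π δ ψ)
    (hrad : ∀ (p : B) (z : ℂ), ‖z‖ < δ → ∀ s ∈ Set.Icc (0 : ℝ) 1,
      IsCharacteristic (formAt ψ α (p, s • z)) (dFormAt ψ α (p, s • z))
        (0 : EuclideanSpace ℝ (Fin b)) z)
    (he : ∀ p, ∃ e : EuclideanSpace ℝ (Fin b), restrictForm ι α p e ≠ 0) :
    ∃ (O : Set (B × ℂ)) (G K : B × ℂ → ℝ), IsOpen O ∧ (∀ p, (p, 0) ∈ O) ∧ O ⊆ ψ.source ∧
      ContMDiffOn ((𝓡 b).prod 𝓘(ℝ, ℂ)) 𝓘(ℝ, ℝ) ∞ G O ∧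
      ContMDiffOn ((𝓡 b).prod 𝓘(ℝ, ℂ)) 𝓘(ℝ, ℝ) ∞ K O ∧
      (∀ x ∈ O, 0 < G x ∧ ∀ (v : EuclideanSpace ℝ (Fin b)) (ζ : ℂ),
        formAt ψ α x (v, ζ) = G x * restrictForm ι α x.1 v + K x * rotForm x.2 ζ) ∧
      ∀ p, K (p, 0) = dFormAt (b := b) ψ α (p, 0) (0, 1) (0, Complex.I) / 2 := by
  have he' : ∀ p, ∃ e : EuclideanSpace ℝ (Fin b), restrictForm ι α p e = 1 := fun p => by
    obtain ⟨e, he⟩ := he p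
    let a : EuclideanSpace ℝ (Fin b) →L[ℝ] ℝ := restrictForm ι α p
    refine ⟨(a e)⁻¹ • e, ?_⟩
    show a ((a e)⁻¹ • e) = 1
    rw [map_smul, smul_eq_mul]
    exact inv_mul_cancel₀ he
  choose e he using he'
  choose O hO hpO hOs hG hK hform using fun q => h.exists_normal_form_at hα hrad he q
  have key : ∀ f : B × ℂ → ℝ, (∀ q, ContMDiffOn ((𝓡 b).prod 𝓘(ℝ, ℂ)) 𝓘(ℝ, ℝ) ∞ f (O q)) →
      ContMDiffOn ((𝓡 b).prod 𝓘(ℝ, ℂ)) 𝓘(ℝ, ℝ) ∞ f (⋃ q, O q) := fun f hf x hx => by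
    obtain ⟨q, hq⟩ := Set.mem_iUnion.1 hx
    exact ((hf q).contMDiffAt ((hO q).mem_nhds hq)).contMDiffWithinAt
  refine ⟨⋃ q, O q, sliceFactor ψ α e, fibreFactor b ψ α, isOpen_iUnion hO,
    fun p => Set.mem_iUnion.2 ⟨p, hpO p⟩, Set.iUnion_subset hOs, key _ hG, key _ hK,
    fun x hx => ?_, fun p => by simp [fibreFactor]⟩
  obtain ⟨q, hq⟩ := Set.mem_iUnion.1 hx
  exact hform q x hq

end GlobalNormalForm

/-! ### Nondegeneracy and Reeb vectors of contact forms. -/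

section ContactForms

variable {n : ℕ} {M : Type u} [TopologicalSpace M]
  [ChartedSpace (EuclideanSpace ℝ (Fin (2 * n + 1))) M]
  [IsManifold (𝓡 (2 * n + 1)) ∞ M] {α : OneForm (2 * n + 1) M}

/-- A 1-form at a point, as a linear form on the model space. -/
def formL {d : ℕ} {M : Type u} [TopologicalSpace M] [ChartedSpace (EuclideanSpace ℝ (Fin d)) M]
    (α : OneForm d M) (q : M) : EuclideanSpace ℝ (Fin d) →L[ℝ] ℝ := α q

lemma IsContactForm.nondegenerate (h : IsContactForm α) (q : M) :
    ContactNondegenerate (fun x => formL α q x) (fun x y => dFormL α q x y) := by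
  obtain ⟨v, hv⟩ := h.volume_ne_zero q
  exact contactNondegenerate_of_contactVolume_ne_zero (n := n) (by simp)
    (formL α q).toLinearMap ((ContinuousLinearMap.coeLM ℝ).comp (dFormL α q).toLinearMap)
    (dForm_swap α q) (v := v) hv

lemma IsContactForm.exists_reeb (h : IsContactForm α) (q : M) :
    ∃ R : EuclideanSpace ℝ (Fin (2 * n + 1)), IsReebVector α q R := by
  obtain ⟨R, h1, h2⟩ := ContactNondegenerate.exists_reeb (dForm_self α q) (h.nondegenerate q)
  exact ⟨R, h2, h1⟩

/-- Reversing a frame of odd size changes the sign of the volume. -/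
lemma formVolume_neg (α : OneForm (2 * n + 1) M) (q : M)
    (v : Fin (2 * n + 1) → EuclideanSpace ℝ (Fin (2 * n + 1))) :
    formVolume α q (fun i => -v i : Fin (2 * n + 1) → EuclideanSpace ℝ (Fin (2 * n + 1))) =
      -formVolume α q v := by
  have h1 : ∀ x : EuclideanSpace ℝ (Fin (2 * n + 1)), formL α q (-x) = -formL α q x :=
    fun x => map_neg _ x
  have h2 : ∀ x y : EuclideanSpace ℝ (Fin (2 * n + 1)),
    dFormL α q (-x) (-y) = dFormL α q x y := fun x y => by simp
  show contactVolume n (fun x => formL α q x) (fun x y => dFormL α q x y) (fun i => -v i) =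
    -contactVolume n (fun x => formL α q x) (fun x y => dFormL α q x y) v
  simp only [contactVolume, h1, h2]
  rw [← Finset.sum_neg_distrib]
  exact Finset.sum_congr rfl fun σ _ => by ring

end ContactForms

/-! ### The sign of dα on the disks along the binding. -/

section Positivity

variable {n : ℕ}
  {B : Type v} [TopologicalSpace B] [ChartedSpace (EuclideanSpace ℝ (Fin (2 * n + 1))) B]
  [IsManifold (𝓡 (2 * n + 1)) ∞ B]
  {M : Type u} [TopologicalSpace M] [ChartedSpace (EuclideanSpace ℝ (Fin (2 * (n + 1) + 1))) M]
  [IsManifold (𝓡 (2 * (n + 1) + 1)) ∞ M]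
  {ι : B → M} {π : M → Circle} {α : OneForm (2 * (n + 1) + 1) M} {δ : ℝ}
  {ψ : PartialDiffeomorph ((𝓡 (2 * n + 1)).prod 𝓘(ℝ, ℂ)) (𝓡 (2 * (n + 1) + 1)) (B × ℂ) M ∞}

local notation "EB" => EuclideanSpace ℝ (Fin (2 * n + 1))

lemma sliceNondegenerate_binding (hsupp : Supports ι π α)
    (h : IsBindingTrivialization ι π δ ψ) (p : B) :
    SliceNondegenerate (formAt (b := 2 * n + 1) ψ α (p, 0))
      (dFormAt (b := 2 * n + 1) ψ α (p, 0)) := by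
  have h1 := hsupp.binding_contact.nondegenerate p
  simp only [SliceNondegenerate, formAt_zero ψ.open_source ψ.contMDiffOn_toFun h.zero_mem
    h.zero_section, dFormAt_zero hsupp.contact.smooth ψ.open_source ψ.contMDiffOn_toFun h.zero_mem
    h.zero_section]
  exact h1

/-- Along the binding, the slices and the fibres of a radial trivialization are orthogonal. -/
lemma dFormAt_fibre_slice (hsupp : Supports ι π α) (h : IsBindingTrivialization ι π δ ψ)
    (hrad : ∀ (p : B) (z : ℂ), ‖z‖ < δ → ∀ s ∈ Set.Icc (0 : ℝ) 1,
      IsCharacteristic (formAt ψ α (p, s • z)) (dFormAt ψ α (p, s • z)) (0 : EB) z)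
    (p : B) (ζ : ℂ) (v : EB) : dFormAt ψ α (p, 0) (0, ζ) (v, 0) = 0 := by
  obtain ⟨R, hR0, hR1⟩ := hsupp.contact.exists_reeb (ι p)
  obtain ⟨w, hw⟩ : ∃ w : EB, mfderiv (𝓡 (2 * n + 1)) (𝓡 (2 * (n + 1) + 1)) ι p w = R :=
    hsupp.reeb_tangent p R ⟨hR0, hR1⟩
  have hS := ψ.open_source
  have hF := ψ.contMDiffOn_toFun
  have hψ0 := h.zero_section p
  have hwR : derivAt ψ (p, 0) (w, 0) = R :=
    (derivAt_zero hS hF h.zero_mem h.zero_section p w).trans hw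
  have hw1 : formAt ψ α (p, 0) (w, 0) = 1 := by
    rw [formAt_zero hS hF h.zero_mem h.zero_section]
    exact (congrArg (α (ι p)) hw).trans hR1
  have hR0' : ∀ x : EuclideanSpace ℝ (Fin (2 * (n + 1) + 1)), dFormL α (ψ (p, 0)) R x = 0 := by
    rw [hψ0]; exact hR0
  have hw2 : dFormAt ψ α (p, 0) (0, ζ) (w, 0) = 0 := by
    have h1 : dFormAt ψ α (p, 0) (0, ζ) (w, 0) = -dFormAt ψ α (p, 0) (w, 0) (0, ζ) :=
      dForm_swap _ _ _ _
    have h2 : dFormAt ψ α (p, 0) (w, 0) (0, ζ) =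
        dFormL α (ψ (p, 0)) (derivAt ψ (p, 0) (w, 0)) (derivAt ψ (p, 0) (0, ζ)) := rfl
    rw [h1, h2, hwR, hR0', neg_zero]
  have hchar : ∀ u : EB, formAt ψ α (p, 0) (u, 0) = 0 → dFormAt ψ α (p, 0) (0, ζ) (u, 0) = 0 := by
    intro u hu
    -- Radial directions are assumed characteristic only for vectors shorter than δ. The scaled
    -- vector is short enough, and s = 0 puts the base point on the binding.
    set c : ℝ := δ / 2 / (‖ζ‖ + 1) with hc
    have hcpos : 0 < c := by have := h.pos; positivity
    have hcζ : ‖c • ζ‖ < δ := by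
      rw [norm_smul, Real.norm_of_nonneg hcpos.le, hc, div_mul_eq_mul_div, div_lt_iff₀ (by positivity)]
      nlinarith [h.pos, norm_nonneg ζ]
    have h1 := (hrad p (c • ζ) hcζ 0 ⟨le_rfl, zero_le_one⟩).2 u (by rw [zero_smul]; exact hu)
    rw [zero_smul, dFormAt_eq_dFormAtL] at h1
    have h2 : ((0, c • ζ) : EB × ℂ) = c • (0, ζ) := by simp
    rw [h2, map_smul, smul_apply, smul_eq_mul] at h1
    exact (mul_eq_zero.1 h1).resolve_left hcpos.ne'
  -- Removing the Reeb component leaves a vector of ker α_B; the Reeb component itself contributes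
  -- nothing to dα.
  have h3 := hchar (v - formAt ψ α (p, 0) (v, 0) • w) (by
    have h4 : ((v - formAt ψ α (p, 0) (v, 0) • w, 0) : EB × ℂ) =
      (v, 0) - formAt ψ α (p, 0) (v, 0) • (w, 0) := by simp
    rw [h4, formAt_eq_formAtL, map_sub, map_smul, ← formAt_eq_formAtL, ← formAt_eq_formAtL, hw1]
    simp)
  have h4 : ((v - formAt ψ α (p, 0) (v, 0) • w, 0) : EB × ℂ) =
      (v, 0) - formAt ψ α (p, 0) (v, 0) • (w, 0) := by simp
  rw [h4, dFormAt_eq_dFormAtL, map_sub, map_smul, ← dFormAt_eq_dFormAtL, ← dFormAt_eq_dFormAtL,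
    hw2, smul_zero, sub_zero] at h3
  exact h3

lemma bindingFrame_castSucc (p : B) (v : Fin (2 * n + 1) → EB) (i : Fin (2 * n + 1)) :
    bindingFrame ι ψ p v i.castSucc.castSucc =
      mfderiv (𝓡 (2 * n + 1)) (𝓡 (2 * (n + 1) + 1)) ι p (v i) := by
  unfold bindingFrame
  exact (Fin.snoc_castSucc (n := 2 * n + 2)
    (α := fun _ => EuclideanSpace ℝ (Fin (2 * (n + 1) + 1))) _ _ _).trans
    (Fin.snoc_castSucc (n := 2 * n + 1)
      (α := fun _ => EuclideanSpace ℝ (Fin (2 * (n + 1) + 1))) _ _ _)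

lemma bindingFrame_pairFst (p : B) (v : Fin (2 * n + 1) → EB) :
    bindingFrame ι ψ p v (pairFst (Fin.last n)) = derivAt (b := 2 * n + 1) ψ (p, 0) (0, 1) := by
  have h1 : pairFst (Fin.last n) = (Fin.last (2 * n + 1)).castSucc := by
    ext; simp [pairFst]
  unfold bindingFrame
  rw [h1]
  exact (Fin.snoc_castSucc (n := 2 * n + 2)
    (α := fun _ => EuclideanSpace ℝ (Fin (2 * (n + 1) + 1))) _ _ _).trans
    (Fin.snoc_last (n := 2 * n + 1)
      (α := fun _ => EuclideanSpace ℝ (Fin (2 * (n + 1) + 1))) _ _)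

lemma bindingFrame_pairSnd (p : B) (v : Fin (2 * n + 1) → EB) :
    bindingFrame ι ψ p v (pairSnd (Fin.last n)) = derivAt (b := 2 * n + 1) ψ (p, 0) (0, Complex.I) := by
  have h1 : pairSnd (Fin.last n) = Fin.last (2 * n + 2) := by
    ext; simp [pairSnd]
  unfold bindingFrame
  rw [h1]
  exact Fin.snoc_last (n := 2 * n + 2)
    (α := fun _ => EuclideanSpace ℝ (Fin (2 * (n + 1) + 1))) _ _

/-- The vector ∂_x lies in ker α and is dα-orthogonal to the whole frame except ∂_y, so the volume
splits. The sign of dα(∂_x, ∂_y) thus compares the orientations of M and B. -/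
lemma formVolume_bindingFrame (hsupp : Supports ι π α) (h : IsBindingTrivialization ι π δ ψ)
    (hrad : ∀ (p : B) (z : ℂ), ‖z‖ < δ → ∀ s ∈ Set.Icc (0 : ℝ) 1,
      IsCharacteristic (formAt ψ α (p, s • z)) (dFormAt ψ α (p, s • z)) (0 : EB) z)
    (hfib : ∀ (p : B) (ζ : ℂ), formAt ψ α (p, 0) ((0, ζ) : EB × ℂ) = 0)
    (p : B) (v : Fin (2 * n + 1) → EB) :
    formVolume α (ι p) (bindingFrame ι ψ p v) =
      2 * (n + 1) * (dFormAt ψ α (p, 0) ((0, 1) : EB × ℂ) (0, Complex.I) *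
        formVolume (restrictForm ι α) p v) := by
  have hψ0 := h.zero_section p
  have hX : ∀ u : EB × ℂ, dFormAt ψ α (p, 0) (0, 1) u =
      dForm α (ι p) (derivAt ψ (p, 0) (0, 1)) (derivAt ψ (p, 0) u) := fun u => by
    rw [← hψ0]; rfl
  show contactVolume _ _ _ _ = _
  rw [contactVolume_eq_sum, sum_volumeTerm_block (n := n) (fun i j => dForm_swap α (ι p) _ _)]
  · rw [bindingFrame_pairFst, bindingFrame_pairSnd, hX]
    simp only [bindingFrame_castSucc]
    congr 2
    refine Eq.trans ?_ (contactVolume_eq_sum n (fun x : EB => restrictForm ι α p x)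
      (fun x y : EB => dForm (restrictForm ι α) p x y) v).symm
    refine Finset.sum_congr rfl fun σ _ => ?_
    congr 1
    funext i j
    exact (dForm_restrictForm hsupp.contact.smooth
      (contMDiff_of_slice ψ.contMDiffOn_toFun h.zero_mem h.zero_section) p (v i) (v j)).symm
  · rw [bindingFrame_pairFst, ← hψ0]
    exact hfib p 1
  · intro j hj
    have hj' : j = pairFst (Fin.last n) ∨ ∃ i : Fin (2 * n + 1), j = i.castSucc.castSucc := by
      rcases Nat.lt_or_ge (j : ℕ) (2 * n + 1) with h1 | h1
      · exact Or.inr ⟨⟨j, h1⟩, by ext; simp⟩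
      · left
        have h2 : (j : ℕ) ≠ 2 * n + 2 := fun h => hj (by ext; simpa [pairSnd] using h)
        ext
        simp only [pairFst, Fin.val_last]
        omega
    rcases hj' with rfl | ⟨i, rfl⟩
    · exact dForm_self _ _ _
    · rw [bindingFrame_pairFst, bindingFrame_castSucc]
      have h1 := dFormAt_fibre_slice hsupp h hrad p 1 (v i)
      rw [hX, derivAt_zero ψ.open_source ψ.contMDiffOn_toFun h.zero_mem h.zero_section] at h1
      exact h1

/-- The fibres of a radial trivialization are positive along the binding. -/
lemma dFormAt_fibre_pos (hsupp : Supports ι π α) (h : IsBindingTrivialization ι π δ ψ)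
    (hrad : ∀ (p : B) (z : ℂ), ‖z‖ < δ → ∀ s ∈ Set.Icc (0 : ℝ) 1,
      IsCharacteristic (formAt ψ α (p, s • z)) (dFormAt ψ α (p, s • z)) (0 : EB) z)
    (hfib : ∀ (p : B) (ζ : ℂ), formAt ψ α (p, 0) ((0, ζ) : EB × ℂ) = 0) (p : B) :
    0 < dFormAt ψ α (p, 0) ((0, 1) : EB × ℂ) (0, Complex.I) := by
  rcases lt_trichotomy (dFormAt ψ α (p, 0) ((0, 1) : EB × ℂ) (0, Complex.I)) 0 with hκ | hκ | hκ
  · exfalso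
    obtain ⟨v, hv⟩ := hsupp.binding_contact.volume_ne_zero p
    -- If κ < 0, a frame of B with negative volume would complete to a positive frame of M, against
    -- `binding_positive`. One of a frame and its reversal has negative volume.
    have key : ∀ v : Fin (2 * n + 1) → EB, formVolume (restrictForm ι α) p v < 0 → False := by
      intro v hv
      have h1 := hsupp.binding_positive δ ψ h p v (by
        rw [formVolume_bindingFrame hsupp h hrad hfib]
        have := mul_pos_of_neg_of_neg hκ hv
        positivity)
      linarith
    rcases lt_or_gt_of_ne hv with hv | hv
    · exact key v hv
    · exact key _ ((formVolume_neg (restrictForm ι α) p v).trans_lt (neg_neg_of_pos hv))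
  · exfalso
    -- If κ = 0, then ∂_x would lie in ker α and in the kernel of dα.
    have hnd := (hsupp.contact.nondegenerate (ψ (p, 0))).2 (derivAt ψ (p, 0) (0, 1))
      (hfib p 1) fun x _ => by
        obtain ⟨⟨u, ζ⟩, rfl⟩ := (derivAt_bijective (h.zero_mem p)).2 x
        show dFormAtL ψ α (p, 0) ((0, 1) : EB × ℂ) (u, ζ) = 0
        have h1 : ((u, ζ) : EB × ℂ) = (u, 0) + ζ.re • (0, 1) + ζ.im • (0, Complex.I) := by
          ext
          · simp
          · simp [Complex.re_add_im]
        rw [h1, map_add, map_add, map_smul, map_smul, ← dFormAt_eq_dFormAtL, ← dFormAt_eq_dFormAtL,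
          ← dFormAt_eq_dFormAtL, hκ, dFormAt_fibre_slice hsupp h hrad,
          show dFormAt ψ α (p, 0) ((0, 1) : EB × ℂ) (0, 1) = 0 from dForm_self _ _ _]
        simp
    have h2 := (derivAt_bijective (h.zero_mem p)).1 (hnd.trans (map_zero _).symm)
    simpa using congrArg Prod.snd h2
  · exact hκ

end Positivity

/-! ### Rescaling the fibres of B × ℂ. -/

section Rescaling

variable {b : ℕ} {B : Type v} [TopologicalSpace B] [ChartedSpace (EuclideanSpace ℝ (Fin b)) B]
  [IsManifold (𝓡 b) ∞ B]

/-- Rescaling of the fibres of `B × ℂ`. -/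
def fibreScale (ρ : B × ℂ → ℝ) (x : B × ℂ) : B × ℂ := (x.1, ρ x • x.2)

/-- The derivative of a map from `B × ℂ` to itself, as a map of vector spaces. -/
def prodD (f : B × ℂ → B × ℂ) (x : B × ℂ) :
    EuclideanSpace ℝ (Fin b) × ℂ →L[ℝ] EuclideanSpace ℝ (Fin b) × ℂ :=
  mfderiv ((𝓡 b).prod 𝓘(ℝ, ℂ)) ((𝓡 b).prod 𝓘(ℝ, ℂ)) f x

/-- The differential of a function on `B × ℂ`, as a linear form. -/
def scalarD (ρ : B × ℂ → ℝ) (x : B × ℂ) : EuclideanSpace ℝ (Fin b) × ℂ →L[ℝ] ℝ :=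
  mfderiv ((𝓡 b).prod 𝓘(ℝ, ℂ)) 𝓘(ℝ, ℝ) ρ x

lemma prodD_fibreScale {ρ : B × ℂ → ℝ} {x : B × ℂ}
    (hρ : MDifferentiableAt ((𝓡 b).prod 𝓘(ℝ, ℂ)) 𝓘(ℝ, ℝ) ρ x)
    (u : EuclideanSpace ℝ (Fin b) × ℂ) :
    prodD (fibreScale ρ) x u = (u.1, ρ x • u.2 + scalarD ρ x u • x.2) := by
  have h1 : HasFDerivAt (fun q : ℝ × ℂ => q.1 • q.2)
      (ρ x • ContinuousLinearMap.snd ℝ ℝ ℂ + (ContinuousLinearMap.fst ℝ ℝ ℂ).smulRight x.2)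
      (ρ x, x.2) :=
    HasFDerivAt.fun_smul (c := fun q : ℝ × ℂ => q.1) (f := fun q : ℝ × ℂ => q.2) (x := (ρ x, x.2))
      hasFDerivAt_fst hasFDerivAt_snd
  have h2 : HasMFDerivAt ((𝓡 b).prod 𝓘(ℝ, ℂ)) 𝓘(ℝ, ℝ × ℂ) (fun x : B × ℂ => (ρ x, x.2)) x
      ((scalarD (b := b) ρ x).prod (ContinuousLinearMap.snd ℝ (EuclideanSpace ℝ (Fin b)) ℂ)) := by
    rw [modelWithCornersSelf_prod, ← chartedSpaceSelf_prod]
    exact hρ.hasMFDerivAt.prodMk (hasMFDerivAt_snd x)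
  have h3 := (hasMFDerivAt_fst (I := 𝓡 b) (I' := 𝓘(ℝ, ℂ)) x).prodMk (h1.hasMFDerivAt.comp x h2)
  exact DFunLike.congr_fun h3.mfderiv u

lemma contMDiffOn_fibreScale {ρ : B × ℂ → ℝ} {O : Set (B × ℂ)}
    (hρ : ContMDiffOn ((𝓡 b).prod 𝓘(ℝ, ℂ)) 𝓘(ℝ, ℝ) ∞ ρ O) :
    ContMDiffOn ((𝓡 b).prod 𝓘(ℝ, ℂ)) ((𝓡 b).prod 𝓘(ℝ, ℂ)) ∞ (fibreScale ρ) O :=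
  contMDiffOn_fst.prodMk (hρ.smul contMDiffOn_snd)

/-- A positive rescaling of the fibres is a diffeomorphism near the zero section. -/
lemma exists_partialDiffeomorph_fibreScale [CompactSpace B] [T2Space B] {ρ : B × ℂ → ℝ}
    {O : Set (B × ℂ)} (hO : IsOpen O) (hO0 : ∀ p, (p, (0 : ℂ)) ∈ O)
    (hρ : ContMDiffOn ((𝓡 b).prod 𝓘(ℝ, ℂ)) 𝓘(ℝ, ℝ) ∞ ρ O) (hpos : ∀ x ∈ O, 0 < ρ x) :
    ∃ θ : PartialDiffeomorph ((𝓡 b).prod 𝓘(ℝ, ℂ)) ((𝓡 b).prod 𝓘(ℝ, ℂ)) (B × ℂ) (B × ℂ) ∞,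
      θ.source ⊆ O ∧ (∀ p, (p, 0) ∈ θ.source) ∧ ∀ x, θ x = fibreScale ρ x := by
  have h0 : ∀ p : B, fibreScale ρ (p, 0) = (p, 0) := fun p => by simp [fibreScale]
  have hbij : ∀ p : B, Function.Bijective (prodD (b := b) (fibreScale ρ) (p, 0)) := by
    intro p
    have hp := (hpos _ (hO0 p)).ne'
    have h1 : ∀ u, prodD (b := b) (fibreScale ρ) (p, 0) u = (u.1, ρ (p, 0) • u.2) := fun u => by
      rw [prodD_fibreScale ((hρ.contMDiffAt (hO.mem_nhds (hO0 p))).mdifferentiableAt (by simp))]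
      simp
    refine Function.bijective_iff_has_inverse.2
      ⟨fun u => (u.1, (ρ (p, 0))⁻¹ • u.2), fun u => ?_, fun u => ?_⟩
    · simp only [h1]
      rw [smul_smul, inv_mul_cancel₀ hp, one_smul]
    · rw [h1]
      show (u.1, ρ (p, 0) • (ρ (p, 0))⁻¹ • u.2) = u
      rw [smul_smul, mul_inv_cancel₀ hp, one_smul]
  obtain ⟨δ, hδ, θ, hs, hsO, hθ⟩ := exists_partialDiffeomorph_ball
    (fun p => isLocalDiffeomorphAt_of_mfderiv hO (contMDiffOn_fibreScale hρ) (hO0 p) (hbij p))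
    (fun p p' hp => by rw [h0, h0] at hp; exact congrArg Prod.fst hp) id hO hO0
  exact ⟨θ, hsO, fun p => by rw [hs]; exact ⟨trivial, Metric.mem_ball_self hδ⟩, hθ⟩

end Rescaling

/-! ### From G α_B + K r² dθ to g (α_B + r² dθ). -/

section Model

variable {b d : ℕ}
  {B : Type v} [TopologicalSpace B] [ChartedSpace (EuclideanSpace ℝ (Fin b)) B]
  [IsManifold (𝓡 b) ∞ B]
  {M : Type u} [TopologicalSpace M] [ChartedSpace (EuclideanSpace ℝ (Fin d)) M]
  [IsManifold (𝓡 d) ∞ M]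
  {ι : B → M} {π : M → Circle} {α : OneForm d M} {δ : ℝ}
  {ψ : PartialDiffeomorph ((𝓡 b).prod 𝓘(ℝ, ℂ)) (𝓡 d) (B × ℂ) M ∞}

/-- The trivialization `ψ` brings `α` to the form `g (α_B + r² dθ)`. -/
structure IsModel (ι : B → M) (π : M → Circle) (α : OneForm d M) (δ : ℝ)
    (ψ : PartialDiffeomorph ((𝓡 b).prod 𝓘(ℝ, ℂ)) (𝓡 d) (B × ℂ) M ∞) (g : B × ℂ → ℝ) : Prop where
  triv : IsBindingTrivialization ι π δ ψ
  smooth : ContMDiffOn ((𝓡 b).prod 𝓘(ℝ, ℂ)) 𝓘(ℝ, ℝ) ∞ g ψ.source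
  pos : ∀ x ∈ ψ.source, 0 < g x
  form : ∀ x ∈ ψ.source, ∀ (v : EuclideanSpace ℝ (Fin b)) (ζ : ℂ),
    formAt ψ α x (v, ζ) = g x * (restrictForm ι α x.1 v + rotForm x.2 ζ)

/-- The form r² dθ kills radial vectors. So when the fibres are rescaled by a nonconstant ρ, the
derivative of ρ, which enters only through a radial component, has no effect. -/
lemma rotForm_smul (z ζ : ℂ) (c c' : ℝ) :
    rotForm (c • z) (c • ζ + c' • z) = c ^ 2 * rotForm z ζ := by
  simp only [rotForm, Complex.add_re, Complex.add_im, Complex.smul_re, Complex.smul_im,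
    smul_eq_mul]
  ring

/-- With ρ = √(K/G) one has G α_B + K r² dθ = G (α_B + (ρr)² dθ), so ρr is the new radius and G the
new factor. Positivity of K along the binding suffices, as it persists nearby. -/
lemma exists_isModel [CompactSpace B] [T2Space B] (h : IsBindingTrivialization ι π δ ψ)
    {O : Set (B × ℂ)} {G K : B × ℂ → ℝ} (hO : IsOpen O) (hO0 : ∀ p, (p, (0 : ℂ)) ∈ O)
    (hOs : O ⊆ ψ.source)
    (hG : ContMDiffOn ((𝓡 b).prod 𝓘(ℝ, ℂ)) 𝓘(ℝ, ℝ) ∞ G O)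
    (hK : ContMDiffOn ((𝓡 b).prod 𝓘(ℝ, ℂ)) 𝓘(ℝ, ℝ) ∞ K O)
    (hGpos : ∀ x ∈ O, 0 < G x) (hKpos : ∀ p, 0 < K (p, 0))
    (hform : ∀ x ∈ O, ∀ (v : EuclideanSpace ℝ (Fin b)) (ζ : ℂ),
      formAt ψ α x (v, ζ) = G x * restrictForm ι α x.1 v + K x * rotForm x.2 ζ) :
    ∃ (δ' : ℝ) (ψ' : PartialDiffeomorph ((𝓡 b).prod 𝓘(ℝ, ℂ)) (𝓡 d) (B × ℂ) M ∞) (g : B × ℂ → ℝ),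
      IsModel ι π α δ' ψ' g := by
  set P : Set (B × ℂ) := O ∩ K ⁻¹' Set.Ioi 0 with hP
  have hPo : IsOpen P := hK.continuousOn.isOpen_inter_preimage hO isOpen_Ioi
  set ρ : B × ℂ → ℝ := fun x => √(K x / G x) with hρ
  have hq : ∀ x ∈ P, 0 < K x / G x := fun x hx => div_pos hx.2 (hGpos x hx.1)
  have hρs : ContMDiffOn ((𝓡 b).prod 𝓘(ℝ, ℂ)) 𝓘(ℝ, ℝ) ∞ ρ P := by
    intro x hx
    have h1 : ContMDiffAt ((𝓡 b).prod 𝓘(ℝ, ℂ)) 𝓘(ℝ, ℝ × ℝ) ∞ (fun x => (K x, G x)) x :=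
      ((hK.contMDiffAt (hO.mem_nhds hx.1)).prodMk_space (hG.contMDiffAt (hO.mem_nhds hx.1)))
    have h2 : ContDiffAt ℝ ∞ (fun q : ℝ × ℝ => √(q.1 / q.2)) (K x, G x) :=
      (contDiffAt_fst.div contDiffAt_snd (hGpos x hx.1).ne').sqrt (hq x hx).ne'
    exact (h2.contMDiffAt.comp x h1).contMDiffWithinAt
  have hρpos : ∀ x ∈ P, 0 < ρ x := fun x hx => Real.sqrt_pos.2 (hq x hx)
  obtain ⟨θ, hθP, hθ0, hθ⟩ := exists_partialDiffeomorph_fibreScale hPo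
    (fun p => ⟨hO0 p, hKpos p⟩) hρs hρpos
  have hθz : ∀ p, θ (p, 0) = (p, 0) := fun p => by rw [hθ]; simp [fibreScale]
  obtain ⟨δ', hδ', hball⟩ := exists_ball_subset θ.open_target
    fun p => by have := θ.map_source (hθ0 p); rwa [hθz] at this
  have hsrc : Set.univ ×ˢ Metric.ball (0 : ℂ) δ' ⊆ (θ.symm.trans ψ).source := fun x hx =>
    ⟨hball hx, hOs (hθP (θ.map_target (hball hx))).1⟩
  obtain ⟨ψ', hψ's, hψ'⟩ := exists_partialDiffeomorph_of_injOn
    (isOpen_univ.prod Metric.isOpen_ball) ((θ.symm.trans ψ).toPartialEquiv.injOn.mono hsrc)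
    (fun x hx => (θ.symm.trans ψ).isLocalDiffeomorphAt _ _ _ (hsrc hx))
    (θ.symm.trans ψ).toPartialEquiv.symm
  have hψ'f : ⇑ψ' = fun x => ψ (θ.symm x) := funext hψ'
  have hmem : ∀ x ∈ ψ'.source, x ∈ θ.target ∧ θ.symm x ∈ P ∧
      (θ.symm x).1 = x.1 ∧ ρ (θ.symm x) • (θ.symm x).2 = x.2 := by
    intro x hx
    rw [hψ's] at hx
    have h1 := hball hx
    have h2 : fibreScale ρ (θ.symm x) = x := by rw [← hθ]; exact θ.right_inv h1
    have h3 := congrArg Prod.fst h2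
    have h4 := congrArg Prod.snd h2
    exact ⟨h1, hθP (θ.map_target h1), h3, h4⟩
  refine ⟨δ', ψ', fun x => G (θ.symm x), ⟨hδ', hψ's, fun p => ?_, fun p r u hr hrδ => ?_⟩,
    ?_, fun x hx => hGpos _ (hmem x hx).2.1.1, fun x hx v ζ => ?_⟩
  · rw [hψ'f]
    have : θ.symm (p, 0) = (p, 0) := by
      have := θ.left_inv (hθ0 p)
      rwa [hθz] at this
    simp only [this, h.zero_section]
  · have hx : (p, r • (u : ℂ)) ∈ ψ'.source := by
      rw [hψ's]
      refine ⟨trivial, ?_⟩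
      rwa [mem_ball_zero_iff, norm_smul, Circle.norm_coe, mul_one, Real.norm_of_nonneg hr.le]
    obtain ⟨-, h1, h2, h3⟩ := hmem _ hx
    set y := θ.symm (p, r • (u : ℂ)) with hy
    have hρy := hρpos y h1
    have h3' : ρ y • y.2 = r • (u : ℂ) := h3
    have hy3 : y.2 = (r / ρ y) • (u : ℂ) := by
      calc y.2 = (ρ y)⁻¹ • (ρ y • y.2) := by rw [smul_smul, inv_mul_cancel₀ hρy.ne', one_smul]
        _ = (ρ y)⁻¹ • (r • (u : ℂ)) := congrArg _ h3'
        _ = (r / ρ y) • (u : ℂ) := by rw [smul_smul, div_eq_inv_mul]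
    have hn : ‖y.2‖ = r / ρ y := by
      calc ‖y.2‖ = ‖(r / ρ y) • (u : ℂ)‖ := congrArg _ hy3
        _ = r / ρ y := by
          rw [norm_smul, Circle.norm_coe, mul_one, Real.norm_of_nonneg (by positivity)]
    have hyδ : r / ρ y < δ := hn ▸ h.mem_source.1 (hOs h1.1)
    have hy2 : y = (p, (r / ρ y) • (u : ℂ)) := Prod.ext h2 hy3
    have h4 := h.angle p _ u (div_pos hr hρy) hyδ
    rw [hψ'f]
    exact (congrArg (fun q => π (ψ q)) hy2).trans h4
  · refine hG.comp (θ.contMDiffOn_invFun.mono fun x hx => (hmem x hx).1)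
      fun x hx => (hmem x hx).2.1.1
  · obtain ⟨h1, h2, h3, h4⟩ := hmem x hx
    set y := θ.symm x with hy
    have hys : y ∈ θ.source := θ.map_target h1
    have hd1 : ∀ u, derivAt (d := d) ψ' x u = derivAt ψ y (prodD (b := b) θ.symm x u) := fun u => by
      rw [hψ'f]
      exact DFunLike.congr_fun (mfderiv_comp x (ψ.mdifferentiableAt (by simp) (hOs h2.1))
        (θ.symm.mdifferentiableAt (by simp) h1)) u
    have hd2 : ∀ u, prodD (b := b) (fibreScale ρ) y (prodD (b := b) θ.symm x u) = u := by
      intro u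
      have h5 : mfderiv ((𝓡 b).prod 𝓘(ℝ, ℂ)) ((𝓡 b).prod 𝓘(ℝ, ℂ)) (θ ∘ θ.symm) x =
          (prodD (b := b) θ y).comp (prodD (b := b) θ.symm x) :=
        mfderiv_comp x (θ.mdifferentiableAt (by simp) hys)
        (θ.symm.mdifferentiableAt (by simp) h1)
      have h6 : (θ ∘ θ.symm) =ᶠ[nhds x] id := by
        filter_upwards [θ.open_target.mem_nhds h1] with x' hx'
        exact θ.right_inv hx'
      rw [h6.mfderiv_eq, mfderiv_id] at h5
      have h7 := DFunLike.congr_fun h5 u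
      have h8 : ⇑θ = fibreScale ρ := funext hθ
      rw [← h8]
      exact h7.symm
    set u := prodD (b := b) θ.symm x (v, ζ) with hu
    have h5 := hd2 (v, ζ)
    rw [← hu, prodD_fibreScale ((hρs.contMDiffAt (hPo.mem_nhds h2)).mdifferentiableAt (by simp)),
      Prod.mk.injEq] at h5
    have h6 : formAt ψ' α x (v, ζ) = formAt ψ α y (u.1, u.2) := by
      show formL α (ψ' x) (derivAt ψ' x (v, ζ)) = formL α (ψ y) (derivAt ψ y u)
      rw [hd1, hψ'f]
    rw [h6, hform y h2.1, h5.1, h3, ← h5.2, ← h4, rotForm_smul,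
      Real.sq_sqrt (hq y h2).le]
    have h7 := (hGpos y h2.1).ne'
    field_simp

end Model

/-! ### Derivatives of forms along lines. -/

section Line

variable {X : Type*} [NormedAddCommGroup X] [NormedSpace ℝ X]

lemma fderiv_apply_eq_of_eventuallyEq {β : X → X →L[ℝ] ℝ} {x a w : X}
    (hβ : DifferentiableAt ℝ β x) {f : ℝ → ℝ} {f' : ℝ} (hf : HasDerivAt f f' 0)
    (he : ∀ᶠ t in nhds (0 : ℝ), β (x + t • a) w = f t) : fderiv ℝ β x a w = f' := by
  have h1 := hasDerivAt_clm_comp_line (s := 0) (u := a) (by simpa using hβ) w 0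
  simp only [zero_smul, smul_zero, add_zero, map_zero] at h1
  exact h1.unique (hf.congr_of_eventuallyEq he)

lemma eventually_line_mem {W : Set X} (hW : IsOpen W) {x : X} (hx : x ∈ W) (a : X) :
    ∀ᶠ t in nhds (0 : ℝ), x + t • a ∈ W := by
  have h1 : Continuous fun t : ℝ => x + t • a := by fun_prop
  exact h1.continuousAt.eventually (hW.mem_nhds (by simpa using hx))

end Line

/-! ### Consequences of the model: the contraction with ∂_r, the angular form and the pages. -/

section Model

variable {b d : ℕ}
  {B : Type v} [TopologicalSpace B] [ChartedSpace (EuclideanSpace ℝ (Fin b)) B]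
  [IsManifold (𝓡 b) ∞ B]
  {M : Type u} [TopologicalSpace M] [ChartedSpace (EuclideanSpace ℝ (Fin d)) M]
  [IsManifold (𝓡 d) ∞ M]
  {ι : B → M} {π : M → Circle} {α : OneForm d M} {δ : ℝ}
  {ψ : PartialDiffeomorph ((𝓡 b).prod 𝓘(ℝ, ℂ)) (𝓡 d) (B × ℂ) M ∞} {g : B × ℂ → ℝ}

/-- The contraction of `d(g (α_B + r² dθ))` with a radial vector. -/
lemma IsModel.dFormAt_radial (hα : IsSmoothForm α) (h : IsModel ι π α δ ψ g) {p : B} {r : ℝ}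
    {u : ℂ} (hx : (p, r • u) ∈ ψ.source) (v : EuclideanSpace ℝ (Fin b)) (ζ : ℂ) :
    dFormAt ψ α (p, r • u) ((0, u) : EuclideanSpace ℝ (Fin b) × ℂ) (v, ζ) =
      deriv (fun s : ℝ => g (p, s • u)) r * (restrictForm ι α p v + rotForm (r • u) ζ) +
        2 * g (p, r • u) * rotForm u ζ := by
  set χ := extChartAt (𝓡 b) p with hχ
  have hp : p ∈ χ.source := mem_extChartAt_source p
  have hS := ψ.open_source
  have hF := ψ.contMDiffOn_toFun
  set W := chartDomain (b := b) ψ.source p with hWdef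
  have hW : IsOpen W := isOpen_chartDomain hS p
  set x : EuclideanSpace ℝ (Fin b) × ℂ := (χ p, r • u) with hxdef
  have hxW : x ∈ W := mem_chartDomain (x := (p, r • u)) hp hx
  have hβ : DifferentiableAt ℝ (chartForm ψ α p) x :=
    ((contDiffOn_chartForm hα hS hF p).contDiffAt (hW.mem_nhds hxW)).differentiableAt (by simp)
  set G : EuclideanSpace ℝ (Fin b) × ℂ → ℝ := fun y => g (χ.symm y.1, y.2) with hG
  have hGx : DifferentiableAt ℝ G x :=
    (((h.smooth.comp (contMDiffOn_chart_prod ψ.source p) fun y hy => hy.2).contDiffOn).contDiffAt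
      (hW.mem_nhds hxW)).differentiableAt (by simp)
  have hform : ∀ y ∈ W, ∀ (v : EuclideanSpace ℝ (Fin b)) (ζ : ℂ), chartForm ψ α p y (v, ζ) =
      G y * (restrictForm ι α (χ.symm y.1) (chartD p y.1 v) + rotForm y.2 ζ) := fun y hy v ζ => by
    rw [chartForm_apply hS hF hy]
    exact h.form _ hy.2 _ _
  have hg : HasDerivAt (fun s : ℝ => g (p, s • u)) (deriv (fun s : ℝ => g (p, s • u)) r) r := by
    have h1 : HasDerivAt (fun s : ℝ => ((χ p, s • u) : EuclideanSpace ℝ (Fin b) × ℂ)) (0, (1 : ℝ) • u) r :=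
      (hasDerivAt_const r (χ p)).prodMk ((hasDerivAt_id r).smul_const u)
    have h2 := hGx.hasFDerivAt.comp_hasDerivAt r h1
    have h3 : (fun s : ℝ => g (p, s • u)) = G ∘ fun s : ℝ => (χ p, s • u) := by
      funext s
      simp [hG, χ.left_inv hp]
    rw [h3]
    exact h2.differentiableAt.hasDerivAt
  have hslice : ∀ y, y = χ p →
      restrictForm ι α (χ.symm y) (chartD p y v) = restrictForm ι α p v := by
    have key : ∀ q, q = p → formL (restrictForm ι α) q v = formL (restrictForm ι α) p v := by
      rintro _ rfl; rfl
    rintro _ rfl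
    rw [show chartD p (χ p) v = v from chartD_self p v]
    exact key _ (χ.left_inv hp)
  have h1 : fderiv ℝ (chartForm ψ α p) x (0, u) (v, ζ) =
      deriv (fun s : ℝ => g (p, s • u)) r * (restrictForm ι α p v + rotForm (r • u) ζ) +
        g (p, r • u) * rotForm u ζ := by
    have h2 : HasDerivAt (fun t : ℝ => restrictForm ι α p v + rotForm ((r + t) • u) ζ)
        (rotForm u ζ) 0 := by
      have h3 : (fun t : ℝ => restrictForm ι α p v + rotForm ((r + t) • u) ζ) =
          fun t : ℝ => (restrictForm ι α p v + rotForm (r • u) ζ) + t * rotForm u ζ := by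
        funext t
        simp only [rotForm, Complex.smul_re, Complex.smul_im, smul_eq_mul]
        ring
      rw [h3]
      simpa using ((hasDerivAt_id (0 : ℝ)).mul_const (rotForm u ζ)).const_add
        (restrictForm ι α p v + rotForm (r • u) ζ)
    have h3 : HasDerivAt (fun t : ℝ => g (p, (r + t) • u))
        (deriv (fun s : ℝ => g (p, s • u)) r) 0 :=
      HasDerivAt.comp_const_add (f := fun s : ℝ => g (p, s • u)) r 0 (by simpa using hg)
    have h4 := h3.mul h2
    simp only [add_zero] at h4
    refine fderiv_apply_eq_of_eventuallyEq hβ h4 ?_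
    filter_upwards [eventually_line_mem hW hxW (0, u)] with t ht
    rw [hform _ ht]
    have h5 : (x + t • ((0, u) : EuclideanSpace ℝ (Fin b) × ℂ)).1 = χ p := by simp [hxdef]
    have h6 : (x + t • ((0, u) : EuclideanSpace ℝ (Fin b) × ℂ)).2 = (r + t) • u := by
      simp [hxdef, add_smul]
    rw [hslice _ h5]
    simp only [hG, h5, h6, χ.left_inv hp, Pi.mul_apply]
  -- At the point ru the value on (0, u) is zero because rotForm(ru, u) = 0, so the derivative of g
  -- does not enter.
  have h2 : fderiv ℝ (chartForm ψ α p) x (v, ζ) (0, u) = -(g (p, r • u) * rotForm u ζ) := by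
    have h3 : HasDerivAt (fun t : ℝ => G (x + t • (v, ζ))) (fderiv ℝ G x (v, ζ)) 0 := by
      have := hasDerivAt_comp_line (s := 0) (u := (v, ζ)) (f := G) (x := x) (by simpa using hGx)
      simpa using this
    have h4 := h3.mul ((hasDerivAt_id (0 : ℝ)).mul_const (rotForm ζ u))
    have h5 : G x = g (p, r • u) := by simp [hG, hxdef, χ.left_inv hp]
    have h6 : rotForm ζ u = -rotForm u ζ := by unfold rotForm; ring
    refine fderiv_apply_eq_of_eventuallyEq hβ (h4.congr_deriv ?_) ?_
    · simp [h5, h6]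
    · filter_upwards [eventually_line_mem hW hxW (v, ζ)] with t ht
      rw [hform _ ht, map_zero]
      simp only [Pi.mul_apply, id]
      refine congrArg (G (x + t • (v, ζ)) * ·) ?_
      have h7 : ∀ q, restrictForm ι α q (0 : EuclideanSpace ℝ (Fin b)) = 0 := fun q =>
        map_zero (formL (restrictForm ι α) q)
      rw [h7]
      simp only [hxdef, rotForm, Prod.snd_add, Prod.smul_snd, Complex.add_re, Complex.add_im,
        Complex.smul_re, Complex.smul_im, smul_eq_mul]
      ring
  have h3 := extD_chartForm' hα hS hF (x := (p, r • u)) hp hx (0, u) (v, ζ)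
  rw [map_zero, show chartD p (extChartAt (𝓡 b) p p) v = v from chartD_self p v] at h3
  refine h3.symm.trans ?_
  show fderiv ℝ (chartForm ψ α p) x (0, u) (v, ζ) - fderiv ℝ (chartForm ψ α p) x (v, ζ) (0, u) = _
  rw [h1, h2]
  ring

namespace IsBindingTrivialization

lemma coe_angle (h : IsBindingTrivialization ι π δ ψ) {p : B} {z : ℂ} (hz : z ≠ 0)
    (hx : (p, z) ∈ ψ.source) : (π (ψ (p, z)) : ℂ) = ‖z‖⁻¹ • z := by
  have hn : 0 < ‖z‖ := norm_pos_iff.2 hz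
  obtain ⟨u, hu⟩ : ∃ u : Circle, (u : ℂ) = ‖z‖⁻¹ • z :=
    ⟨⟨‖z‖⁻¹ • z, by
      rw [Submonoid.unitSphere, Submonoid.mem_mk]
      simp [hn.ne']⟩, rfl⟩
  have h1 : ‖z‖ • (u : ℂ) = z := by
    rw [hu, smul_smul, mul_inv_cancel₀ hn.ne', one_smul]
  have h2 := h.angle p ‖z‖ u hn (h.mem_source.1 hx)
  rw [h1] at h2
  rw [h2, hu]

lemma notMem_range (h : IsBindingTrivialization ι π δ ψ) {p : B} {z : ℂ} (hz : z ≠ 0)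
    (hx : (p, z) ∈ ψ.source) : ψ (p, z) ∉ Set.range ι := by
  rintro ⟨p', hp'⟩
  rw [← h.zero_section] at hp'
  exact hz (congrArg Prod.snd (ψ.toPartialEquiv.injOn (h.zero_mem p') hx hp')).symm

/-- The form `dπ` in an adapted trivialization is `dθ`. -/
lemma angularForm_derivAt (h : IsBindingTrivialization ι π δ ψ) {p : B} {z : ℂ} (hz : z ≠ 0)
    (hx : (p, z) ∈ ψ.source) (v : EuclideanSpace ℝ (Fin b)) (ζ : ℂ) :
    angularForm (d := d) π (ψ (p, z)) (derivAt (d := d) ψ (p, z) (v, ζ)) = rotForm z ζ / ‖z‖ ^ 2 := by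
  have hn : 0 < ‖z‖ := norm_pos_iff.2 hz
  -- The derivative of 1/‖w‖ need not be known: it contributes a real multiple of z, which drops out
  -- of the imaginary part after multiplication by the conjugate of z/‖z‖.
  obtain ⟨N', hN'⟩ : ∃ N' : ℂ →L[ℝ] ℝ, HasFDerivAt (fun w : ℂ => ‖w‖⁻¹) N' z :=
    ⟨_, (((contDiffAt_norm ℝ hz).differentiableAt one_ne_zero).inv hn.ne').hasFDerivAt⟩
  have hf := HasFDerivAt.fun_smul (c := fun w : ℂ => ‖w‖⁻¹) (f := fun w : ℂ => w) hN'
    (hasFDerivAt_id z)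
  have hf2 := hf.hasMFDerivAt.comp (p, z) (hasMFDerivAt_snd (I := 𝓡 b) (I' := 𝓘(ℝ, ℂ)) (p, z))
  have hopen : IsOpen (ψ.source ∩ {x | x.2 ≠ 0}) :=
    ψ.open_source.inter (isOpen_ne.preimage continuous_snd)
  have he : (fun x : B × ℂ => (π (ψ x) : ℂ)) =ᶠ[nhds (p, z)]
      (fun w : ℂ => ‖w‖⁻¹ • w) ∘ Prod.snd := by
    filter_upwards [hopen.mem_nhds ⟨hx, hz⟩] with x hx'
    exact h.coe_angle hx'.2 hx'.1
  have hd : MDifferentiableAt (𝓡 d) 𝓘(ℝ, ℂ) (fun q => (π q : ℂ)) (ψ (p, z)) := by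
    have hf3 : MDifferentiableAt ((𝓡 b).prod 𝓘(ℝ, ℂ)) 𝓘(ℝ, ℂ)
        (fun x : B × ℂ => (π (ψ x) : ℂ)) (ψ.symm (ψ (p, z))) := by
      have : ψ.symm (ψ (p, z)) = (p, z) := ψ.left_inv hx
      rw [this]
      exact (hf2.congr_of_eventuallyEq he).mdifferentiableAt
    have hs : MDifferentiableAt (𝓡 d) ((𝓡 b).prod 𝓘(ℝ, ℂ)) ψ.symm (ψ (p, z)) :=
      ψ.symm.mdifferentiableAt (by simp) (ψ.map_source hx)
    refine (hf3.comp _ hs).congr_of_eventuallyEq ?_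
    filter_upwards [ψ.open_target.mem_nhds (ψ.map_source hx)] with q hq
    exact congrArg (fun q => (π q : ℂ)) (ψ.right_inv hq).symm
  have hc := mfderiv_comp (p, z) hd (ψ.mdifferentiableAt (by simp) hx)
  have hc2 : (mfderiv (𝓡 d) 𝓘(ℝ, ℂ) (fun q => (π q : ℂ)) (ψ (p, z)) (derivAt ψ (p, z) (v, ζ)) : ℂ)
      = ‖z‖⁻¹ • ζ + N' ζ • z := by
    have h1 := DFunLike.congr_fun hc (v, ζ)
    have h2 := DFunLike.congr_fun (hf2.congr_of_eventuallyEq he).mfderiv (v, ζ)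
    exact h1.symm.trans h2
  have h3 : angularForm (d := d) π (ψ (p, z)) (derivAt (d := d) ψ (p, z) (v, ζ)) =
      ((starRingEnd ℂ (π (ψ (p, z)) : ℂ)) * (‖z‖⁻¹ • ζ + N' ζ • z)).im := by
    rw [← hc2]
    rfl
  rw [h3, h.coe_angle hz hx]
  simp only [rotForm, Complex.mul_im, Complex.add_im, Complex.add_re, Complex.smul_re,
    Complex.smul_im, smul_eq_mul, Complex.conj_re, Complex.conj_im]
  field_simp
  ring

lemma mem_openPage (h : IsBindingTrivialization ι π δ ψ) (p : B) (t : Circle) {r : ℝ} (hr : 0 < r)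
    (hrδ : r < δ) : ψ (p, r • (t : ℂ)) ∈ openPage ι π t := by
  have hx : (p, r • (t : ℂ)) ∈ ψ.source := by
    rw [h.mem_source, norm_smul, Circle.norm_coe, mul_one, Real.norm_of_nonneg hr.le]
    exact hrδ
  exact ⟨h.notMem_range (smul_ne_zero hr.ne' (Circle.coe_ne_zero t)) hx, h.angle p r t hr hrδ⟩

lemma contMDiffAt_ray (h : IsBindingTrivialization ι π δ ψ) (p : B) (u : ℂ) :
    ContMDiffAt 𝓘(ℝ, ℝ) (𝓡 d) ∞ (fun s : ℝ => ψ (p, s • u)) 0 := by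
  have h1 : ContMDiff 𝓘(ℝ, ℝ) ((𝓡 b).prod 𝓘(ℝ, ℂ)) ∞ fun s : ℝ => (p, s • u) :=
    contMDiff_const.prodMk (contDiff_id.smul contDiff_const).contMDiff
  have h2 : (p, (0 : ℝ) • u) ∈ ψ.source := by
    rw [zero_smul]
    exact h.zero_mem p
  exact (ψ.contMDiffOn_toFun.contMDiffAt (ψ.open_source.mem_nhds h2)).comp 0 h1.contMDiffAt

lemma mem_page (h : IsBindingTrivialization ι π δ ψ) (p : B) (t : Circle) : ι p ∈ page ι π t := by
  have h1 := (h.contMDiffAt_ray p t).continuousAt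
  have h2 : Filter.Tendsto (fun s : ℝ => ψ (p, s • (t : ℂ))) (nhdsWithin 0 (Set.Ioi 0))
      (nhds (ι p)) := by
    have h3 := h1.tendsto
    simp only [zero_smul, h.zero_section] at h3
    exact h3.mono_left nhdsWithin_le_nhds
  refine mem_closure_of_tendsto h2 ?_
  filter_upwards [Ioo_mem_nhdsGT h.pos] with s hs
  exact h.mem_openPage p t hs.1 hs.2

end IsBindingTrivialization

/-- Continuity of π at q carries the condition π = t over to the closure. -/
lemma mem_openPage_of_mem_page {t : Circle} {q : M} (hπ : ContinuousAt π q)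
    (hq : q ∈ page ι π t) (hι : q ∉ Set.range ι) : q ∈ openPage ι π t := by
  refine ⟨hι, ?_⟩
  have h1 := hπ.continuousWithinAt.mem_closure hq (t := {t}) fun x hx => hx.2
  rwa [closure_singleton] at h1

/-- The pages in an adapted trivialization. -/
lemma IsBindingTrivialization.page_inter_target (h : IsBindingTrivialization ι π δ ψ)
    (hπ : ∀ q ∉ Set.range ι, ContinuousAt π q) (t : Circle) :
    page ι π t ∩ ψ.target =
      {q | ∃ (p : B) (r : ℝ), 0 ≤ r ∧ r < δ ∧ q = ψ (p, r • (t : ℂ))} := by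
  ext q
  constructor
  · rintro ⟨hq, hqt⟩
    obtain ⟨⟨p, z⟩, hx, hxq⟩ : ∃ x : B × ℂ, x ∈ ψ.source ∧ ψ x = q :=
      ⟨ψ.symm q, ψ.map_target hqt, ψ.right_inv hqt⟩
    rcases eq_or_ne z 0 with rfl | hz
    · exact ⟨p, 0, le_rfl, h.pos, by rw [zero_smul, hxq]⟩
    · have h1 := h.notMem_range hz hx
      rw [hxq] at h1
      have h2 := (mem_openPage_of_mem_page (hπ q h1) hq h1).2
      have h3 := h.coe_angle hz hx
      rw [hxq, h2] at h3
      refine ⟨p, ‖z‖, norm_nonneg _, h.mem_source.1 hx, ?_⟩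
      rw [h3, smul_smul, mul_inv_cancel₀ (norm_ne_zero_iff.2 hz), one_smul, hxq]
  · rintro ⟨p, r, hr, hrδ, rfl⟩
    rcases hr.eq_or_lt with rfl | hr
    · rw [zero_smul]
      refine ⟨?_, ψ.map_source (h.zero_mem p)⟩
      rw [h.zero_section]
      exact h.mem_page p t
    · refine ⟨subset_closure (h.mem_openPage p t hr hrδ), ψ.map_source ?_⟩
      rw [h.mem_source, norm_smul, Circle.norm_coe, mul_one, Real.norm_of_nonneg hr.le]
      exact hrδ

end Model

/-! ### The extended multiple of the Liouville field. -/

section VectorField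

variable {b d : ℕ}
  {B : Type v} [TopologicalSpace B] [ChartedSpace (EuclideanSpace ℝ (Fin b)) B]
  [IsManifold (𝓡 b) ∞ B]
  {M : Type u} [TopologicalSpace M] [ChartedSpace (EuclideanSpace ℝ (Fin d)) M]
  [IsManifold (𝓡 d) ∞ M]
  {ι : B → M} {π : M → Circle} {α : OneForm d M} {δ : ℝ}
  {ψ : PartialDiffeomorph ((𝓡 b).prod 𝓘(ℝ, ℂ)) (𝓡 d) (B × ℂ) M ∞} {g : B × ℂ → ℝ}

/-- The image under a partial diffeomorphism of a constant vector field in the fibres. -/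
def fibreField (ψ : PartialDiffeomorph ((𝓡 b).prod 𝓘(ℝ, ℂ)) (𝓡 d) (B × ℂ) M ∞) (ζ : ℂ) (q : M) :
    EuclideanSpace ℝ (Fin d) :=
  derivAt (b := b) ψ (ψ.symm q) (0, ζ)

lemma fibreField_apply {x : B × ℂ} (hx : x ∈ ψ.source) (ζ : ℂ) :
    fibreField (b := b) (d := d) ψ ζ (ψ x) =
      derivAt ψ x ((0, ζ) : EuclideanSpace ℝ (Fin b) × ℂ) :=
  congrArg (fun y => derivAt (b := b) (d := d) ψ y ((0, ζ) : EuclideanSpace ℝ (Fin b) × ℂ)) (ψ.left_inv hx)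

lemma contMDiffOn_fibreField (ζ : ℂ) :
    ContMDiffOn (𝓡 d) (𝓡 d).tangent ∞
      (fun q => (⟨q, fibreField (b := b) (d := d) ψ ζ q⟩ : TangentBundle (𝓡 d) M)) ψ.target := by
  have h0 : ContMDiff ((𝓡 b).prod 𝓘(ℝ, ℂ)) ((𝓡 b).prod 𝓘(ℝ, ℂ)).tangent ∞
      (fun x : B × ℂ => (⟨x, ((0, ζ) : EuclideanSpace ℝ (Fin b) × ℂ)⟩ :
        TangentBundle ((𝓡 b).prod 𝓘(ℝ, ℂ)) (B × ℂ))) := by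
    have h1 : ContMDiff (𝓡 b) (𝓡 b).tangent ∞
        (fun p : B => (⟨p, 0⟩ : TangentBundle (𝓡 b) B)) :=
      Bundle.contMDiff_zeroSection ℝ (TangentSpace (𝓡 b) : B → Type)
    have h2 : ContMDiff 𝓘(ℝ, ℂ) 𝓘(ℝ, ℂ).tangent ∞
        (fun z : ℂ => (⟨z, ζ⟩ : TangentBundle 𝓘(ℝ, ℂ) ℂ)) :=
      contMDiff_vectorSpace_iff_contDiff.2 contDiff_const
    exact contMDiff_equivTangentBundleProd_symm.comp
      ((h1.comp contMDiff_fst).prodMk (h2.comp contMDiff_snd))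
  have h1 : ContMDiffOn ((𝓡 b).prod 𝓘(ℝ, ℂ)).tangent (𝓡 d).tangent ∞
      (tangentMap ((𝓡 b).prod 𝓘(ℝ, ℂ)) (𝓡 d) ψ)
      (Bundle.TotalSpace.proj ⁻¹' ψ.source) :=
    (ψ.contMDiffOn_toFun.contMDiffOn_tangentMapWithin (m := ∞) (by simp)
      ψ.open_source.uniqueMDiffOn).congr fun v hv =>
        (tangentMapWithin_eq_tangentMap (ψ.open_source.uniqueMDiffOn _ hv)
          (ψ.mdifferentiableAt (by simp) hv)).symm
  have h2 := h1.comp (h0.comp_contMDiffOn ψ.contMDiffOn_invFun) fun q hq => ψ.map_target hq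
  refine h2.congr fun q hq => ?_
  exact congrArg (fun q' => (⟨q', fibreField (b := b) (d := d) ψ ζ q⟩ : TangentBundle (𝓡 d) M))
    (ψ.right_inv hq).symm

/-- The negative of the field is the initial velocity of the curve s ↦ ψ(p, st), which runs into the
page. The field is not tangent to B because its disk component is -t ≠ 0. -/
lemma IsBindingTrivialization.isOutward_fibreField (h : IsBindingTrivialization ι π δ ψ)
    (t : Circle) (p : B) :
    IsOutward (b := b) ι π t p (fibreField (b := b) (d := d) ψ (-(t : ℂ)) (ι p)) := by
  have h0 : fibreField (b := b) (d := d) ψ (-(t : ℂ)) (ι p) =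
      derivAt (b := b) ψ (p, 0) (0, -(t : ℂ)) := by
    rw [← h.zero_section, fibreField_apply (h.zero_mem p)]
  rw [h0]
  refine ⟨fun w hw => ?_, fun s => ψ (p, s • (t : ℂ)), h.contMDiffAt_ray p t, ?_, ?_⟩
  · have h1 := derivAt_zero ψ.open_source ψ.contMDiffOn_toFun h.zero_mem h.zero_section p w
    have h2 := (derivAt_bijective (h.zero_mem p)).1 (h1.trans hw)
    have h3 := congrArg Prod.snd h2
    exact Circle.coe_ne_zero t (neg_eq_zero.1 h3.symm)
  · have h1 : HasMFDerivAt 𝓘(ℝ, ℝ) ((𝓡 b).prod 𝓘(ℝ, ℂ)) (fun s : ℝ => (p, s • (t : ℂ))) 0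
        (((0 : ℝ →L[ℝ] EuclideanSpace ℝ (Fin b))).prod
          (ContinuousLinearMap.toSpanSingleton ℝ (t : ℂ))) := by
      refine (hasMFDerivAt_const p (0 : ℝ)).prodMk (HasFDerivAt.hasMFDerivAt ?_)
      exact (ContinuousLinearMap.toSpanSingleton ℝ (t : ℂ)).hasFDerivAt
    have h2 : MDifferentiableAt ((𝓡 b).prod 𝓘(ℝ, ℂ)) (𝓡 d) ψ (p, (0 : ℝ) • (t : ℂ)) :=
      ψ.mdifferentiableAt (by simp) (by rw [zero_smul]; exact h.zero_mem p)
    have h3 := DFunLike.congr_fun (h2.hasMFDerivAt.comp (0 : ℝ) h1).mfderiv (1 : ℝ)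
    have h4 : (mfderiv 𝓘(ℝ, ℝ) (𝓡 d) (fun s : ℝ => ψ (p, s • (t : ℂ))) 0 (1 : ℝ) :
        EuclideanSpace ℝ (Fin d)) = -derivAt (b := b) ψ (p, 0) (0, -(t : ℂ)) := by
      have h5 : (mfderiv 𝓘(ℝ, ℝ) (𝓡 d) (fun s : ℝ => ψ (p, s • (t : ℂ))) 0 (1 : ℝ) :
        EuclideanSpace ℝ (Fin d)) =
          derivAt (b := b) ψ (p, (0 : ℝ) • (t : ℂ)) (0, (1 : ℝ) • (t : ℂ)) := h3
      rw [h5, one_smul, zero_smul, ← map_neg]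
      exact congrArg (derivAt (b := b) (d := d) ψ (p, 0)) (by simp)
    have h6 : ψ (p, (0 : ℝ) • (t : ℂ)) = ι p := by rw [zero_smul, h.zero_section]
    have key : ∀ (q q' : M) (v v' : EuclideanSpace ℝ (Fin d)), q = q' → v = v' →
        (⟨q, v⟩ : TangentBundle (𝓡 d) M) = ⟨q', v'⟩ := by
      rintro q _ v _ rfl rfl; rfl
    exact key _ _ _ _ h6 h4
  · filter_upwards [Ioo_mem_nhdsGT h.pos] with s hs
    exact h.mem_openPage p t hs.1 hs.2

end VectorField

/-! ### The model for a supporting form, the sign of ∂_r g, and convexity. -/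

section Main

variable {n : ℕ}
  {B : Type v} [TopologicalSpace B] [ChartedSpace (EuclideanSpace ℝ (Fin (2 * n + 1))) B]
  [IsManifold (𝓡 (2 * n + 1)) ∞ B]
  {M : Type u} [TopologicalSpace M] [ChartedSpace (EuclideanSpace ℝ (Fin (2 * (n + 1) + 1))) M]
  [IsManifold (𝓡 (2 * (n + 1) + 1)) ∞ M]
  {ι : B → M} {π : M → Circle} {α : OneForm (2 * (n + 1) + 1) M} {δ : ℝ}
  {ψ : PartialDiffeomorph ((𝓡 (2 * n + 1)).prod 𝓘(ℝ, ℂ)) (𝓡 (2 * (n + 1) + 1)) (B × ℂ) M ∞}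
  {g : B × ℂ → ℝ}

/-- The normal form comes before the sign of K: it shows that α vanishes on the disk directions
along the binding, which the splitting of the volume requires. -/
lemma Supports.exists_isModel [CompactSpace B] [T2Space B] [T2Space M] (hsupp : Supports ι π α)
    (h : IsBindingTrivialization ι π δ ψ) :
    ∃ (δ' : ℝ) (ψ' : PartialDiffeomorph ((𝓡 (2 * n + 1)).prod 𝓘(ℝ, ℂ)) (𝓡 (2 * (n + 1) + 1))
      (B × ℂ) M ∞) (g : B × ℂ → ℝ), IsModel ι π α δ' ψ' g := by
  have hα := hsupp.contact.smooth
  obtain ⟨δ₁, ψ₁, h₁, hrad⟩ := h.exists_radial hα (sliceNondegenerate_binding hsupp h)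
  obtain ⟨O, G, K, hO, hO0, hOs, hG, hK, hGK, hK0⟩ := h₁.exists_normal_form hα hrad
    fun p => (hsupp.binding_contact.nondegenerate p).1
  have hfib : ∀ (p : B) (ζ : ℂ),
      formAt ψ₁ α (p, 0) ((0, ζ) : EuclideanSpace ℝ (Fin (2 * n + 1)) × ℂ) = 0 := fun p ζ => by
    rw [(hGK _ (hO0 p)).2, rotForm_zero_left]
    have h7 : restrictForm ι α p (0 : EuclideanSpace ℝ (Fin (2 * n + 1))) = 0 :=
        map_zero (formL (restrictForm ι α) p)
    rw [h7]
    simp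
  refine ContactOpenBook.exists_isModel h₁ hO hO0 hOs hG hK (fun x hx => (hGK x hx).1)
    (fun p => ?_) fun x hx => (hGK x hx).2
  rw [hK0]
  exact half_pos (dFormAt_fibre_pos hsupp h₁ hrad hfib p)

/-- The contraction of dα with ∂_r is evaluated on the Reeb vector R, where it is zero. The factor
(α_B + r² dθ)(R) is 1/g > 0 since α(R) = 1, and 2 g r dθ(R) > 0 since dπ(R) > 0; hence the
coefficient g_r must be negative. -/
lemma IsModel.deriv_neg (h : IsModel ι π α δ ψ g) (hsupp : Supports ι π α) (p : B) (u : Circle)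
    {r : ℝ} (hr : 0 < r) (hrδ : r < δ) : deriv (fun s : ℝ => g (p, s • (u : ℂ))) r < 0 := by
  have hx : (p, r • (u : ℂ)) ∈ ψ.source := by
    rw [h.triv.mem_source, norm_smul, Circle.norm_coe, mul_one, Real.norm_of_nonneg hr.le]
    exact hrδ
  have hz : r • (u : ℂ) ≠ 0 := smul_ne_zero hr.ne' (Circle.coe_ne_zero u)
  obtain ⟨R, hR⟩ := hsupp.contact.exists_reeb (ψ (p, r • (u : ℂ)))
  obtain ⟨⟨v, ζ⟩, rfl⟩ := (derivAt_bijective hx).2 R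
  have h1 := hsupp.reeb_transverse _ _ (h.triv.notMem_range hz hx) hR
  rw [h.triv.angularForm_derivAt hz hx] at h1
  have h2 : 0 < rotForm (u : ℂ) ζ := by
    have h3 : rotForm (r • (u : ℂ)) ζ = r * rotForm u ζ := by
      simp only [rotForm, Complex.smul_re, Complex.smul_im, smul_eq_mul]
      ring
    rw [h3] at h1
    have h4 := (div_pos_iff_of_pos_right (by positivity)).1 h1
    exact (mul_pos_iff_of_pos_left hr).1 h4
  have h3 : dFormAt ψ α (p, r • (u : ℂ))
      ((0, (u : ℂ)) : EuclideanSpace ℝ (Fin (2 * n + 1)) × ℂ) (v, ζ) = 0 := by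
    have h4 := hR.1 (derivAt (b := 2 * n + 1) ψ (p, r • (u : ℂ)) (0, (u : ℂ)))
    have h5 := dForm_swap α (ψ (p, r • (u : ℂ)))
      (derivAt (b := 2 * n + 1) ψ (p, r • (u : ℂ)) (0, (u : ℂ)))
      (derivAt ψ (p, r • (u : ℂ)) (v, ζ))
    exact h5.trans (neg_eq_zero.2 h4)
  rw [h.dFormAt_radial hsupp.contact.smooth hx] at h3
  have h4 : g (p, r • (u : ℂ)) * (restrictForm ι α p v + rotForm (r • (u : ℂ)) ζ) = 1 :=
    (h.form _ hx v ζ).symm.trans hR.2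
  have hg := h.pos _ hx
  have h5 : 0 < restrictForm ι α p v + rotForm (r • (u : ℂ)) ζ := by
    by_contra hneg
    have := mul_nonpos_of_nonneg_of_nonpos hg.le (not_lt.1 hneg)
    linarith
  have h6 : 0 < 2 * g (p, r • (u : ℂ)) * rotForm (u : ℂ) ζ := by positivity
  by_contra hneg
  have := mul_nonneg (not_lt.1 hneg) h5.le
  linarith

/-- The pages are symplectic. -/
lemma Supports.symplectic (hsupp : Supports ι π α) {q : M} (hq : q ∉ Set.range ι)
    (v : EuclideanSpace ℝ (Fin (2 * (n + 1) + 1))) (hv : angularForm π q v = 0)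
    (hw : ∀ w : EuclideanSpace ℝ (Fin (2 * (n + 1) + 1)), angularForm π q w = 0 →
      dForm α q v w = 0) : v = 0 := by
  obtain ⟨R, hR⟩ := hsupp.contact.exists_reeb q
  have hpos : 0 < formL (angularForm π) q R := hsupp.reeb_transverse q R hq hR
  have hv' : formL (angularForm π) q v = 0 := hv
  have hR0 : ∀ w, dFormL α q R w = 0 := hR.1
  have hR1 : formL α q R = 1 := hR.2
  have hvR : dFormL α q v R = 0 := (dForm_swap α q v R).trans (neg_eq_zero.2 (hR.1 v))
  -- The Reeb vector is transverse to ker dπ and dα-orthogonal to v, so orthogonality of v to the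
  -- page extends to all vectors.
  have hall : ∀ x, dFormL α q v x = 0 := fun x => by
    set c := formL (angularForm π) q x / formL (angularForm π) q R with hc
    have h1 : dFormL α q v (x - c • R) = 0 := hw _ (by
      show formL (angularForm π) q (x - c • R) = 0
      rw [map_sub, map_smul, smul_eq_mul, hc, div_mul_cancel₀ _ hpos.ne', sub_self])
    rwa [map_sub, map_smul, hvR, smul_zero, sub_zero] at h1
  -- By nondegeneracy of α such a v is a multiple of R, and dπ(v) = 0 with dπ(R) > 0 makes the
  -- multiple zero.
  have h1 := (hsupp.contact.nondegenerate q).2 (v - formL α q v • R)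
    (by simp [hR1]) fun x _ => by simp [hall, hR0]
  have h2 : v = formL α q v • R := sub_eq_zero.1 h1
  rw [h2, map_smul, smul_eq_mul] at hv'
  rcases mul_eq_zero.1 hv' with h3 | h3
  · rw [h2, h3, zero_smul]
  · exact absurd h3 hpos.ne'

/-- Near the binding, the Liouville field of a page is a negative multiple of `∂_r`. -/
lemma IsModel.exists_liouville (h : IsModel ι π α δ ψ g) (hsupp : Supports ι π α) (p : B)
    (t : Circle) {r : ℝ} (hr : 0 < r) (hrδ : r < δ) :
    ∃ (f : ℝ) (X : EuclideanSpace ℝ (Fin (2 * (n + 1) + 1))), 0 < f ∧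
      IsLiouvilleVector π α (ψ (p, r • (t : ℂ))) X ∧
      derivAt (b := 2 * n + 1) ψ (p, r • (t : ℂ)) (0, -(t : ℂ)) = f • X := by
  have hx : (p, r • (t : ℂ)) ∈ ψ.source := by
    rw [h.triv.mem_source, norm_smul, Circle.norm_coe, mul_one, Real.norm_of_nonneg hr.le]
    exact hrδ
  have hz : r • (t : ℂ) ≠ 0 := smul_ne_zero hr.ne' (Circle.coe_ne_zero t)
  have hneg := h.deriv_neg hsupp p t hr hrδ
  have hg := h.pos _ hx
  set g' := deriv (fun s : ℝ => g (p, s • (t : ℂ))) r with hg'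
  -- On the page dθ = 0, so i_{∂_r} dα = g_r α_B and α = g α_B. The Liouville vector is therefore c
  -- ∂_r with c = g/g_r < 0, and -∂_r is -1/c > 0 times it.
  set c := g (p, r • (t : ℂ)) / g' with hc
  set T := derivAt (b := 2 * n + 1) (d := 2 * (n + 1) + 1) ψ (p, r • (t : ℂ)) (0, (t : ℂ)) with hT
  have hrot : ∀ ζ, rotForm (r • (t : ℂ)) ζ = r * rotForm t ζ := fun ζ => by
    simp only [rotForm, Complex.smul_re, Complex.smul_im, smul_eq_mul]
    ring
  have hang : ∀ (v : EuclideanSpace ℝ (Fin (2 * n + 1))) (ζ : ℂ),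
      formL (angularForm π) (ψ (p, r • (t : ℂ))) (derivAt ψ (p, r • (t : ℂ)) (v, ζ)) =
        rotForm (r • (t : ℂ)) ζ / ‖r • (t : ℂ)‖ ^ 2 :=
    h.triv.angularForm_derivAt hz hx
  refine ⟨-c⁻¹, c • T, ?_, ⟨?_, fun w hw => ?_⟩, ?_⟩
  · rw [← inv_neg]
    exact inv_pos.2 (neg_pos.2 (div_neg_of_pos_of_neg hg hneg))
  · show formL (angularForm π) (ψ (p, r • (t : ℂ))) (c • T) = 0
    rw [map_smul, hT, hang, hrot, show rotForm (t : ℂ) t = 0 by unfold rotForm; ring]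
    simp
  · obtain ⟨⟨v, ζ⟩, rfl⟩ := (derivAt_bijective hx).2 w
    have h1 : rotForm (t : ℂ) ζ = 0 := by
      have h2 := (hang v ζ).symm.trans hw
      rw [div_eq_zero_iff, hrot] at h2
      rcases h2 with h2 | h2
      · exact (mul_eq_zero.1 h2).resolve_left hr.ne'
      · exact absurd h2 (by positivity)
    have h3 : dFormL α (ψ (p, r • (t : ℂ))) T (derivAt ψ (p, r • (t : ℂ)) (v, ζ)) =
        g' * restrictForm ι α p v := by
      have h4 := h.dFormAt_radial hsupp.contact.smooth hx v ζ
      rw [hrot, h1] at h4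
      refine Eq.trans h4 ?_
      ring
    have h5 : formL α (ψ (p, r • (t : ℂ))) (derivAt ψ (p, r • (t : ℂ)) (v, ζ)) =
        g (p, r • (t : ℂ)) * restrictForm ι α p v := by
      have h4 := h.form _ hx v ζ
      rw [hrot, h1] at h4
      refine Eq.trans h4 ?_
      ring
    show dFormL α (ψ (p, r • (t : ℂ))) (c • T) (derivAt ψ (p, r • (t : ℂ)) (v, ζ)) =
      formL α (ψ (p, r • (t : ℂ))) (derivAt ψ (p, r • (t : ℂ)) (v, ζ))
    rw [map_smul, smul_apply, h3, h5, smul_eq_mul, ← mul_assoc, hc,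
      div_mul_cancel₀ _ hneg.ne]
  · have hc0 : c ≠ 0 := (div_neg_of_pos_of_neg hg hneg).ne
    rw [smul_smul, neg_mul, inv_mul_cancel₀ hc0, neg_smul, one_smul, hT, ← map_neg]
    simp

/-- The extension is the image of the constant field -t on the disk. On the page over t it is -∂_r,
and unlike the polar field it is smooth across r = 0. -/
lemma IsModel.isConvexBoundary (h : IsModel ι π α δ ψ g) (hsupp : Supports ι π α)
    (hπ : ∀ q ∉ Set.range ι, ContinuousAt π q) (t : Circle) :
    IsConvexBoundary (b := 2 * n + 1) ι π α t where
  boundary_eq := by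
    ext q
    constructor
    · rintro ⟨hq, hq'⟩
      by_contra hι
      exact hq' (mem_openPage_of_mem_page (hπ q hι) hq hι)
    · rintro ⟨p, rfl⟩
      exact ⟨h.triv.mem_page p t, fun hq => hq.1 ⟨p, rfl⟩⟩
  symplectic q hq v := hsupp.symplectic hq.1 v
  convex := by
    refine ⟨ψ.target, fibreField (b := 2 * n + 1) ψ (-(t : ℂ)), ψ.open_target, ?_,
      contMDiffOn_fibreField _, ?_, h.triv.isOutward_fibreField t⟩
    · rintro _ ⟨p, rfl⟩
      rw [← h.triv.zero_section]
      exact ψ.map_source (h.triv.zero_mem p)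
    · rintro q ⟨hqt, hq⟩
      have h1 : q ∈ page ι π t ∩ ψ.target := ⟨subset_closure hq, hqt⟩
      rw [h.triv.page_inter_target hπ] at h1
      obtain ⟨p, r, hr, hrδ, rfl⟩ := h1
      rcases hr.eq_or_lt with rfl | hr
      · rw [zero_smul, h.triv.zero_section] at hq
        exact absurd ⟨p, rfl⟩ hq.1
      have hx : (p, r • (t : ℂ)) ∈ ψ.source := by
        rw [h.triv.mem_source, norm_smul, Circle.norm_coe, mul_one, Real.norm_of_nonneg hr.le]
        exact hrδ
      rw [fibreField_apply hx]
      exact h.exists_liouville hsupp p t hr hrδ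

end Main

end ContactOpenBook

end

theorem mainTheorem8 (n : ℕ)
    {B : Type*} [TopologicalSpace B] [CompactSpace B]
    [ChartedSpace (EuclideanSpace ℝ (Fin (2 * n + 1))) B] [IsManifold (𝓡 (2 * n + 1)) ∞ B]
    {M : Type*} [TopologicalSpace M] [T2Space M] [CompactSpace M]
    [ChartedSpace (EuclideanSpace ℝ (Fin (2 * (n + 1) + 1))) M]
    [IsManifold (𝓡 (2 * (n + 1) + 1)) ∞ M]
    (ι : B → M) (π : M → Circle) (α : ContactOpenBook.OneForm (2 * (n + 1) + 1) M)
    (hbook : ContactOpenBook.IsOpenBook (b := 2 * n + 1) (d := 2 * (n + 1) + 1) ι π)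
    (hsupp : ContactOpenBook.Supports ι π α) :
    (∃ (δ : ℝ)
      (ψ : PartialDiffeomorph ((𝓡 (2 * n + 1)).prod 𝓘(ℝ, ℂ)) (𝓡 (2 * (n + 1) + 1)) (B × ℂ) M ∞)
      (g : B × ℂ → ℝ),
      ContactOpenBook.IsBindingTrivialization ι π δ ψ ∧
      ContMDiffOn ((𝓡 (2 * n + 1)).prod 𝓘(ℝ, ℂ)) 𝓘(ℝ, ℝ) ∞ g
        (Set.univ ×ˢ Metric.ball (0 : ℂ) δ) ∧
      (∀ (p : B), ∀ z ∈ Metric.ball (0 : ℂ) δ, 0 < g (p, z)) ∧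
      -- `ψ^* α = g (α_B + r² dθ)`, where `r² dθ = x dy - y dx`
      (∀ (p : B), ∀ z ∈ Metric.ball (0 : ℂ) δ,
        ∀ (w : TangentSpace (𝓡 (2 * n + 1)) p) (ζ : ℂ),
          α (ψ (p, z)) (mfderiv ((𝓡 (2 * n + 1)).prod 𝓘(ℝ, ℂ)) (𝓡 (2 * (n + 1) + 1)) ψ (p, z)
            ((w, ζ) : EuclideanSpace ℝ (Fin (2 * n + 1)) × ℂ)) =
          g (p, z) * (ContactOpenBook.restrictForm (b := 2 * n + 1) ι α p w
            + (z.re * ζ.im - z.im * ζ.re))) ∧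
      -- `∂_r g < 0` for `r > 0`
      (∀ (p : B) (u : Circle) (r : ℝ), 0 < r → r < δ →
        deriv (fun s : ℝ => g (p, s • (u : ℂ))) r < 0) ∧
      -- in this model the page over `t` is `{θ = t}`, with boundary `{r = 0}`
      (∀ t : Circle, ContactOpenBook.page ι π t ∩ ψ.target =
        {q | ∃ (p : B) (r : ℝ), 0 ≤ r ∧ r < δ ∧ q = ψ (p, r • (t : ℂ))})) ∧
    (∀ t : Circle, ContactOpenBook.IsConvexBoundary (b := 2 * n + 1) ι π α t) := by
  have hT2 : T2Space B := hbook.embedding.isEmbedding.t2Space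
  have hπ : ∀ q ∉ Set.range ι, ContinuousAt π q := fun q hq =>
    (hbook.submersion q hq).contMDiffAt.continuousAt
  obtain ⟨δ₀, φ, hφ⟩ := hbook.tubular
  obtain ⟨δ, ψ, g, h⟩ := hsupp.exists_isModel hφ
  have hmem : ∀ (p : B), ∀ z ∈ Metric.ball (0 : ℂ) δ, (p, z) ∈ ψ.source := fun p z hz => by
    rw [h.triv.source_eq]
    exact ⟨trivial, hz⟩
  refine ⟨⟨δ, ψ, g, h.triv, ?_, fun p z hz => h.pos _ (hmem p z hz),
    fun p z hz w ζ => h.form _ (hmem p z hz) w ζ, fun p u r => h.deriv_neg hsupp p u,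
    h.triv.page_inter_target hπ⟩, h.isConvexBoundary hsupp hπ⟩
  rw [← h.triv.source_eq]
  exact h.smooth
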